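/- Let $\Omega\subset\mathbb{R}^3$ be a bounded convex domain with $C^2$ boundary of positive Gaussian curvature. Let $0\le\gamma\le 1$, and let $B$ be a measurable cross-section satisfying, for some constant $C_B>0$, $$0\le B(r,\theta)\le C_B\, r^{\gamma}\cos\theta\sin\theta ,\qquad r>0,\ 0\le\theta\le\tfrac{\pi}{2}.$$ For $v,v_*\in\mathbb{R}^3$ let $\alpha$ be the unit vector with spherical coordinates $(\theta,\varphi)$ relative to the polar axis $v_*-v$, put $v'=v+((v_*-v)\cdot\alpha)\alpha$ and $v'_*=v_*-((v_*-v)\cdot\alpha)\alpha$, and let $$Q(F,G)(v)=\int_{\mathbb{R}^3}\int_0^{2\pi}\int_0^{\pi/2}\bigl(F(v')G(v'_*)-F(v)G(v_*)\bigr)B(|v-v_*|,\theta)\,d\theta\, d\varphi\, dv_* .$$ With $M(v)=\pi^{-3/2}e^{-|v|^2}$, let $L f=M^{-1/2}\bigl(Q(M,M^{1/2}f)+Q(M^{1/2}f,M)\bigr)$, let $\nu(v)=\int_{\mathbb{R}^3}\int_0^{2\pi}\int_0^{\pi/2}M(v_*)B(|v-v_*|,\theta)\,d\theta\, d\varphi\,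 dv_*$, and let $K$ be the operator with $Lf=-\nu f+Kf$, acting in the velocity variable $v$ of functions $f(x,v)$. For $x\in\Omega$, $v\in\mathbb{R}^3$ put $$\tau_-(x,v)=\inf\{t>0: x-tv\notin\Omega\},\qquad (S_\Omega h)(x,v)=\int_0^{\tau_-(x,v)}e^{-\nu(v)s}h(x-sv,v)\,ds ,$$ and write $\widetilde h$ for the extension of $h$ by zero from $\Omega\times\mathbb{R}^3$ to $\mathbb{R}^3\times\mathbb{R}^3$. For $0<s<1$ let $L^2_v(\mathbb{R}^3;H^s_x(\mathbb{R}^3))$ be the space of $u\in L^2(\mathbb{R}^3\times\mathbb{R}^3)$ whose norm $$\|u\|_{L^2_v(\mathbb{R}^3;H^s_x(\mathbb{R}^3))}=\Bigl(\|u\|_{L^2(\mathbb{R}^3\times\mathbb{R}^3)}^2+\int_{\mathbb{R}^3}\int_{\mathbb{R}^3}\int_{\mathbb{R}^3}\frac{|u(x,v)-u(y,v)|^2}{|x-y|^{3+2s}}\,dx\,dy\,dv\Bigr)^{1/2}$$ is finite. Then there is a constant $C>0$, depending only on $\Omega$ and $B$, such that for every $\epsilon\in(0,\tfrac12)$ and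 every $f\in L^2(\Omega\times\mathbb{R}^3)$ the function $\widetilde{S_\Omega K S_\Omega K f}$ belongs to $L^2_v(\mathbb{R}^3;H^{1/2-\epsilon}_x(\mathbb{R}^3))$ and $$\bigl\|\widetilde{S_\Omega K S_\Omega K f}\bigr\|_{L^2_v(\mathbb{R}^3;H^{1/2-\epsilon}_x(\mathbb{R}^3))}\le\frac{C}{\sqrt{\epsilon(1-2\epsilon)}}\,\|f\|_{L^2(\Omega\times\mathbb{R}^3)} .$$ In particular, for each $\epsilon_0<\tfrac12$ the norm is at most $C'\epsilon^{-1/2}\|f\|_{L^2(\Omega\times\mathbb{R}^3)}$ for all $\epsilon\in(0,\epsilon_0]$, with $C'$ independent of $\epsilon$ and $f$. -/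

import Mathlib

open MeasureTheory Set

noncomputable section

/-- Three-dimensional Euclidean space, for positions and for velocities. -/
abbrev E3 : Type := EuclideanSpace ℝ (Fin 3)

namespace KineticDomain

/-- `ρ` is a `C²` defining function of `Ω` near `q`: on some open neighbourhood `U` of `q` it is
twice continuously differentiable without critical points, and `Ω ∩ U = {x ∈ U | ρ x < 0}`. -/
def IsC2DefiningFunctionAt (Ω : Set E3) (ρ : E3 → ℝ) (q : E3) : Prop :=
  ∃ U : Set E3, IsOpen U ∧ q ∈ U ∧ ContDiffOn ℝ 2 ρ U ∧
    (∀ x ∈ U, fderiv ℝ ρ x ≠ 0) ∧ ∀ x ∈ U, (x ∈ Ω ↔ ρ x < 0)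

/-- Gaussian curvature at `q` of the level surface of `ρ` through `q`, computed in an orthonormal
basis `u, w` of the tangent plane `ker Dρ(q)`: the determinant of the second fundamental form
`D²ρ(q) / |Dρ(q)|` restricted to that plane. -/
def gaussianCurvature (ρ : E3 → ℝ) (q u w : E3) : ℝ :=
  (fderiv ℝ (fderiv ℝ ρ) q u u * fderiv ℝ (fderiv ℝ ρ) q w w
    - fderiv ℝ (fderiv ℝ ρ) q u w * fderiv ℝ (fderiv ℝ ρ) q w u) / ‖fderiv ℝ ρ q‖ ^ 2

/-- A bounded convex domain with `C²` boundary of positive Gaussian curvature. -/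
structure IsPositivelyCurved (Ω : Set E3) : Prop where
  isOpen : IsOpen Ω
  nonempty : Ω.Nonempty
  isBounded : Bornology.IsBounded Ω
  convex : Convex ℝ Ω
  curvature_pos : ∀ q ∈ frontier Ω, ∃ ρ : E3 → ℝ, IsC2DefiningFunctionAt Ω ρ q ∧
    ∀ u w : E3, ‖u‖ = 1 → ‖w‖ = 1 → inner ℝ u w = 0 →
      fderiv ℝ ρ q u = 0 → fderiv ℝ ρ q w = 0 → 0 < gaussianCurvature ρ q u w

/-- Backward exit time `inf {t > 0 | x - t v ∉ Ω}`, equal to `⊤` if the trajectory never leaves. -/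
def exitTime (Ω : Set E3) (x v : E3) : EReal :=
  sInf ((fun t : ℝ => (t : EReal)) '' {t : ℝ | 0 < t ∧ x - t • v ∉ Ω})

/-- The transport operator
`(S_Ω h)(x, v) = ∫_0^{τ_-(x,v)} e^{-ν(v) s} h(x - s v, v) ds` for a collision frequency `ν`. -/
def transport (Ω : Set E3) (ν : E3 → ℝ) (h : E3 × E3 → ℝ) (p : E3 × E3) : ℝ :=
  ∫ s in {s : ℝ | 0 < s ∧ (s : EReal) < exitTime Ω p.1 p.2},
    Real.exp (-(ν p.2) * s) * h (p.1 - s • p.2, p.2)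

/-- Extension by zero from `Ω × ℝ³` to `ℝ³ × ℝ³`. -/
def zeroExtension (Ω : Set E3) (h : E3 × E3 → ℝ) : E3 × E3 → ℝ :=
  (Ω ×ˢ (univ : Set E3)).indicator h

/-- Lebesgue measure on `Ω × ℝ³`. -/
def phaseMeasure (Ω : Set E3) : Measure (E3 × E3) :=
  ((volume : Measure E3).restrict Ω).prod (volume : Measure E3)

/-- The integral over `v` of the squared Slobodeckij seminorm of order `s` in `x`. -/
def slobodeckijEnergy (s : ℝ) (Ω : Set E3) (f : E3 × E3 → ℝ) : ENNReal :=
  ∫⁻ v : E3, ∫⁻ y in Ω, ∫⁻ x in Ω,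
    ENNReal.ofReal (|f (x, v) - f (y, v)| ^ 2 / ‖x - y‖ ^ (3 + 2 * s))

/-- The norm of `L²_v(ℝ³; H^s_x(Ω))`, with value `⊤` allowed. -/
def mixedSobolevNorm (s : ℝ) (Ω : Set E3) (f : E3 × E3 → ℝ) : ENNReal :=
  (eLpNorm f 2 (phaseMeasure Ω) ^ 2 + slobodeckijEnergy s Ω f) ^ (1 / 2 : ℝ)

/-- Membership in `L²_v(ℝ³; H^s_x(Ω))`. -/
def MemMixedSobolev (s : ℝ) (Ω : Set E3) (f : E3 × E3 → ℝ) : Prop :=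
  MemLp f 2 (phaseMeasure Ω) ∧ slobodeckijEnergy s Ω f < ⊤

end KineticDomain

namespace Boltzmann

/-- Unit vectors of `ℝ³`. -/
abbrev S2 : Type := Metric.sphere (0 : E3) 1

/-- Angular cutoff with exponent `γ`: `0 ≤ B(r, θ) ≤ C r^γ cos θ sin θ` for `0 ≤ θ ≤ π / 2`. -/
def AngularCutoff (γ : ℝ) (B : ℝ → ℝ → ℝ) : Prop :=
  Measurable (Function.uncurry B) ∧
    ∃ C : ℝ, 0 < C ∧ ∀ r θ : ℝ, 0 < r → 0 ≤ θ → θ ≤ Real.pi / 2 →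
      0 ≤ B r θ ∧ B r θ ≤ C * r ^ γ * Real.cos θ * Real.sin θ

/-- Post-collisional velocity `v' = v + ((v_* - v) · α) α`. -/
def postV (v : E3) (p : E3 × S2) : E3 :=
  v + (inner ℝ (p.1 - v) (p.2 : E3)) • (p.2 : E3)

/-- Post-collisional velocity `v'_* = v_* - ((v_* - v) · α) α`. -/
def postVStar (v : E3) (p : E3 × S2) : E3 :=
  p.1 - (inner ℝ (p.1 - v) (p.2 : E3)) • (p.2 : E3)

/-- For fixed `v`, the integral `∫_{ℝ³} ∫_0^{2π} ∫_0^{π/2} g(v_*, α) B(|v - v_*|, θ) dθ dε dv_*`,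
where `(θ, ε)` are the spherical coordinates of the unit vector `α` with polar axis
`v_* - v`. The surface measure of the sphere is `dα = sin θ dθ dε`, so this is the integral of
`g(v_*, α) B(|v - v_*|, θ) / sin θ` over the `v_*` in `ℝ³` and the unit vectors `α` in the open
hemisphere `(v_* - v) · α > 0`, where `θ` is the angle between `v_* - v` and `α`. -/
def collisionIntegral (B : ℝ → ℝ → ℝ) (v : E3) (g : E3 × S2 → ℝ) : ℝ :=
  ∫ p in {p : E3 × S2 | 0 < inner ℝ (p.1 - v) (p.2 : E3)},
    g p * (B ‖v - p.1‖ (InnerProductGeometry.angle (p.1 - v) (p.2 : E3))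
      / Real.sin (InnerProductGeometry.angle (p.1 - v) (p.2 : E3)))
    ∂((volume : Measure E3).prod (volume : Measure E3).toSphere)

/-- The collision operator
`Q(F, G)(v) = ∫∫∫ (F(v') G(v'_*) - F(v) G(v_*)) B(|v - v_*|, θ) dθ dε dv_*`. -/
def collisionQ (B : ℝ → ℝ → ℝ) (F G : E3 → ℝ) (v : E3) : ℝ :=
  collisionIntegral B v fun p => F (postV v p) * G (postVStar v p) - F v * G p.1

/-- The standard Maxwellian `M(v) = π^{-3/2} e^{-|v|²}`. -/
def maxwellian (v : E3) : ℝ := Real.pi ^ (-(3 / 2) : ℝ) * Real.exp (-‖v‖ ^ 2)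

/-- The linearized collision operator `L f = M^{-1/2} (Q(M, M^{1/2} f) + Q(M^{1/2} f, M))`. -/
def linearizedL (B : ℝ → ℝ → ℝ) (f : E3 → ℝ) (v : E3) : ℝ :=
  (Real.sqrt (maxwellian v))⁻¹ *
    (collisionQ B maxwellian (fun w => Real.sqrt (maxwellian w) * f w) v
      + collisionQ B (fun w => Real.sqrt (maxwellian w) * f w) maxwellian v)

/-- The collision frequency `ν(v) = ∫∫∫ M(v_*) B(|v - v_*|, θ) dθ dε dv_*`. -/
def collisionFrequency (B : ℝ → ℝ → ℝ) (v : E3) : ℝ :=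
  collisionIntegral B v fun p => maxwellian p.1

/-- The operator `K` of the decomposition `L f = -ν f + K f`, acting on the velocity variable of a
function of `(x, v)`. -/
def collisionK (B : ℝ → ℝ → ℝ) (f : E3 × E3 → ℝ) (p : E3 × E3) : ℝ :=
  linearizedL B (fun w => f (p.1, w)) p.2 + collisionFrequency B p.2 * f p

/-- The operator `S_Ω K`. -/
def transportK (Ω : Set E3) (B : ℝ → ℝ → ℝ) (f : E3 × E3 → ℝ) : E3 × E3 → ℝ :=
  KineticDomain.transport Ω (collisionFrequency B) (collisionK B f)

end Boltzmann

end

/-! The half derivative comes from velocity averaging, and positive curvature ensures that cutting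
off at the boundary does not destroy it.

After removing a null set of velocities, transport in `Ω` is the restriction to `Ω` of a
translation-invariant operator on the whole space: integrate the zero extension backwards along the
velocity `v` for the fixed time `d / |v|`, where `d` bounds the diameter
(`transport_eq_lineTransport`). In `x` this is a Fourier multiplier `m(v, ξ)`, bounded by `d / |v|`
and by `1 / |v · ξ|`. The operator `K` has a kernel bounded by a multiple of `|w - v|⁻¹ exp(-|w -
v|² / 8)` (`AngularCutoff.exists_kernel`). Integrating `|w|² |m(w, ξ)|²` against this bound costs
only `(1 + |v|) / |ξ|`, since the multiplier is large only in a slab of width about `1 / |ξ|` around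
the plane `w · ξ = 0`. By Cauchy–Schwarz and Plancherel the average `K S A` over the whole space
gains half a derivative in `x`: the square of its `L²` modulus of continuity is `O(|z|)`
(`exists_lintegral_transportAverage_translate_le`).

Two obstacles remain. First, cutting off by `Ω` adds the mass on the points that leave `Ω` under a
translation by `z`. Positive curvature and compactness make `Ω` strongly convex, so along a line the
length of the chord times the length of the part pushed out is `O(|z| / |v|²)`
(`volume_chord_mul_volume_le`). One factor, the length of the chord, comes from Cauchy–Schwarz along
the line, so the boundary mass of a transported density is `O(|z| / |v|²)` times its squared norm.
Secondly, transport costs `|v|⁻²` in the squared norm and thus needs control at small velocities.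
The weight `1 + |v|^(-5/2)` supplies it: it dominates `|v|⁻²`, it is locally integrable in three
dimensions, so `K` maps `L²` into the weighted space, and it absorbs the two factors `|v|⁻²` and
`|w|⁻²` that meet when the second transport follows the average
(`exists_lintegral_weighted_gradKernel_le`).

The second transport commutes with translations, so it keeps the modulus and adds only one more
boundary term. Hence for `u = S K S K f` the squared modulus is at most `C |z| ‖f‖²`, and trivially
at most a constant times `‖f‖²`. Integrating `min(|z|, 1)` against `|z|^(-(4 - 2ε))` gives a
multiple of `1 / (2ε) + 1 / (1 - 2ε) = 1 / (2ε (1 - 2ε))`, whose square root is the constant in the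
theorem. -/

noncomputable section

namespace KineticDomain

open scoped ENNReal FourierTransform

/-! ### Plancherel and the modulus of continuity on the Fourier side -/

section Plancherel

variable {V : Type*} [NormedAddCommGroup V] [InnerProductSpace ℝ V] [FiniteDimensional ℝ V]
  [MeasurableSpace V] [BorelSpace V]

/-- On `L¹ ∩ L²` the Fourier integral represents the Fourier transform of `L²`. -/
theorem fourier_toLp_ae_eq {f : V → ℂ} (hf : Integrable f) (hf2 : MemLp f 2) :
    (𝓕 (hf2.toLp f) : Lp ℂ 2 (volume : Measure V)) =ᵐ[volume] 𝓕 f := by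
  have hcont : Continuous (𝓕 f) :=
    VectorFourier.fourierIntegral_continuous Real.continuous_fourierChar
      (by exact continuous_inner) hf
  -- Both sides are tested against smooth compactly supported functions. The transform of `L²` is
  -- moved to the test function through tempered distributions, the Fourier integral through its
  -- self-adjointness.
  refine ae_eq_of_integral_contDiff_smul_eq
    ((Lp.memLp _).locallyIntegrable (by norm_num)) hcont.locallyIntegrable ?_
  intro g hg hgs
  have hg1 : HasCompactSupport (fun x => (g x : ℂ)) := hgs.comp_left Complex.ofReal_zero
  have hg2 := Complex.ofRealCLM.contDiff.comp hg
  set φ : SchwartzMap V ℂ := hg1.toSchwartzMap hg2 with hφ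
  have hφg : ∀ x, φ x = (g x : ℂ) := fun x => rfl
  have key := congrArg (fun T : TemperedDistribution V ℂ => T φ)
    (Lp.fourier_toTemperedDistribution_eq (hf2.toLp f))
  simp only [TemperedDistribution.fourier_apply, Lp.toTemperedDistribution_apply] at key
  have h2 := VectorFourier.integral_fourierIntegral_smul_eq_flip (L := innerₗ V)
    (μ := volume) (ν := volume) Real.continuous_fourierChar
    (by exact continuous_inner) hf φ.integrable
  rw [flip_innerₗ] at h2
  calc ∫ x, g x • (𝓕 (hf2.toLp f) : Lp ℂ 2 (volume : Measure V)) x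
      = ∫ x, φ x • (𝓕 (hf2.toLp f) : Lp ℂ 2 (volume : Measure V)) x := by
        simp [hφg]
    _ = ∫ x, (𝓕 φ) x • (hf2.toLp f) x := key.symm
    _ = ∫ x, f x • (𝓕 (φ : V → ℂ)) x := by
        apply integral_congr_ae
        filter_upwards [hf2.coeFn_toLp] with x hx
        rw [hx, SchwartzMap.fourier_coe, smul_eq_mul, smul_eq_mul, mul_comm]
    _ = ∫ x, (𝓕 f) x • φ x := h2.symm
    _ = ∫ x, g x • 𝓕 f x := by
        simp [hφg, mul_comm]

theorem lintegral_enorm_fourier_sq {f : V → ℂ} (hf : Integrable f) (hf2 : MemLp f 2) :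
    ∫⁻ ξ, ‖𝓕 f ξ‖ₑ ^ 2 = ∫⁻ x, ‖f x‖ₑ ^ 2 := by
  have h1 : eLpNorm (𝓕 f) 2 volume = eLpNorm f 2 volume := by
    rw [← eLpNorm_congr_ae (fourier_toLp_ae_eq hf hf2), ← eLpNorm_congr_ae hf2.coeFn_toLp,
      ← Lp.enorm_def, ← Lp.enorm_def, ← ofReal_norm, ← ofReal_norm, Lp.norm_fourier_eq]
  have h2 : ∀ g : V → ℂ, ∫⁻ x, ‖g x‖ₑ ^ 2 = eLpNorm g 2 volume ^ 2 := by
    intro g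
    have := eLpNorm_nnreal_pow_eq_lintegral (f := g) (p := 2) (μ := volume) (by norm_num)
    simp at this
    simpa using this.symm
  rw [h2, h2, h1]

/-- The Fourier side of the squared `L²` modulus of continuity. -/
theorem lintegral_translate_sub_sq {f : V → ℂ} (hf : Integrable f) (hf2 : MemLp f 2) (z : V) :
    ∫⁻ x, ‖f (x + z) - f x‖ₑ ^ 2
      ≤ ENNReal.ofReal (4 * Real.pi * ‖z‖) * ∫⁻ ξ, ENNReal.ofReal ‖ξ‖ * ‖𝓕 f ξ‖ₑ ^ 2 := by
  have hfz : Integrable (fun x => f (x + z)) := hf.comp_add_right z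
  have hfz2 : MemLp (fun x => f (x + z)) 2 :=
    hf2.comp_measurePreserving (measurePreserving_add_right volume z)
  have hF : ∀ ξ, 𝓕 (fun x => f (x + z) - f x) ξ
      = (Complex.exp ((2 * Real.pi * inner ℝ z ξ : ℝ) * Complex.I) - 1) * 𝓕 f ξ := by
    intro ξ
    have h1 : 𝓕 (fun x => f (x + z)) ξ = Real.fourierChar (inner ℝ z ξ) • 𝓕 f ξ := by
      have := VectorFourier.fourierIntegral_comp_add_right Real.fourierChar (volume : Measure V)
        (innerₗ V) f z
      exact congrFun this ξ
    have h2 : 𝓕 (fun x => f (x + z) - f x) ξ = 𝓕 (fun x => f (x + z)) ξ - 𝓕 f ξ := by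
      simp only [Real.fourier_eq, smul_sub]
      exact integral_sub ((Real.fourierIntegral_convergent_iff ξ).2 hfz)
        ((Real.fourierIntegral_convergent_iff ξ).2 hf)
    rw [h2, h1, Circle.smul_def, Real.fourierChar_apply, sub_mul, one_mul, smul_eq_mul]
  rw [← lintegral_enorm_fourier_sq (f := fun x => f (x + z) - f x) (hfz.sub hf) (hfz2.sub hf2),
    ← lintegral_const_mul' _ _
    ENNReal.ofReal_ne_top]
  refine lintegral_mono fun ξ => ?_
  simp only [hF, enorm_mul, mul_pow, ← mul_assoc]
  gcongr
  rw [← ENNReal.ofReal_mul (by positivity), ← ofReal_norm, ← ENNReal.ofReal_pow (norm_nonneg _)]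
  apply ENNReal.ofReal_le_ofReal
  set θ := 2 * Real.pi * inner ℝ z ξ with hθ
  have h1 : ‖Complex.exp (θ * Complex.I) - 1‖ ≤ |θ| := by
    have := Real.norm_exp_I_mul_ofReal_sub_one_le (x := θ)
    rwa [mul_comm, Real.norm_eq_abs] at this
  have h2 : ‖Complex.exp (θ * Complex.I) - 1‖ ≤ 2 := by
    refine (norm_sub_le _ _).trans ?_
    rw [Complex.norm_exp_ofReal_mul_I, norm_one]; norm_num
  have h3 : |θ| ≤ 2 * Real.pi * (‖z‖ * ‖ξ‖) := by
    rw [hθ, abs_mul, abs_of_pos Real.two_pi_pos]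
    gcongr
    exact abs_real_inner_le_norm z ξ
  -- One factor is bounded by 2 and the other by `|θ|`, so the result is linear in `‖z‖ ‖ξ‖`: only
  -- half a derivative is spent.
  calc ‖Complex.exp (θ * Complex.I) - 1‖ ^ 2
      = ‖Complex.exp (θ * Complex.I) - 1‖ * ‖Complex.exp (θ * Complex.I) - 1‖ := sq _
    _ ≤ 2 * (2 * Real.pi * (‖z‖ * ‖ξ‖)) := by
        exact mul_le_mul h2 (h1.trans h3) (norm_nonneg _) (by norm_num)
    _ = _ := by ring

end Plancherel

end KineticDomain

end

/-! ### From positive curvature to strong convexity -/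

noncomputable section

namespace KineticDomain

open Filter Topology

section Taylor

variable {U : Set E3} {ρ : E3 → ℝ} {q : E3}

/-- The base point `a` moves while the Hessian stays frozen at `q`; this uniformity is needed for
boundary points converging to `q`. It holds because `Dρ` is strictly differentiable at `q`, so the
derivative of the remainder `ψ` is at most `δ ‖b - a‖` on the segment, and the mean value inequality
applies. -/
theorem exists_ball_taylor_two (hU : IsOpen U) (hq : q ∈ U) (hρ : ContDiffOn ℝ 2 ρ U)
    {δ : ℝ} (hδ : 0 < δ) :
    ∃ r > 0, Metric.ball q r ⊆ U ∧ ∀ a ∈ Metric.ball q r, ∀ b ∈ Metric.ball q r,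
      |ρ b - ρ a - fderiv ℝ ρ a (b - a) - 1 / 2 * fderiv ℝ (fderiv ℝ ρ) q (b - a) (b - a)|
        ≤ δ * ‖b - a‖ ^ 2 := by
  have hρq : ContDiffAt ℝ 2 ρ q := hρ.contDiffAt (hU.mem_nhds hq)
  have h1 : ContDiffAt ℝ 1 (fderiv ℝ ρ) q := hρq.fderiv_right (by norm_num)
  have hsymm : IsSymmSndFDerivAt ℝ ρ q := hρq.isSymmSndFDerivAt (by simp)
  have hs := (h1.hasStrictFDerivAt (by norm_num)).isLittleO.def hδ
  rw [nhds_prod_eq] at hs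
  obtain ⟨t, ht, hst⟩ := Filter.mem_prod_self_iff.1 hs
  obtain ⟨r, hr, hrt⟩ := Metric.mem_nhds_iff.1 (inter_mem ht (hU.mem_nhds hq))
  refine ⟨r, hr, fun x hx => (hrt hx).2, fun a ha b hb => ?_⟩
  set H := fderiv ℝ (fderiv ℝ ρ) q with hH
  set ψ : E3 → ℝ := fun y => ρ y - fderiv ℝ ρ a (y - a) - 1 / 2 * H (y - a) (y - a) with hψ
  have hseg : segment ℝ a b ⊆ Metric.ball q r := (convex_ball q r).segment_subset ha hb
  have hder : ∀ y ∈ segment ℝ a b, HasFDerivWithinAt ψ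
      (fderiv ℝ ρ y - fderiv ℝ ρ a - H (y - a)) (segment ℝ a b) y := by
    intro y hy
    have hyU := (hrt (hseg hy)).2
    have d1 : HasFDerivAt ρ (fderiv ℝ ρ y) y :=
      ((hρ.contDiffAt (hU.mem_nhds hyU)).differentiableAt (by norm_num)).hasFDerivAt
    have d0 : HasFDerivAt (fun y : E3 => y - a) (ContinuousLinearMap.id ℝ E3) y :=
      (hasFDerivAt_id y).sub_const a
    have d2 : HasFDerivAt (fun y : E3 => fderiv ℝ ρ a (y - a)) (fderiv ℝ ρ a) y := by
      exact ((fderiv ℝ ρ a).hasFDerivAt.comp y d0).congr_fderiv (by ext; simp)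
    have d3 := ((H.hasFDerivAt.comp y d0).clm_apply d0).const_mul (1 / 2)
    refine (((d1.sub d2).sub d3).congr_fderiv ?_).hasFDerivWithinAt
    ext u
    have := hsymm u (y - a)
    rw [← hH] at this
    simp only [map_sub, sub_apply] at this
    simp
    linarith
  have hbound : ∀ y ∈ segment ℝ a b,
      ‖fderiv ℝ ρ y - fderiv ℝ ρ a - H (y - a)‖ ≤ δ * ‖b - a‖ := by
    intro y hy
    refine (hst (mk_mem_prod (hrt (hseg hy)).1 (hrt ha).1)).trans ?_
    gcongr
    obtain ⟨θ, hθ, rfl⟩ := (segment_eq_image' ℝ a b).subset hy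
    simp only [add_sub_cancel_left, norm_smul, Real.norm_eq_abs, abs_of_nonneg hθ.1]
    exact mul_le_of_le_one_left (norm_nonneg _) hθ.2
  have := (convex_segment a b).norm_image_sub_le_of_norm_hasFDerivWithin_le hder hbound
    (left_mem_segment ℝ a b) (right_mem_segment ℝ a b)
  simp only [hψ, sub_self, map_zero, mul_zero, sub_zero, Real.norm_eq_abs] at this
  calc _ = |ρ b - (fderiv ℝ ρ a) (b - a) - 1 / 2 * (H (b - a)) (b - a) - ρ a| := by
        congr 1; ring
    _ ≤ _ := this.trans (by rw [sq, mul_assoc])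

end Taylor

theorem defining_eq_zero {Ω U : Set E3} {ρ : E3 → ℝ} (hΩ : IsOpen Ω) (hU : IsOpen U)
    (hρ : ContinuousOn ρ U) (hdef : ∀ x ∈ U, (x ∈ Ω ↔ ρ x < 0)) {q : E3} (hq : q ∈ frontier Ω)
    (hqU : q ∈ U) : ρ q = 0 := by
  have hcont : ContinuousAt ρ q := hρ.continuousAt (hU.mem_nhds hqU)
  have hn : q ∉ Ω := by
    rw [hΩ.frontier_eq] at hq; exact hq.2
  refine le_antisymm ?_ (not_lt.1 fun h => hn ((hdef q hqU).2 h))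
  by_contra! h
  have h1 : ∀ᶠ x in 𝓝 q, 0 < ρ x ∧ x ∈ U :=
    (hcont.eventually_const_lt h).and (hU.mem_nhds hqU)
  have h2 : ∃ᶠ x in 𝓝 q, x ∈ Ω := mem_closure_iff_frequently.1 (frontier_subset_closure hq)
  obtain ⟨x, hx, hx2, hx3⟩ := (h2.and_eventually h1).exists
  exact absurd ((hdef x hx3).1 hx) (not_lt.2 hx2.le)

theorem combo_mem_of_mem_frontier {Ω : Set E3} (hΩ : IsOpen Ω) (hconv : Convex ℝ Ω) {q x : E3}
    (hq : q ∈ frontier Ω) (hx : x ∈ Ω) {t : ℝ} (ht : 0 < t) (ht1 : t ≤ 1) :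
    q + t • (x - q) ∈ Ω := by
  have := hconv.combo_closure_interior_mem_interior (frontier_subset_closure hq)
    (by rwa [hΩ.interior_eq]) (sub_nonneg.2 ht1) ht (by ring)
  rw [hΩ.interior_eq] at this
  convert this using 1
  module

/-- By convexity the segment from `q` to `x` runs inside `Ω`, where `ρ < 0 = ρ q`, so its difference
quotients at `q` are nonpositive. -/
theorem fderiv_defining_nonpos {Ω U : Set E3} {ρ : E3 → ℝ} (hΩ : IsOpen Ω)
    (hconv : Convex ℝ Ω) (hU : IsOpen U) (hρ : ContDiffOn ℝ 2 ρ U)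
    (hdef : ∀ x ∈ U, (x ∈ Ω ↔ ρ x < 0)) {q : E3} (hq : q ∈ frontier Ω) (hqU : q ∈ U) {x : E3}
    (hx : x ∈ Ω) : fderiv ℝ ρ q (x - q) ≤ 0 := by
  have h0 := defining_eq_zero hΩ hU hρ.continuousOn hdef hq hqU
  have hd : HasFDerivAt ρ (fderiv ℝ ρ q) q :=
    ((hρ.contDiffAt (hU.mem_nhds hqU)).differentiableAt (by norm_num)).hasFDerivAt
  have hl : HasDerivAt (fun t : ℝ => ρ (q + t • (x - q))) (fderiv ℝ ρ q (x - q)) 0 := by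
    have h1 : HasDerivAt (fun t : ℝ => q + t • (x - q)) (x - q) 0 := by
      simpa using ((hasDerivAt_id (0 : ℝ)).smul_const (x - q)).const_add q
    have h2 : HasFDerivAt ρ (fderiv ℝ ρ q) (q + (0 : ℝ) • (x - q)) := by simpa using hd
    exact h2.comp_hasDerivAt 0 h1
  have hslope := (hasDerivWithinAt_iff_tendsto_slope' (by simp)).1
    (hl.hasDerivWithinAt (s := Ioi 0))
  refine le_of_tendsto hslope ?_
  have hU' : ∀ᶠ t in 𝓝[>] (0 : ℝ), q + t • (x - q) ∈ U := by
    apply nhdsWithin_le_nhds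
    have : ContinuousAt (fun t : ℝ => q + t • (x - q)) 0 := by fun_prop
    exact this (hU.mem_nhds (by simpa using hqU))
  filter_upwards [hU', Ioo_mem_nhdsGT (zero_lt_one' ℝ)] with t ht ht1
  rw [slope_def_field]
  simp only [zero_smul, add_zero, h0, sub_zero]
  exact div_nonpos_of_nonpos_of_nonneg
    ((hdef _ ht).1 (combo_mem_of_mem_frontier hΩ hconv hq hx ht1.1 ht1.2.le)).le ht1.1.le

/-- In dimension three the gradient and `e` span at most a plane, so some unit vector is orthogonal
to both. It completes a tangent direction to the orthonormal pair on which the curvature is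
evaluated. -/
theorem exists_orthonormal_tangent (ℓ : E3 →L[ℝ] ℝ) (e : E3) :
    ∃ w : E3, ‖w‖ = 1 ∧ inner ℝ e w = 0 ∧ ℓ w = 0 := by
  set n : E3 := (InnerProductSpace.toDual ℝ E3).symm ℓ with hn
  set S : Submodule ℝ E3 := Submodule.span ℝ {n, e}
  have hS : Module.finrank ℝ S ≤ 2 := by
    refine (finrank_span_le_card _).trans ?_
    simpa using Finset.card_le_two
  have hperp : Sᗮ ≠ ⊥ := by
    intro h
    have := Submodule.finrank_add_finrank_orthogonal S
    rw [h, finrank_bot, finrank_euclideanSpace_fin] at this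
    omega
  obtain ⟨w, hw, hw0⟩ := Submodule.exists_mem_ne_zero_of_ne_bot hperp
  rw [Submodule.mem_orthogonal] at hw
  refine ⟨(‖w‖⁻¹ : ℝ) • w, ?_, ?_, ?_⟩
  · rw [norm_smul, norm_inv, norm_norm, inv_mul_cancel₀ (norm_ne_zero_iff.2 hw0)]
  · rw [inner_smul_right, hw e (Submodule.subset_span (by simp)), mul_zero]
  · have h1 : ℓ w = inner ℝ n w := by rw [hn, InnerProductSpace.toDual_symm_apply]
    rw [map_smul, h1, hw n (Submodule.subset_span (by simp)), smul_zero]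

/-- On the tangent plane the second derivative of a defining function is positive. -/
theorem hessian_pos_of_curvature_pos {Ω U : Set E3} {ρ : E3 → ℝ} (hΩ : IsOpen Ω)
    (hconv : Convex ℝ Ω) (hU : IsOpen U) (hρ : ContDiffOn ℝ 2 ρ U)
    (hdef : ∀ x ∈ U, (x ∈ Ω ↔ ρ x < 0)) {q : E3} (hq : q ∈ frontier Ω) (hqU : q ∈ U)
    (hcurv : ∀ u w : E3, ‖u‖ = 1 → ‖w‖ = 1 → inner ℝ u w = 0 →
      fderiv ℝ ρ q u = 0 → fderiv ℝ ρ q w = 0 → 0 < gaussianCurvature ρ q u w)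
    {e : E3} (he : ‖e‖ = 1) (htan : fderiv ℝ ρ q e = 0) :
    0 < fderiv ℝ (fderiv ℝ ρ) q e e := by
  have h0 := defining_eq_zero hΩ hU hρ.continuousOn hdef hq hqU
  set H := fderiv ℝ (fderiv ℝ ρ) q with hH
  -- If the second derivative were negative, Taylor with error `-(H e e) / 4` would give `ρ (q + t •
  -- e) ≤ (H e e / 4) t² < 0` on both sides of `q`; two opposite points of `Ω` would then have the
  -- boundary point `q` as midpoint.
  have hnn : 0 ≤ H e e := by
    by_contra! hneg
    obtain ⟨r, hr, hrU, hT⟩ := exists_ball_taylor_two hU hqU hρ (δ := -(H e e) / 4) (by linarith)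
    have hmem : ∀ t : ℝ, t ≠ 0 → |t| < r → q + t • e ∈ Ω := by
      intro t ht0 htr
      have hb : q + t • e ∈ Metric.ball q r := by
        simp [Metric.mem_ball, dist_eq_norm, norm_smul, he, htr]
      rw [hdef _ (hrU hb)]
      have := hT q (Metric.mem_ball_self hr) _ hb
      simp only [add_sub_cancel_left, map_smul, htan, norm_smul, he, h0,
        smul_apply, smul_eq_mul, Real.norm_eq_abs, mul_one, mul_zero, sub_zero,
        sq_abs] at this
      have h3 := (abs_le.1 this).2
      have h4 : 0 < t ^ 2 := by positivity
      rw [← hH] at h3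
      nlinarith
    have h1 := hmem (r / 2) (by positivity) (by rw [abs_of_pos] <;> linarith)
    have h2 := hmem (-(r / 2)) (by simp; positivity) (by rw [abs_neg, abs_of_pos] <;> linarith)
    have h3 := hconv h1 h2 (a := 1 / 2) (b := 1 / 2) (by norm_num) (by norm_num) (by norm_num)
    have h4 : (1 / 2 : ℝ) • (q + (r / 2) • e) + (1 / 2 : ℝ) • (q + (-(r / 2)) • e) = q := by
      module
    rw [h4] at h3
    rw [hΩ.frontier_eq] at hq
    exact hq.2 h3
  obtain ⟨w, hw, hew, hwt⟩ := exists_orthonormal_tangent (fderiv ℝ ρ q) e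
  have hc := hcurv e w he hw hew htan hwt
  have hsymm : IsSymmSndFDerivAt ℝ ρ q :=
    (hρ.contDiffAt (hU.mem_nhds hqU)).isSymmSndFDerivAt (by simp)
  rw [gaussianCurvature] at hc
  have hnum : 0 < H e e * H w w - H e w * H w e := by
    by_contra! h
    exact absurd hc (not_lt.2 (div_nonpos_of_nonpos_of_nonneg h (by positivity)))
  have hsw : H w e = H e w := hsymm w e
  rw [hsw] at hnum
  -- If `H e e = 0`, the positive determinant would equal `-(H e w)²`.
  refine lt_of_le_of_ne hnn fun h => ?_
  rw [← h] at hnum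
  nlinarith [mul_self_nonneg (H e w)]


/-- Near a boundary point the domain lies below a paraboloid touching it. -/
theorem exists_local_strict_support {Ω : Set E3} (hΩ : IsPositivelyCurved Ω) {q : E3}
    (hq : q ∈ frontier Ω) :
    ∃ c > 0, ∃ r > 0, ∀ p ∈ frontier Ω, dist p q < r → ∃ ℓ : E3 →L[ℝ] ℝ, ‖ℓ‖ ≤ 1 ∧
      ∀ x ∈ Ω, ℓ (x - p) ≤ -c * ‖x - p‖ ^ 2 := by
  obtain ⟨ρ, ⟨U, hU, hqU, hρ, -, hdef⟩, hcurv⟩ := hΩ.curvature_pos q hq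
  have hop := hΩ.isOpen
  have hconv := hΩ.convex
  have hDc : ContinuousAt (fderiv ℝ ρ) q :=
    ((hρ.contDiffAt (hU.mem_nhds hqU)).fderiv_right (m := 1) (by norm_num)).continuousAt
  obtain ⟨D, hD⟩ := Metric.isBounded_iff.1 hΩ.isBounded.closure
  -- The single parameter `1 / (n + 1)` serves as radius and as modulus, so the negation yields
  -- sequences `p n → q` and `x n ∈ Ω` that violate the estimate. Normalising `Dρ(p)` by the local
  -- bound `L` afterwards gives norm at most one.
  suffices h : ∃ n : ℕ, ∀ p ∈ frontier Ω, dist p q < 1 / ((n : ℝ) + 1) → ∀ x ∈ Ω,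
      fderiv ℝ ρ p (x - p) ≤ -(1 / ((n : ℝ) + 1)) * ‖x - p‖ ^ 2 by
    obtain ⟨n, hn⟩ := h
    set L : ℝ := ‖fderiv ℝ ρ q‖ + 1 with hL
    have hLpos : 0 < L := by positivity
    have hev : ∀ᶠ p in 𝓝 q, ‖fderiv ℝ ρ p‖ < L :=
      hDc.norm.eventually_lt_const (by linarith)
    obtain ⟨r, hr, hrb⟩ := Metric.eventually_nhds_iff.1 hev
    refine ⟨L⁻¹ * (1 / ((n : ℝ) + 1)), by positivity, min r (1 / ((n : ℝ) + 1)),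
      lt_min hr (by positivity), fun p hp hpq => ⟨L⁻¹ • fderiv ℝ ρ p, ?_, fun x hx => ?_⟩⟩
    · rw [norm_smul, Real.norm_eq_abs, abs_of_pos (inv_pos.2 hLpos), inv_mul_le_one₀ hLpos]
      exact (hrb (hpq.trans_le (min_le_left _ _))).le
    · have := hn p hp (hpq.trans_le (min_le_right _ _)) x hx
      have h2 := mul_le_mul_of_nonneg_left this (inv_pos.2 hLpos).le
      simp only [smul_apply, smul_eq_mul]
      linarith
  by_contra! hcon
  choose p hp hpq x hx hlt using hcon
  have hd0 : ∀ n, x n - p n ≠ 0 := by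
    intro n h
    rw [sub_eq_zero] at h
    have := hp n
    rw [hop.frontier_eq, ← h] at this
    exact this.2 (hx n)
  set e : ℕ → E3 := fun n => (‖x n - p n‖⁻¹ : ℝ) • (x n - p n) with he
  have hde : ∀ n, x n - p n = ‖x n - p n‖ • e n := fun n => by
    rw [he]; simp only [smul_smul, mul_inv_cancel₀ (norm_ne_zero_iff.2 (hd0 n)), one_smul]
  have hen : ∀ n, e n ∈ Metric.sphere (0 : E3) 1 := fun n => by
    simp [he, norm_smul, inv_mul_cancel₀ (norm_ne_zero_iff.2 (hd0 n))]
  have hcpt : IsCompact (closure Ω ×ˢ Metric.sphere (0 : E3) 1) :=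
    hΩ.isBounded.isCompact_closure.prod (isCompact_sphere 0 1)
  obtain ⟨⟨y, u⟩, hyu, φ, hφ, hlim⟩ := hcpt.tendsto_subseq (x := fun n => (x n, e n))
    (fun n => ⟨subset_closure (hx n), hen n⟩)
  have hy : Tendsto (fun n => x (φ n)) atTop (𝓝 y) := (continuous_fst.tendsto _).comp hlim
  have hu : Tendsto (fun n => e (φ n)) atTop (𝓝 u) := (continuous_snd.tendsto _).comp hlim
  have hun : ‖u‖ = 1 := by simpa using hyu.2
  have hinv : Tendsto (fun n => 1 / ((φ n : ℝ) + 1)) atTop (𝓝 0) :=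
    tendsto_one_div_add_atTop_nhds_zero_nat.comp hφ.tendsto_atTop
  have hpl : Tendsto (fun n => p (φ n)) atTop (𝓝 q) := by
    rw [tendsto_iff_dist_tendsto_zero]
    exact squeeze_zero (fun _ => dist_nonneg) (fun n => (hpq (φ n)).le) hinv
  have hpU : ∀ᶠ n in atTop, p (φ n) ∈ U := hpl (hU.mem_nhds hqU)
  have hDl : Tendsto (fun n => fderiv ℝ ρ (p (φ n)) (e (φ n))) atTop (𝓝 (fderiv ℝ ρ q u)) :=
    (isBoundedBilinearMap_apply.continuous.tendsto (fderiv ℝ ρ q, u)).comp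
      ((hDc.tendsto.comp hpl).prodMk_nhds hu)
  have hnorm : ∀ n, ‖x n - p n‖ ≤ D := fun n => by
    rw [← dist_eq_norm]; exact hD (subset_closure (hx n)) (frontier_subset_closure (hp n))
  have hDe : ∀ n : ℕ, -(1 / ((n : ℝ) + 1)) * ‖x n - p n‖ < fderiv ℝ ρ (p n) (e n) := by
    intro n
    have h1 := hlt n
    have h2 : 0 < ‖x n - p n‖ := norm_pos_iff.2 (hd0 n)
    have h3 : fderiv ℝ ρ (p n) (x n - p n) = ‖x n - p n‖ * fderiv ℝ ρ (p n) (e n) := by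
      conv_lhs => rw [hde n]
      rw [map_smul, smul_eq_mul]
    rw [h3] at h1
    have : ‖x n - p n‖ * (-(1 / ((n : ℝ) + 1)) * ‖x n - p n‖)
        < ‖x n - p n‖ * fderiv ℝ ρ (p n) (e n) := by linarith
    exact lt_of_mul_lt_mul_left this h2.le
  -- The limiting direction is tangent: `Dρ(p)` is nonpositive towards points of `Ω`, while the
  -- violated estimate bounds it below by `-‖x n - p n‖ / (n + 1)`, which tends to zero.
  have htan : fderiv ℝ ρ q u = 0 := by
    apply le_antisymm
    · refine le_of_tendsto hDl ?_
      filter_upwards [hpU] with n hn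
      have := fderiv_defining_nonpos hop hconv hU hρ hdef (hp (φ n)) hn (hx (φ n))
      simp only [he, map_smul, smul_eq_mul]
      exact mul_nonpos_of_nonneg_of_nonpos (by positivity) this
    · have hlim0 : Tendsto (fun n => -(1 / ((φ n : ℝ) + 1)) * D) atTop (𝓝 0) := by
        simpa using (hinv.neg.mul_const D)
      refine le_of_tendsto_of_tendsto' hlim0 hDl fun n => ?_
      refine le_trans ?_ (hDe (φ n)).le
      rw [neg_mul, neg_mul, neg_le_neg_iff]
      gcongr
      exact hnorm _
  have hpos := hessian_pos_of_curvature_pos hop hconv hU hρ hdef hq hqU hcurv hun htan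
  set H := fderiv ℝ (fderiv ℝ ρ) q with hH
  have hρq := defining_eq_zero hop hU hρ.continuousOn hdef hq hqU
  obtain ⟨r, hr, hrU, hT⟩ := exists_ball_taylor_two hU hqU hρ (δ := H u u / 4) (by linarith)
  rw [← hH] at hT
  -- If `x n → q`, Taylor at `p n` divided by `‖x n - p n‖²` gives in the limit `H u u / 2 ≤ H u u /
  -- 4`. Otherwise the segment from `q` to `y` has the tangent direction `u` and lies in the
  -- closure, where `ρ ≤ 0`, while Taylor gives `ρ (q + t • u) ≥ (H u u / 4) t² > 0`. Both
  -- contradict `0 < H u u`.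
  by_cases hyq : y = q
  · rw [hyq] at hy
    have hball : ∀ᶠ n in atTop, x (φ n) ∈ Metric.ball q r ∧ p (φ n) ∈ Metric.ball q r :=
      (hy.eventually (Metric.ball_mem_nhds q hr)).and (hpl.eventually (Metric.ball_mem_nhds q hr))
    have hHl : Tendsto (fun n => H (e (φ n)) (e (φ n))) atTop (𝓝 (H u u)) :=
      (isBoundedBilinearMap_apply.continuous.tendsto (H u, u)).comp
        (((H.continuous.tendsto _).comp hu).prodMk_nhds hu)
    have hle : 1 / 2 * H u u ≤ H u u / 4 + 0 := by
      refine le_of_tendsto_of_tendsto (hHl.const_mul (1 / 2)) (hinv.const_add (H u u / 4)) ?_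
      filter_upwards [hball] with n hn
      have h1 := (abs_le.1 (hT _ hn.2 _ hn.1)).1
      have hx0 : ρ (x (φ n)) < 0 := (hdef _ (hrU hn.1)).1 (hx _)
      have hp0 : ρ (p (φ n)) = 0 :=
        defining_eq_zero hop hU hρ.continuousOn hdef (hp _) (hrU hn.2)
      have h2 := hlt (φ n)
      have h3 : H (x (φ n) - p (φ n)) (x (φ n) - p (φ n))
          = ‖x (φ n) - p (φ n)‖ ^ 2 * H (e (φ n)) (e (φ n)) := by
        conv_lhs => rw [hde (φ n)]
        simp only [map_smul, smul_apply, smul_eq_mul]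
        ring
      rw [h3, hp0] at h1
      have h4 : 0 < ‖x (φ n) - p (φ n)‖ ^ 2 := by
        have := norm_pos_iff.2 (hd0 (φ n)); positivity
      have h5 : ‖x (φ n) - p (φ n)‖ ^ 2 * (1 / 2 * H (e (φ n)) (e (φ n)))
          ≤ ‖x (φ n) - p (φ n)‖ ^ 2 * (H u u / 4 + 1 / ((φ n : ℝ) + 1)) := by
        linarith
      exact le_of_mul_le_mul_left h5 h4
    linarith
  · have hyq' : 0 < ‖y - q‖ := norm_pos_iff.2 (sub_ne_zero.2 hyq)
    have hyu2 : y - q = ‖y - q‖ • u := by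
      have h1 : Tendsto (fun n => x (φ n) - p (φ n)) atTop (𝓝 (y - q)) := hy.sub hpl
      have h2 : Tendsto (fun n => ‖x (φ n) - p (φ n)‖ • e (φ n)) atTop (𝓝 (‖y - q‖ • u)) :=
        h1.norm.smul hu
      refine tendsto_nhds_unique h1 (h2.congr fun n => (hde (φ n)).symm)
    set t : ℝ := min (‖y - q‖) (r / 2) with ht
    have htpos : 0 < t := lt_min hyq' (by linarith)
    have hmem : q + t • u ∈ closure Ω := by
      have h1 := hconv.closure (frontier_subset_closure hq) hyu.1
        (a := 1 - t / ‖y - q‖) (b := t / ‖y - q‖)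
        (sub_nonneg.2 ((div_le_one hyq').2 (min_le_left _ _))) (by positivity) (by ring)
      convert h1 using 1
      have : u = (‖y - q‖⁻¹ : ℝ) • (y - q) := by
        rw [hyu2, norm_smul, hun, norm_norm, mul_one, smul_smul, inv_mul_cancel₀ hyq'.ne',
          one_smul]
      conv_lhs => rw [this]
      simp only
      rw [smul_smul, div_eq_mul_inv]
      module
    have hb : q + t • u ∈ Metric.ball q r := by
      have : t ≤ r / 2 := min_le_right _ _
      simp only [Metric.mem_ball, dist_eq_norm, add_sub_cancel_left, norm_smul, hun, mul_one,
        Real.norm_eq_abs, abs_of_pos htpos]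
      linarith
    have hle : ρ (q + t • u) ≤ 0 := by
      have hc : ContinuousAt ρ (q + t • u) := hρ.continuousOn.continuousAt (hU.mem_nhds (hrU hb))
      by_contra! h
      have h1 : ∀ᶠ z in 𝓝 (q + t • u), 0 < ρ z ∧ z ∈ U :=
        (hc.eventually_const_lt h).and (hU.mem_nhds (hrU hb))
      obtain ⟨z, hz, hz2, hz3⟩ := ((mem_closure_iff_frequently.1 hmem).and_eventually h1).exists
      exact absurd ((hdef z hz3).1 hz) (not_lt.2 hz2.le)
    have h1 := (abs_le.1 (hT q (Metric.mem_ball_self hr) _ hb)).1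
    simp only [add_sub_cancel_left, map_smul, htan, norm_smul, hun, hρq, smul_apply,
      smul_eq_mul, Real.norm_eq_abs, mul_one, mul_zero, sub_zero, sq_abs] at h1
    have : 0 < t ^ 2 := by positivity
    nlinarith

/-- The local moduli are glued by compactness of the boundary, taking the smaller one on a union of
two sets. -/
theorem exists_strict_support {Ω : Set E3} (hΩ : IsPositivelyCurved Ω) :
    ∃ c > 0, ∀ p ∈ frontier Ω, ∃ ℓ : E3 →L[ℝ] ℝ, ‖ℓ‖ ≤ 1 ∧
      ∀ x ∈ Ω, ℓ (x - p) ≤ -c * ‖x - p‖ ^ 2 := by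
  have hcpt : IsCompact (frontier Ω) :=
    hΩ.isBounded.isCompact_closure.of_isClosed_subset isClosed_frontier frontier_subset_closure
  refine hcpt.induction_on (p := fun s => ∃ c > 0, ∀ p ∈ s, ∃ ℓ : E3 →L[ℝ] ℝ, ‖ℓ‖ ≤ 1 ∧
      ∀ x ∈ Ω, ℓ (x - p) ≤ -c * ‖x - p‖ ^ 2) ⟨1, one_pos, by simp⟩ ?_ ?_ ?_
  · rintro s t hst ⟨c, hc, h⟩
    exact ⟨c, hc, fun p hp => h p (hst hp)⟩
  · rintro s t ⟨c, hc, h⟩ ⟨c', hc', h'⟩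
    refine ⟨min c c', lt_min hc hc', fun p hp => ?_⟩
    rcases hp with hp | hp
    · obtain ⟨ℓ, hℓ, hx⟩ := h p hp
      refine ⟨ℓ, hℓ, fun x hxΩ => (hx x hxΩ).trans ?_⟩
      gcongr
      exact min_le_left _ _
    · obtain ⟨ℓ, hℓ, hx⟩ := h' p hp
      refine ⟨ℓ, hℓ, fun x hxΩ => (hx x hxΩ).trans ?_⟩
      gcongr
      exact min_le_right _ _
  · intro q hq
    obtain ⟨c, hc, r, hr, h⟩ := exists_local_strict_support hΩ hq
    refine ⟨frontier Ω ∩ Metric.ball q r, inter_mem_nhdsWithin _ (Metric.ball_mem_nhds q hr),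
      c, hc, fun p hp => h p hp.1 hp.2⟩

/-- A set is strongly convex with modulus `c` if a point dividing a chord stays in the set under
perturbations smaller than `c` times the product of the distances to the end points. -/
def StronglyConvexSet (c : ℝ) (Ω : Set E3) : Prop :=
  ∀ a ∈ Ω, ∀ b ∈ Ω, ∀ t : ℝ, 0 ≤ t → t ≤ 1 → ∀ z : E3, a + t • (b - a) + z ∉ Ω →
    c * (t * (1 - t)) * ‖b - a‖ ^ 2 ≤ ‖z‖

/-- The segment from the dividing point `m` to `m + z` meets the boundary at some `p = m + θ • z`.
The supporting functional at `p` is applied to `a` and `b` with weights `1 - t` and `t`: the vectors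
average to `-θ • z`, and the squared distances to `p` average to at least `t (1 - t) ‖b - a‖²`. -/
theorem IsPositivelyCurved.exists_stronglyConvexSet {Ω : Set E3} (hΩ : IsPositivelyCurved Ω) :
    ∃ c > 0, StronglyConvexSet c Ω := by
  obtain ⟨c, hc, h⟩ := exists_strict_support hΩ
  refine ⟨c, hc, fun a ha b hb t ht0 ht1 z hz => ?_⟩
  set m := a + t • (b - a) with hm
  have hmΩ : m ∈ Ω := hΩ.convex.add_smul_sub_mem ha hb ⟨ht0, ht1⟩
  obtain ⟨p, hp, hpf⟩ : ∃ p ∈ segment ℝ m (m + z), p ∈ frontier Ω := by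
    by_contra! hcon
    have hpre : IsPreconnected (segment ℝ m (m + z)) := (convex_segment _ _).isPreconnected
    have hsplit : ∀ p ∈ segment ℝ m (m + z), p ∈ Ω ∨ p ∈ (closure Ω)ᶜ := by
      intro p hp
      by_contra! h'
      exact hcon p hp (by rw [hΩ.isOpen.frontier_eq]; exact ⟨not_notMem.1 h'.2, h'.1⟩)
    obtain ⟨p, -, hp1, hp2⟩ := hpre Ω (closure Ω)ᶜ hΩ.isOpen isClosed_closure.isOpen_compl hsplit
      ⟨m, left_mem_segment ℝ _ _, hmΩ⟩ ⟨m + z, right_mem_segment ℝ _ _,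
        (hsplit _ (right_mem_segment ℝ _ _)).resolve_left hz⟩
    exact hp2 (subset_closure hp1)
  obtain ⟨θ, hθ, rfl⟩ := (segment_eq_image' ℝ m (m + z)).subset hp
  simp only [add_sub_cancel_left] at hpf
  obtain ⟨ℓ, hℓ, hx⟩ := h _ hpf
  set p := m + θ • z with hpdef
  have h1 := hx a ha
  have h2 := hx b hb
  have h3 : (1 - t) * ℓ (a - p) + t * ℓ (b - p) = -θ * ℓ z := by
    have : (1 - t) • (a - p) + t • (b - p) = -θ • z := by
      rw [hpdef, hm]; module
    have h4 := congrArg ℓ this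
    simpa only [map_add, map_smul, smul_eq_mul] using h4
  have h4 : (1 - t) * ‖a - p‖ ^ 2 + t * ‖b - p‖ ^ 2
      = ‖θ • z‖ ^ 2 + t * (1 - t) * ‖b - a‖ ^ 2 := by
    have ha' : a - p = -(t • (b - a)) - θ • z := by rw [hpdef, hm]; module
    have hb' : b - p = (1 - t) • (b - a) - θ • z := by rw [hpdef, hm]; module
    rw [ha', hb', norm_sub_sq_real, norm_sub_sq_real, norm_neg, norm_smul t, norm_smul (1 - t),
      inner_neg_left, real_inner_smul_left, real_inner_smul_left, mul_pow, mul_pow,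
      Real.norm_eq_abs, Real.norm_eq_abs, sq_abs, sq_abs]
    ring
  have h5 : |ℓ z| ≤ ‖z‖ := by
    have := ℓ.le_opNorm z
    rw [Real.norm_eq_abs] at this
    exact this.trans (mul_le_of_le_one_left (norm_nonneg _) hℓ)
  have h6 : θ * ℓ z ≤ ‖z‖ := by
    calc θ * ℓ z ≤ θ * |ℓ z| := mul_le_mul_of_nonneg_left (le_abs_self _) hθ.1
      _ ≤ 1 * ‖z‖ := mul_le_mul hθ.2 h5 (abs_nonneg _) zero_le_one
      _ = ‖z‖ := one_mul _
  have h7 := mul_le_mul_of_nonneg_left h1 (sub_nonneg.2 ht1)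
  have h8 := mul_le_mul_of_nonneg_left h2 ht0
  have h9 : 0 ≤ c * ‖θ • z‖ ^ 2 := by positivity
  have h10 : c * ((1 - t) * ‖a - p‖ ^ 2 + t * ‖b - p‖ ^ 2)
      = c * ‖θ • z‖ ^ 2 + c * (t * (1 - t)) * ‖b - a‖ ^ 2 := by rw [h4]; ring
  nlinarith

end KineticDomain

end

noncomputable section

namespace KineticDomain

open Filter Topology
open scoped ENNReal

/-- Cauchy–Schwarz for the lower Lebesgue integral. -/
theorem lintegral_mul_sq_le {α : Type*} [MeasurableSpace α] (μ : Measure α) {f g : α → ℝ≥0∞}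
    (hf : AEMeasurable f μ) (hg : AEMeasurable g μ) :
    (∫⁻ a, f a * g a ∂μ) ^ 2 ≤ (∫⁻ a, f a ^ 2 ∂μ) * ∫⁻ a, g a ^ 2 ∂μ := by
  have h := ENNReal.lintegral_mul_le_Lp_mul_Lq μ Real.HolderConjugate.two_two hf hg
  simp only [Pi.mul_apply, ENNReal.rpow_ofNat] at h
  calc (∫⁻ a, f a * g a ∂μ) ^ 2
      ≤ ((∫⁻ a, f a ^ 2 ∂μ) ^ (1 / 2 : ℝ) * (∫⁻ a, g a ^ 2 ∂μ) ^ (1 / 2 : ℝ)) ^ 2 := by gcongr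
    _ = _ := by
      rw [mul_pow, ← ENNReal.rpow_natCast, ← ENNReal.rpow_natCast, ← ENNReal.rpow_mul,
        ← ENNReal.rpow_mul]
      norm_num

/-! ### Chords of a strongly convex set -/

section Chords

variable {Ω : Set E3} {c d : ℝ}

/-- The parameters for which the line through `y` in direction `v` is in `Ω`. -/
def chord (Ω : Set E3) (v y : E3) : Set ℝ := {s | y + s • v ∈ Ω}

theorem volume_chord_translate (v y : E3) (s : ℝ) :
    volume (chord Ω v (y + s • v)) = volume (chord Ω v y) := by
  have : chord Ω v (y + s • v) = (fun r => r + s) ⁻¹' chord Ω v y := by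
    ext r
    simp only [chord, mem_ofPred_eq, mem_preimage, add_smul]
    rw [add_assoc, add_comm (s • v)]
  rw [this, measure_preimage_add_right]

theorem measurable_volume_chord (hΩ : MeasurableSet Ω) (v : E3) :
    Measurable fun y => volume (chord Ω v y) := by
  have hs : MeasurableSet {p : E3 × ℝ | p.1 + p.2 • v ∈ Ω} := by
    apply measurableSet_preimage _ hΩ
    fun_prop
  exact measurable_measure_prodMk_left hs

/-- The part of a chord that a translation pushes out of `Ω` is short if the chord is long. -/
theorem volume_chord_mul_volume_le (hc : 0 < c) (hsc : StronglyConvexSet c Ω)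
    (hd : ∀ x ∈ Ω, ∀ y ∈ Ω, ‖x - y‖ ≤ d) {v : E3} (hv : v ≠ 0) (y z : E3) :
    volume (chord Ω v y) * volume {s : ℝ | y + s • v ∈ Ω ∧ y + s • v + z ∉ Ω}
      ≤ ENNReal.ofReal (4 / c * ‖z‖ / ‖v‖ ^ 2) := by
  set J := chord Ω v y with hJ
  have hv0 : 0 < ‖v‖ := norm_pos_iff.2 hv
  rcases J.eq_empty_or_nonempty with h0 | hne
  · simp [h0]
  have hdiff : ∀ a ∈ J, ∀ b ∈ J, |a - b| ≤ d / ‖v‖ := by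
    intro a ha b hb
    rw [le_div_iff₀ hv0]
    have := hd _ ha _ hb
    rwa [add_sub_add_left_eq_sub, ← sub_smul, norm_smul, Real.norm_eq_abs] at this
  obtain ⟨a₀, ha₀⟩ := hne
  have hbelow : BddBelow J := ⟨a₀ - d / ‖v‖, fun b hb => by
    have := (abs_le.1 (hdiff a₀ ha₀ b hb)).2; linarith⟩
  have habove : BddAbove J := ⟨a₀ + d / ‖v‖, fun b hb => by
    have := (abs_le.1 (hdiff a₀ ha₀ b hb)).1; linarith⟩
  set α := sInf J with hα
  set β := sSup J with hβ
  have hJsub : J ⊆ Icc α β := fun s hs => ⟨csInf_le hbelow hs, le_csSup habove hs⟩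
  set κ := ‖z‖ / (c * ‖v‖ ^ 2) with hκ
  -- Strong convexity at the ratio `(s - a) / (b - a)` becomes `(s - a) (b - s) ≤ κ`. The end points
  -- `α`, `β` of the chord need not belong to `J`, so this is extended to all pairs in `J` (in the
  -- mixed orders the product is nonpositive) and then to the closure.
  have hprod : ∀ s ∈ {s : ℝ | y + s • v ∈ Ω ∧ y + s • v + z ∉ Ω}, (s - α) * (β - s) ≤ κ := by
    rintro s ⟨hs, hsz⟩
    have key : ∀ a ∈ J, ∀ b ∈ J, a ≤ s → s ≤ b → (s - a) * (b - s) ≤ κ := by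
      intro a ha b hb has hsb
      rcases eq_or_lt_of_le (has.trans hsb) with hab | hab
      · have : s = a := le_antisymm (by rw [hab]; exact hsb) has
        rw [this, sub_self, zero_mul]
        positivity
      have hba : 0 < b - a := sub_pos.2 hab
      have h1 := hsc _ ha _ hb ((s - a) / (b - a)) (div_nonneg (sub_nonneg.2 has) hba.le)
        ((div_le_one hba).2 (by linarith)) z
      have h2 : y + a • v + ((s - a) / (b - a)) • (y + b • v - (y + a • v)) = y + s • v := by
        rw [add_sub_add_left_eq_sub, ← sub_smul, smul_smul, div_mul_cancel₀ _ hba.ne']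
        module
      rw [h2] at h1
      have h3 := h1 hsz
      rw [add_sub_add_left_eq_sub, ← sub_smul, norm_smul, Real.norm_eq_abs, mul_pow, sq_abs] at h3
      rw [hκ, le_div_iff₀ (by positivity)]
      calc (s - a) * (b - s) * (c * ‖v‖ ^ 2)
          = c * ((s - a) / (b - a) * (1 - (s - a) / (b - a))) * ((b - a) ^ 2 * ‖v‖ ^ 2) := by
            field_simp
            ring
        _ ≤ ‖z‖ := h3
    have key' : ∀ a ∈ J, ∀ b ∈ J, (s - a) * (b - s) ≤ κ := by
      intro a ha b hb
      have hκ0 : 0 ≤ κ := by positivity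
      rcases le_total a s with h1 | h1 <;> rcases le_total s b with h2 | h2
      · exact key a ha b hb h1 h2
      · nlinarith
      · nlinarith
      · have := key b hb a ha h2 h1
        linarith
    have hcl : closure J ×ˢ closure J ⊆ {p : ℝ × ℝ | (s - p.1) * (p.2 - s) ≤ κ} := by
      rw [← closure_prod_eq]
      refine closure_minimal (fun p hp => key' _ hp.1 _ hp.2) ?_
      exact isClosed_le (by fun_prop) continuous_const
    exact hcl (mk_mem_prod (csInf_mem_closure ⟨a₀, ha₀⟩ hbelow)
      (csSup_mem_closure ⟨a₀, ha₀⟩ habove))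
  have hvolJ : volume J ≤ ENNReal.ofReal (β - α) := by
    rw [← Real.volume_Icc]; exact measure_mono hJsub
  rcases eq_or_lt_of_le ((hJsub ha₀).1.trans (hJsub ha₀).2) with hL | hL
  · have : volume J = 0 := by
      rw [← nonpos_iff_eq_zero]; refine hvolJ.trans ?_; simp [hL]
    simp [this]
  have hL' : 0 < β - α := sub_pos.2 hL
  -- The larger of `s - α` and `β - s` is at least half of `β - α`, so the smaller is at most `2 κ /
  -- (β - α)`. The two end intervals have total length `4 κ / (β - α)`, and multiplying by the
  -- length of the chord cancels the denominator.
  have hN : {s : ℝ | y + s • v ∈ Ω ∧ y + s • v + z ∉ Ω}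
      ⊆ Icc α (α + 2 * κ / (β - α)) ∪ Icc (β - 2 * κ / (β - α)) β := by
    intro s hs
    have h1 := hprod s hs
    have h2 := hJsub hs.1
    rcases le_total (s - α) (β - s) with h3 | h3
    · left
      refine ⟨h2.1, ?_⟩
      have : s - α ≤ 2 * κ / (β - α) := by
        rw [le_div_iff₀ hL']
        nlinarith [h2.1]
      linarith
    · right
      refine ⟨?_, h2.2⟩
      have : β - s ≤ 2 * κ / (β - α) := by
        rw [le_div_iff₀ hL']
        nlinarith [h2.2]
      linarith
  have hκ0 : 0 ≤ κ := by positivity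
  calc volume J * volume {s : ℝ | y + s • v ∈ Ω ∧ y + s • v + z ∉ Ω}
      ≤ ENNReal.ofReal (β - α) * ENNReal.ofReal (2 * (2 * κ / (β - α))) := by
        gcongr
        refine (measure_mono hN).trans ((measure_union_le _ _).trans ?_)
        have hq : 0 ≤ 2 * κ / (β - α) := by positivity
        rw [Real.volume_Icc, Real.volume_Icc, ← ENNReal.ofReal_add (by linarith) (by linarith)]
        apply ENNReal.ofReal_le_ofReal
        linarith
    _ = ENNReal.ofReal (4 / c * ‖z‖ / ‖v‖ ^ 2) := by
        rw [← ENNReal.ofReal_mul hL'.le]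
        congr 1
        rw [hκ]
        field_simp
        ring

end Chords

/-! ### Transport along lines: bounds, translates and boundary mass -/

section Transport

variable {Ω : Set E3}

/-- Convexity excludes an exit before a time at which the trajectory is in `Ω`; openness keeps it in
`Ω` slightly longer, which makes the inequality strict. -/
theorem lt_exitTime_iff (hop : IsOpen Ω) (hconv : Convex ℝ Ω) {x : E3} (hx : x ∈ Ω) (v : E3)
    {s : ℝ} (hs : 0 < s) : (s : EReal) < exitTime Ω x v ↔ x - s • v ∈ Ω := by
  constructor
  · intro h
    by_contra hn
    exact absurd h (not_lt.2 (sInf_le ⟨s, ⟨hs, hn⟩, rfl⟩))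
  · intro h
    have hcont : Continuous fun t : ℝ => x - t • v := by fun_prop
    have : {t : ℝ | x - t • v ∈ Ω} ∈ 𝓝 s := (hop.preimage hcont).mem_nhds h
    obtain ⟨δ, hδ, hball⟩ := Metric.mem_nhds_iff.1 this
    have hle : ((s + δ / 2 : ℝ) : EReal) ≤ exitTime Ω x v := by
      apply le_sInf
      rintro _ ⟨t, ⟨ht0, htΩ⟩, rfl⟩
      simp only [EReal.coe_le_coe_iff]
      by_contra! hlt
      apply htΩ
      have hend : x - (s + δ / 2) • v ∈ Ω := hball (by
        rw [Metric.mem_ball, Real.dist_eq, add_sub_cancel_left, abs_of_pos (half_pos hδ)]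
        linarith)
      have hpos : 0 < s + δ / 2 := by positivity
      have := hconv hx hend (a := 1 - t / (s + δ / 2)) (b := t / (s + δ / 2))
        (sub_nonneg.2 ((div_le_one hpos).2 hlt.le)) (by positivity) (by ring)
      convert this using 1
      have h2 : (t / (s + δ / 2)) * (s + δ / 2) = t := div_mul_cancel₀ _ hpos.ne'
      rw [smul_sub, smul_smul, h2]
      module
    exact lt_of_lt_of_le (by exact_mod_cast (by linarith : s < s + δ / 2)) hle

/-- Transport along a fixed velocity `v`, with attenuation `a`, up to the time `d / |v|`. -/
def lineTransport (d a : ℝ) (v : E3) (h : E3 → ℝ) (x : E3) : ℝ :=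
  ∫ s in Ioc 0 (d / ‖v‖), Real.exp (-a * s) * h (x - s • v)

variable {c d : ℝ}

/-- This trades the exit time, which depends on `x`, for the fixed time `d / ‖v‖`: the zero
extension vanishes after the exit, and the exit occurs by that time. The resulting operator commutes
with translations. For `v = 0` the horizon `d / ‖v‖` is `0` by convention, hence the exclusion. -/
theorem transport_eq_lineTransport (hop : IsOpen Ω) (hconv : Convex ℝ Ω)
    (hd : ∀ x ∈ Ω, ∀ y ∈ Ω, ‖x - y‖ ≤ d) (ν : E3 → ℝ) (h : E3 × E3 → ℝ) {x v : E3}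
    (hx : x ∈ Ω) (hv : v ≠ 0) :
    transport Ω ν h (x, v)
      = lineTransport d (ν v) v (fun y => zeroExtension Ω h (y, v)) x := by
  have hset : {s : ℝ | 0 < s ∧ (s : EReal) < exitTime Ω x v} = {s : ℝ | 0 < s ∧ x - s • v ∈ Ω} := by
    ext s
    exact and_congr_right fun hs => lt_exitTime_iff hop hconv hx v hs
  have hcont : Continuous fun t : ℝ => x - t • v := by fun_prop
  have hm : MeasurableSet {s : ℝ | 0 < s ∧ x - s • v ∈ Ω} :=
    (measurableSet_lt measurable_const measurable_id).inter
      (hcont.measurable hop.measurableSet)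
  have hsub : {s : ℝ | 0 < s ∧ x - s • v ∈ Ω} ⊆ Ioc 0 (d / ‖v‖) := by
    rintro s ⟨hs, hsΩ⟩
    refine ⟨hs, ?_⟩
    rw [le_div_iff₀ (norm_pos_iff.2 hv)]
    have := hd _ hx _ hsΩ
    rwa [sub_sub_cancel, norm_smul, Real.norm_eq_abs, abs_of_pos hs] at this
  unfold transport lineTransport
  simp only [hset]
  rw [setIntegral_eq_of_subset_of_forall_sdiff_eq_zero measurableSet_Ioc hsub
    (f := fun s => Real.exp (-ν v * s) * zeroExtension Ω h (x - s • v, v))]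
  · refine setIntegral_congr_fun hm fun s hs => ?_
    simp only [zeroExtension]
    rw [indicator_of_mem (show (x - s • v, v) ∈ Ω ×ˢ univ from ⟨hs.2, mem_univ _⟩)]
  · rintro s ⟨hs1, hs2⟩
    have : x - s • v ∉ Ω := fun h' => hs2 ⟨hs1.1, h'⟩
    simp only [zeroExtension]
    rw [indicator_of_notMem (fun h' : (x - s • v, v) ∈ Ω ×ˢ univ => this h'.1), mul_zero]

theorem enorm_exp_mul_le {a s : ℝ} (ha : 0 ≤ a) (hs : 0 < s) (t : ℝ) :
    ‖Real.exp (-a * s) * t‖ₑ ≤ ‖t‖ₑ := by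
  rw [enorm_mul]
  refine mul_le_of_le_one_left' ?_
  rw [← ofReal_norm, Real.norm_eq_abs, Real.abs_exp, ← ENNReal.ofReal_one]
  apply ENNReal.ofReal_le_ofReal
  rw [Real.exp_le_one_iff]
  nlinarith

theorem enorm_lineTransport_le {a : ℝ} (ha : 0 ≤ a) (v : E3) (h : E3 → ℝ) (x : E3) :
    ‖lineTransport d a v h x‖ₑ ≤ ∫⁻ s in Ioc 0 (d / ‖v‖), ‖h (x - s • v)‖ₑ := by
  refine (enorm_integral_le_lintegral_enorm _).trans ?_
  refine setLIntegral_mono' measurableSet_Ioc fun s hs => enorm_exp_mul_le ha hs.1 _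

/-- Cauchy–Schwarz on the time interval gives one factor `d / ‖v‖`; Tonelli and translation
invariance give the other. -/
theorem lintegral_sq_line_le {g : E3 → ℝ≥0∞} (hg : Measurable g) (v : E3) :
    ∫⁻ x, (∫⁻ s in Ioc 0 (d / ‖v‖), g (x - s • v)) ^ 2
      ≤ ENNReal.ofReal (d / ‖v‖) ^ 2 * ∫⁻ x, g x ^ 2 := by
  have hmeas : Measurable fun p : E3 × ℝ => g (p.1 - p.2 • v) := by fun_prop
  calc ∫⁻ x, (∫⁻ s in Ioc 0 (d / ‖v‖), g (x - s • v)) ^ 2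
      ≤ ∫⁻ x, ENNReal.ofReal (d / ‖v‖) * ∫⁻ s in Ioc 0 (d / ‖v‖), g (x - s • v) ^ 2 := by
        refine lintegral_mono fun x => ?_
        have := lintegral_mul_sq_le (volume.restrict (Ioc 0 (d / ‖v‖)))
          (f := fun _ => 1) (g := fun s => g (x - s • v)) aemeasurable_const
          (hmeas.comp measurable_prodMk_left).aemeasurable
        simpa using this
    _ = ENNReal.ofReal (d / ‖v‖) * ∫⁻ s in Ioc 0 (d / ‖v‖), ∫⁻ x, g (x - s • v) ^ 2 := by
        rw [lintegral_const_mul' _ _ ENNReal.ofReal_ne_top, lintegral_lintegral_swap]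
        exact (hmeas.pow_const 2).aemeasurable
    _ = ENNReal.ofReal (d / ‖v‖) ^ 2 * ∫⁻ x, g x ^ 2 := by
        have : ∀ s : ℝ, ∫⁻ x, g (x - s • v) ^ 2 = ∫⁻ x, g x ^ 2 := fun s =>
          lintegral_sub_right_eq_self (fun x => g x ^ 2) (s • v)
        simp only [this, lintegral_const, Measure.restrict_apply_univ, Real.volume_Ioc, sub_zero]
        ring

theorem lintegral_lineTransport_sq_le {a : ℝ} (ha : 0 ≤ a) (v : E3) {h : E3 → ℝ}
    (hh : Measurable h) :
    ∫⁻ x, ‖lineTransport d a v h x‖ₑ ^ 2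
      ≤ ENNReal.ofReal (d / ‖v‖) ^ 2 * ∫⁻ x, ‖h x‖ₑ ^ 2 := by
  refine le_trans (lintegral_mono fun x => ?_) (lintegral_sq_line_le hh.enorm v)
  gcongr
  exact enorm_lineTransport_le ha v h x

theorem lintegral_lineTransport_le {a : ℝ} (ha : 0 ≤ a) (v : E3) {h : E3 → ℝ}
    (hh : Measurable h) :
    ∫⁻ x, ‖lineTransport d a v h x‖ₑ ≤ ENNReal.ofReal (d / ‖v‖) * ∫⁻ x, ‖h x‖ₑ := by
  have hmeas : Measurable fun p : E3 × ℝ => ‖h (p.1 - p.2 • v)‖ₑ := by fun_prop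
  calc ∫⁻ x, ‖lineTransport d a v h x‖ₑ
      ≤ ∫⁻ x, ∫⁻ s in Ioc 0 (d / ‖v‖), ‖h (x - s • v)‖ₑ :=
        lintegral_mono fun x => enorm_lineTransport_le ha v h x
    _ = ∫⁻ s in Ioc 0 (d / ‖v‖), ∫⁻ x, ‖h (x - s • v)‖ₑ :=
        lintegral_lintegral_swap hmeas.aemeasurable
    _ = _ := by
        have : ∀ s : ℝ, ∫⁻ x, ‖h (x - s • v)‖ₑ = ∫⁻ x, ‖h x‖ₑ := fun s =>
          lintegral_sub_right_eq_self (fun x => ‖h x‖ₑ) (s • v)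
        simp only [this, lintegral_const, Measure.restrict_apply_univ, Real.volume_Ioc, sub_zero]
        rw [mul_comm]

theorem ae_integrableOn_line (v : E3) {h : E3 → ℝ} (hh : Measurable h)
    (hfin : ∫⁻ x, ‖h x‖ₑ ^ 2 < ∞) (a : ℝ) (ha : 0 ≤ a) :
    ∀ᵐ x : E3, IntegrableOn (fun s => Real.exp (-a * s) * h (x - s • v)) (Ioc 0 (d / ‖v‖)) := by
  have h1 := lintegral_sq_line_le (d := d) hh.enorm v
  have h2 : ∫⁻ x, (∫⁻ s in Ioc 0 (d / ‖v‖), ‖h (x - s • v)‖ₑ) ^ 2 ≠ ∞ :=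
    ne_top_of_le_ne_top (ENNReal.mul_ne_top (ENNReal.pow_ne_top ENNReal.ofReal_ne_top) hfin.ne) h1
  have hmeas : Measurable fun p : E3 × ℝ => ‖h (p.1 - p.2 • v)‖ₑ := by fun_prop
  filter_upwards [ae_lt_top (hmeas.lintegral_prod_right'.pow_const 2) h2] with x hx
  refine ⟨by fun_prop, ?_⟩
  have hx' : ∫⁻ s in Ioc 0 (d / ‖v‖), ‖h (x - s • v)‖ₑ < ∞ := by
    by_contra hcon
    rw [not_lt, top_le_iff] at hcon
    rw [hcon] at hx
    simp at hx
  exact lt_of_le_of_lt (setLIntegral_mono' measurableSet_Ioc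
    fun s hs => enorm_exp_mul_le ha hs.1 _) hx'

/-- Transport commutes with translations, so this is the `L²` bound for `h (· + z) - h`.
Integrability along almost every line is needed because a difference of integrals is merged into
one. -/
theorem lintegral_lineTransport_translate_sub_sq_le {a : ℝ} (ha : 0 ≤ a) (v : E3) {h : E3 → ℝ}
    (hh : Measurable h) (hfin : ∫⁻ x, ‖h x‖ₑ ^ 2 < ∞) (z : E3) :
    ∫⁻ x, ‖lineTransport d a v h (x + z) - lineTransport d a v h x‖ₑ ^ 2
      ≤ ENNReal.ofReal (d / ‖v‖) ^ 2 * ∫⁻ x, ‖h (x + z) - h x‖ₑ ^ 2 := by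
  have hint := ae_integrableOn_line (d := d) v hh hfin a ha
  have hint' : ∀ᵐ x : E3, IntegrableOn
      (fun s => Real.exp (-a * s) * h (x + z - s • v)) (Ioc 0 (d / ‖v‖)) :=
    (measurePreserving_add_right volume z).quasiMeasurePreserving.ae hint
  refine le_trans ?_ (lintegral_lineTransport_sq_le (d := d) ha v
    (h := fun x => h (x + z) - h x) (by fun_prop))
  refine lintegral_mono_ae ?_
  filter_upwards [hint, hint'] with x h1 h2
  apply le_of_eq
  congr 2
  unfold lineTransport
  rw [← integral_sub h2 h1]
  congr 1
  ext s
  rw [mul_sub, sub_add_eq_add_sub]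

/-- The part of the transported density that a translation by `z` pushes out of `Ω`. -/
theorem setLIntegral_boundary_lineTransport_sq_le (hop : IsOpen Ω) (hc : 0 < c)
    (hsc : StronglyConvexSet c Ω) (hd : ∀ x ∈ Ω, ∀ y ∈ Ω, ‖x - y‖ ≤ d) {a : ℝ} (ha : 0 ≤ a)
    {v : E3} (hv : v ≠ 0) {h : E3 → ℝ} (hh : Measurable h) (hsupp : ∀ x ∉ Ω, h x = 0) (z : E3) :
    ∫⁻ x in {x | x ∈ Ω ∧ x + z ∉ Ω}, ‖lineTransport d a v h x‖ₑ ^ 2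
      ≤ ENNReal.ofReal (4 / c * ‖z‖ / ‖v‖ ^ 2) * ∫⁻ x, ‖h x‖ₑ ^ 2 := by
  set D : Set E3 := {x | x ∈ Ω ∧ x + z ∉ Ω} with hD
  have hDm : MeasurableSet D :=
    hop.measurableSet.inter ((measurable_add_const z) hop.measurableSet).compl
  -- Cauchy–Schwarz on the times spent in `Ω`, instead of on the whole interval, produces the length
  -- of the chord through `x`.
  have hpt : ∀ x, ‖lineTransport d a v h x‖ₑ ^ 2
      ≤ volume (chord Ω v x) * ∫⁻ s : ℝ, ‖h (x - s • v)‖ₑ ^ 2 := by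
    intro x
    set I : Set ℝ := {s | x - s • v ∈ Ω} with hI
    have hIm : MeasurableSet I := by
      have : Continuous fun s : ℝ => x - s • v := by fun_prop
      exact this.measurable hop.measurableSet
    have hIvol : volume I = volume (chord Ω v x) := by
      have : I = (fun s : ℝ => -s) ⁻¹' chord Ω v x := by
        ext s; simp [hI, chord, sub_eq_add_neg]
      rw [this, Measure.measure_preimage_neg]
    calc ‖lineTransport d a v h x‖ₑ ^ 2
        ≤ (∫⁻ s in Ioc 0 (d / ‖v‖), ‖h (x - s • v)‖ₑ) ^ 2 := by
          gcongr; exact enorm_lineTransport_le ha v h x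
      _ ≤ (∫⁻ s, I.indicator 1 s * ‖h (x - s • v)‖ₑ) ^ 2 := by
          refine pow_le_pow_left' ((setLIntegral_le_lintegral _ _).trans
            (lintegral_mono fun s => ?_)) 2
          by_cases hs : s ∈ I
          · simp [hs]
          · simp [hsupp _ hs]
      _ ≤ (∫⁻ s, I.indicator 1 s ^ 2) * ∫⁻ s : ℝ, ‖h (x - s • v)‖ₑ ^ 2 :=
          lintegral_mul_sq_le volume (measurable_one.indicator hIm).aemeasurable (by fun_prop)
      _ = volume (chord Ω v x) * ∫⁻ s : ℝ, ‖h (x - s • v)‖ₑ ^ 2 := by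
          congr 1
          have : ∀ s, (I.indicator (1 : ℝ → ℝ≥0∞) s) ^ 2 = I.indicator 1 s := by
            intro s; by_cases hs : s ∈ I <;> simp [hs]
          simp only [this]
          rw [lintegral_indicator_one hIm, hIvol]
  have hVm := measurable_volume_chord hop.measurableSet v
  calc ∫⁻ x in D, ‖lineTransport d a v h x‖ₑ ^ 2
      ≤ ∫⁻ x, D.indicator 1 x * (volume (chord Ω v x) * ∫⁻ s : ℝ, ‖h (x - s • v)‖ₑ ^ 2) := by
        rw [← lintegral_indicator hDm]
        refine lintegral_mono fun x => ?_
        by_cases hx : x ∈ D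
        · simpa [hx] using hpt x
        · simp [hx]
    _ = ∫⁻ x, ∫⁻ s : ℝ, D.indicator 1 x * volume (chord Ω v x) * ‖h (x - s • v)‖ₑ ^ 2 := by
        refine lintegral_congr fun x => ?_
        rw [lintegral_const_mul _ (by fun_prop), mul_assoc]
    _ = ∫⁻ s : ℝ, ∫⁻ x, D.indicator 1 x * volume (chord Ω v x) * ‖h (x - s • v)‖ₑ ^ 2 := by
        refine lintegral_lintegral_swap (Measurable.aemeasurable ?_)
        refine Measurable.mul ?_ (by fun_prop)
        exact ((measurable_one.indicator hDm).mul hVm).comp measurable_fst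
    -- The substitution `x = y + s • v` moves the density to `y`. The chord length is constant along
    -- the line, so the integral in `s` is exactly chord length times the length pushed out of `Ω`.
    _ = ∫⁻ s : ℝ, ∫⁻ y, D.indicator 1 (y + s • v) * volume (chord Ω v y) * ‖h y‖ₑ ^ 2 := by
        refine lintegral_congr fun s => ?_
        rw [← lintegral_add_right_eq_self _ (s • v)]
        refine lintegral_congr fun y => ?_
        rw [volume_chord_translate, add_sub_cancel_right]
    _ = ∫⁻ y, ∫⁻ s : ℝ, D.indicator 1 (y + s • v) * volume (chord Ω v y) * ‖h y‖ₑ ^ 2 := by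
        refine lintegral_lintegral_swap (Measurable.aemeasurable ?_)
        refine Measurable.mul (Measurable.mul ?_ ?_) (by fun_prop)
        · exact (measurable_one.indicator hDm).comp (by fun_prop)
        · exact hVm.comp measurable_snd
    _ ≤ ∫⁻ y, ENNReal.ofReal (4 / c * ‖z‖ / ‖v‖ ^ 2) * ‖h y‖ₑ ^ 2 := by
        refine lintegral_mono fun y => ?_
        have hm : MeasurableSet ((fun s : ℝ => y + s • v) ⁻¹' D) := by
          have : Measurable fun s : ℝ => y + s • v := by fun_prop
          exact this hDm
        have h1 : ∫⁻ s : ℝ, D.indicator 1 (y + s • v)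
            = volume {s : ℝ | y + s • v ∈ Ω ∧ y + s • v + z ∉ Ω} := by
          exact lintegral_indicator_one hm
        have h2 : Measurable fun s : ℝ => D.indicator (1 : E3 → ℝ≥0∞) (y + s • v) :=
          (measurable_one.indicator hDm).comp (by fun_prop)
        rw [lintegral_mul_const' _ _ (by finiteness), lintegral_mul_const _ h2, h1,
          mul_comm (volume _)]
        gcongr
        exact volume_chord_mul_volume_le hc hsc hd hv y z
    _ = _ := lintegral_const_mul' _ _ ENNReal.ofReal_ne_top

end Transport

end KineticDomain

end

noncomputable section

namespace KineticDomain

open Filter Topology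
open scoped ENNReal

/-! ### Singular Gaussian integrals -/

section Gaussian

variable {E : Type*} [NormedAddCommGroup E] [NormedSpace ℝ E] [FiniteDimensional ℝ E]
  [Nontrivial E] [MeasurableSpace E] [BorelSpace E] (μ : Measure E) [μ.IsAddHaarMeasure]

theorem integrable_norm_rpow_mul_exp {q b : ℝ} (hq : q < Module.finrank ℝ E) (hb : 0 < b) :
    Integrable (fun x : E => ‖x‖ ^ (-q) * Real.exp (-b * ‖x‖ ^ 2)) μ := by
  rw [integrable_fun_norm_addHaar μ (f := fun r => r ^ (-q) * Real.exp (-b * r ^ 2))]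
  have hdim : 1 ≤ Module.finrank ℝ E := Module.finrank_pos
  refine (integrableOn_rpow_mul_exp_neg_mul_sq hb
    (s := (Module.finrank ℝ E : ℝ) - 1 - q) (by linarith)).congr_fun ?_ measurableSet_Ioi
  intro r hr
  have hr' : 0 < r := hr
  simp only [smul_eq_mul]
  rw [← mul_assoc, ← Real.rpow_natCast r (_ - 1), ← Real.rpow_add hr']
  congr 2
  push_cast [hdim]
  ring

/-- Uniformity in the centre `u` comes from splitting at `‖x‖ = 1`: outside, the singular factor is
at most 1; inside, the Gaussian is at most `1 ≤ exp 1 * exp (-‖x‖²)`, which does not involve `u`. -/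
theorem exists_integral_norm_rpow_mul_exp_le {q b : ℝ} (hq0 : 0 ≤ q)
    (hq : q < Module.finrank ℝ E) (hb : 0 < b) :
    ∃ C : ℝ, 0 < C ∧ ∀ u : E,
      ∫⁻ x, ENNReal.ofReal ((1 + ‖x‖ ^ (-q)) * Real.exp (-b * ‖x - u‖ ^ 2)) ∂μ
        ≤ ENNReal.ofReal C := by
  have h1 := integrable_norm_rpow_mul_exp μ hq one_pos
  have hdim : 1 ≤ Module.finrank ℝ E := Module.finrank_pos
  have h0 : Integrable (fun x : E => Real.exp (-b * ‖x‖ ^ 2)) μ := by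
    simpa using integrable_norm_rpow_mul_exp μ (q := 0) (by exact_mod_cast hdim) hb
  set I0 := ∫ x : E, Real.exp (-b * ‖x‖ ^ 2) ∂μ with hI0
  set I1 := ∫ x : E, ‖x‖ ^ (-q) * Real.exp (-1 * ‖x‖ ^ 2) ∂μ with hI1
  have hI0' : 0 ≤ I0 := integral_nonneg fun x => (Real.exp_pos _).le
  have hI1' : 0 ≤ I1 := integral_nonneg fun x => by positivity
  refine ⟨2 * I0 + Real.exp 1 * I1 + 1, by positivity, fun u => ?_⟩
  have hu : Integrable (fun x : E => Real.exp (-b * ‖x - u‖ ^ 2)) μ := h0.comp_sub_right u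
  have hmaj : Integrable (fun x : E => 2 * Real.exp (-b * ‖x - u‖ ^ 2)
      + Real.exp 1 * (‖x‖ ^ (-q) * Real.exp (-1 * ‖x‖ ^ 2))) μ :=
    (hu.const_mul 2).add (h1.const_mul _)
  calc ∫⁻ x, ENNReal.ofReal ((1 + ‖x‖ ^ (-q)) * Real.exp (-b * ‖x - u‖ ^ 2)) ∂μ
      ≤ ∫⁻ x, ENNReal.ofReal (2 * Real.exp (-b * ‖x - u‖ ^ 2)
          + Real.exp 1 * (‖x‖ ^ (-q) * Real.exp (-1 * ‖x‖ ^ 2))) ∂μ := by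
        refine lintegral_mono fun x => ENNReal.ofReal_le_ofReal ?_
        have he : Real.exp (-b * ‖x - u‖ ^ 2) ≤ 1 := by
          rw [Real.exp_le_one_iff]; nlinarith [sq_nonneg ‖x - u‖]
        have hx0 : 0 ≤ ‖x‖ ^ (-q) := by positivity
        rcases le_total 1 ‖x‖ with hx | hx
        · have : ‖x‖ ^ (-q) ≤ 1 := Real.rpow_le_one_of_one_le_of_nonpos hx (by linarith)
          have h3 : 0 ≤ Real.exp 1 * (‖x‖ ^ (-q) * Real.exp (-1 * ‖x‖ ^ 2)) := by positivity
          nlinarith [Real.exp_pos (-b * ‖x - u‖ ^ 2)]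
        · have h4 : 1 ≤ Real.exp 1 * Real.exp (-1 * ‖x‖ ^ 2) := by
            rw [← Real.exp_add]
            apply Real.one_le_exp
            nlinarith [norm_nonneg x]
          have h5 : ‖x‖ ^ (-q) ≤ ‖x‖ ^ (-q) * (Real.exp 1 * Real.exp (-1 * ‖x‖ ^ 2)) :=
            le_mul_of_one_le_right hx0 h4
          have h6 : ‖x‖ ^ (-q) * Real.exp (-b * ‖x - u‖ ^ 2) ≤ ‖x‖ ^ (-q) :=
            mul_le_of_le_one_right hx0 he
          nlinarith [Real.exp_pos (-b * ‖x - u‖ ^ 2)]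
    _ = ENNReal.ofReal (2 * I0 + Real.exp 1 * I1) := by
        rw [← ofReal_integral_eq_lintegral_ofReal hmaj
          (Eventually.of_forall fun x => by positivity),
          integral_add (hu.const_mul 2) (h1.const_mul _), integral_const_mul, integral_const_mul,
          integral_sub_right_eq_self (fun x => Real.exp (-b * ‖x‖ ^ 2)) u]
    _ ≤ _ := ENNReal.ofReal_le_ofReal (by linarith)

end Gaussian

/-! ### Cartesian and polar coordinates in three dimensions -/

section Coordinates

theorem lintegral_euclidean_three {F : E3 → ℝ≥0∞} (hF : Measurable F) :
    ∫⁻ y, F y = ∫⁻ a : ℝ, ∫⁻ q : ℝ × ℝ, F !₂[a, q.1, q.2] := by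
  have h1 := (PiLp.volume_preserving_toLp (Fin 3)).lintegral_comp hF
  have hF1 : Measurable fun y : Fin 3 → ℝ => F (WithLp.toLp 2 y) :=
    hF.comp (PiLp.volume_preserving_toLp (Fin 3)).measurable
  have h2 := ((volume_preserving_piFinSuccAbove (fun _ : Fin 3 => ℝ) 0).symm).lintegral_comp hF1
  have hF2 : Measurable fun p : ℝ × (Fin 2 → ℝ) =>
      F (WithLp.toLp 2 ((MeasurableEquiv.piFinSuccAbove (fun _ : Fin 3 => ℝ) 0).symm p)) :=
    hF1.comp (MeasurableEquiv.measurable _)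
  rw [← h1, ← h2, Measure.volume_eq_prod, lintegral_prod _ hF2.aemeasurable]
  refine lintegral_congr fun a => ?_
  have hF3 : Measurable fun p : Fin 2 → ℝ =>
      F (WithLp.toLp 2 ((MeasurableEquiv.piFinSuccAbove (fun _ : Fin 3 => ℝ) 0).symm (a, p))) :=
    hF2.comp measurable_prodMk_left
  rw [← ((volume_preserving_finTwoArrow ℝ).symm).lintegral_comp hF3]
  refine lintegral_congr fun q => ?_
  congr 2
  ext i
  fin_cases i <;> rfl

/-- Some linear isometry maps the first basis vector to a given unit vector. -/
theorem exists_isometry_map_first {e : E3} (he : ‖e‖ = 1) :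
    ∃ R : E3 ≃ₗᵢ[ℝ] E3, R !₂[1, 0, 0] = e := by
  have h1 : ‖(!₂[1, 0, 0] : E3)‖ = ‖e‖ := by
    rw [he, EuclideanSpace.norm_eq]; simp [Fin.sum_univ_three]
  exact ⟨_, Submodule.reflection_sub h1⟩

theorem norm_sq_three (a b c : ℝ) : ‖(!₂[a, b, c] : E3)‖ ^ 2 = a ^ 2 + b ^ 2 + c ^ 2 := by
  rw [EuclideanSpace.norm_sq_eq]; simp [Fin.sum_univ_three]

theorem inner_first (y : E3) : inner ℝ y (!₂[1, 0, 0] : E3) = y 0 := by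
  simp [PiLp.inner_apply, Fin.sum_univ_three]

/-- From `|b c| ≤ b² + c²`: the singularity `‖y‖⁻¹` splits into a product of two half powers, each
integrable on a line. The cases `b = 0` and `c = 0` are excepted because `0 ^ (-1/2) = 0` by
convention. -/
theorem inv_norm_three_le (a b c : ℝ) :
    ‖(!₂[a, b, c] : E3)‖⁻¹ ≤ |b| ^ (-(1 / 2) : ℝ) * |c| ^ (-(1 / 2) : ℝ) ∨ b = 0 ∨ c = 0 := by
  by_cases hb : b = 0
  · exact Or.inr (Or.inl hb)
  by_cases hc : c = 0
  · exact Or.inr (Or.inr hc)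
  left
  have hb' : 0 < |b| := abs_pos.2 hb
  have hc' : 0 < |c| := abs_pos.2 hc
  rw [← Real.mul_rpow hb'.le hc'.le, Real.rpow_neg (by positivity), ← Real.sqrt_eq_rpow]
  apply inv_anti₀ (by positivity)
  apply Real.sqrt_le_iff.2 ⟨norm_nonneg _, ?_⟩
  rw [norm_sq_three, ← abs_mul]
  have h1 : |b * c| ≤ b ^ 2 + c ^ 2 := by
    rw [abs_le]; constructor <;> nlinarith [sq_nonneg (b - c), sq_nonneg (b + c)]
  nlinarith [sq_nonneg a]

theorem lintegral_polar {F : E3 → ℝ≥0∞} (hF : Measurable F) :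
    ∫⁻ x, F x = ∫⁻ α : Metric.sphere (0 : E3) 1, ∫⁻ r in Ioi (0 : ℝ),
      ENNReal.ofReal (r ^ 2) * F (r • (α : E3)) ∂volume ∂(volume : Measure E3).toSphere := by
  have hmp := (volume : Measure E3).measurePreserving_homeomorphUnitSphereProd
  have hdim : Module.finrank ℝ E3 - 1 = 2 := by simp
  rw [hdim] at hmp
  have hG : Measurable fun p : Metric.sphere (0 : E3) 1 × Ioi (0 : ℝ) =>
      F ((p.2 : ℝ) • (p.1 : E3)) := by fun_prop
  have h1 := hmp.lintegral_comp hG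
  have h2 : ∀ x : ({0}ᶜ : Set E3), F (((homeomorphUnitSphereProd E3 x).2 : ℝ) •
      ((homeomorphUnitSphereProd E3 x).1 : E3)) = F x := by
    intro x
    congr 1
    have : ‖(x : E3)‖ ≠ 0 := norm_ne_zero_iff.2 x.2
    simp [smul_smul, this]
  simp only [h2] at h1
  rw [lintegral_subtype_comap (measurableSet_singleton _).compl F,
    restrict_compl_singleton] at h1
  rw [h1, lintegral_prod _ hG.aemeasurable]
  refine lintegral_congr fun α => ?_
  rw [Measure.volumeIoiPow, lintegral_withDensity_eq_lintegral_mul _ (by fun_prop) (by fun_prop)]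
  exact lintegral_subtype_comap measurableSet_Ioi
    (fun r : ℝ => ENNReal.ofReal (r ^ 2) * F (r • (α : E3)))

end Coordinates

end KineticDomain

end

/-! ### The symmetry that exchanges the two post-collisional velocities -/

noncomputable section

namespace KineticDomain

open Filter Topology
open scoped ENNReal

section Swap

theorem lintegral_cylindrical {F : E3 → ℝ≥0∞} (hF : Measurable F)
    (h0 : ∀ y : E3, y 0 ≤ 0 → F y = 0) :
    ∫⁻ y, F y = ∫⁻ a in Ioi (0 : ℝ), ∫⁻ ρ in Ioi (0 : ℝ), ∫⁻ φ in Ioo (-Real.pi) Real.pi,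
      ENNReal.ofReal ρ * F !₂[a, ρ * Real.cos φ, ρ * Real.sin φ] := by
  have hvec : Measurable fun p : ℝ × ℝ × ℝ => (!₂[p.1, p.2.1, p.2.2] : E3) := by
    refine (PiLp.volume_preserving_toLp (Fin 3)).measurable.comp
      (measurable_pi_lambda _ fun i => ?_)
    fin_cases i
    · exact measurable_fst
    · exact measurable_fst.comp measurable_snd
    · exact measurable_snd.comp measurable_snd
  rw [lintegral_euclidean_three hF, ← setLIntegral_eq_of_support_subset (s := Ioi (0 : ℝ))]
  · refine lintegral_congr fun a => ?_
    rw [← lintegral_comp_polarCoord_symm, polarCoord_target, Measure.volume_eq_prod,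
      ← Measure.prod_restrict, lintegral_prod]
    · rfl
    · apply Measurable.aemeasurable
      refine (ENNReal.measurable_ofReal.comp measurable_fst).smul ?_
      have hm : Measurable fun p : ℝ × ℝ => polarCoord.symm p := by
        simp only [polarCoord_symm_apply]; fun_prop
      exact hF.comp (hvec.comp (measurable_const.prodMk hm))
  · intro a ha
    by_contra hcon
    apply ha
    simp only [mem_Ioi, not_lt] at hcon
    have : ∀ q : ℝ × ℝ, F !₂[a, q.1, q.2] = 0 := fun q => h0 _ (by simpa using hcon)
    simp [this]

/-- In cylindrical coordinates around the first axis the weighted measure is `a ρ / (a² + ρ²)^(1/2)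
da dρ dφ`, symmetric in `a` and `ρ`. Exchanging them turns the projection of the first basis vector
onto `y` into the complementary leg of the right triangle, up to the half-turn `S` about the axis,
and the half-turn also preserves the integral. -/
theorem lintegral_halfSpace_swap {G : E3 → ℝ≥0∞} (hG : Measurable G) :
    ∫⁻ y in Metric.ball (0 : E3) 1, ENNReal.ofReal (y 0 / ‖y‖) * G ((y 0 / ‖y‖ ^ 2) • y)
      = ∫⁻ y in Metric.ball (0 : E3) 1,
          ENNReal.ofReal (y 0 / ‖y‖) * G (!₂[1, 0, 0] - (y 0 / ‖y‖ ^ 2) • y) := by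
  set χ : ℝ → ℝ≥0∞ := (Iio (1 : ℝ)).indicator 1 with hχ
  have hχm : Measurable χ := measurable_one.indicator measurableSet_Iio
  have hball : ∀ F : E3 → ℝ≥0∞, ∫⁻ y in Metric.ball (0 : E3) 1, F y
      = ∫⁻ y, χ (‖y‖ ^ 2) * F y := by
    intro F
    rw [← lintegral_indicator measurableSet_ball]
    refine lintegral_congr fun y => ?_
    have : y ∈ Metric.ball (0 : E3) 1 ↔ ‖y‖ ^ 2 < 1 := by
      rw [mem_ball_zero_iff, sq_lt_one_iff₀ (norm_nonneg y)]
    by_cases hy : y ∈ Metric.ball (0 : E3) 1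
    · simp [hy, hχ, this.1 hy]
    · have h2 : ¬ (‖y‖ ^ 2 < 1) := fun h => hy (this.2 h)
      simp [hy, hχ, h2]
  have hcoord : Measurable fun y : E3 => y 0 := by fun_prop
  rw [hball, hball]
  set S : E3 → E3 := fun y => (2 * y 0) • !₂[1, 0, 0] - y with hS
  have hR : ∫⁻ y, χ (‖y‖ ^ 2) * (ENNReal.ofReal (y 0 / ‖y‖)
        * G (!₂[1, 0, 0] - (y 0 / ‖y‖ ^ 2) • y))
      = ∫⁻ y, χ (‖y‖ ^ 2) * (ENNReal.ofReal (y 0 / ‖y‖)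
        * G (!₂[1, 0, 0] - (y 0 / ‖y‖ ^ 2) • S y)) := by
    have hm1 : Measurable fun y : E3 => χ (‖y‖ ^ 2) * (ENNReal.ofReal (y 0 / ‖y‖)
        * G (!₂[1, 0, 0] - (y 0 / ‖y‖ ^ 2) • y)) := by fun_prop
    have hm2 : Measurable fun y : E3 => χ (‖y‖ ^ 2) * (ENNReal.ofReal (y 0 / ‖y‖)
        * G (!₂[1, 0, 0] - (y 0 / ‖y‖ ^ 2) • S y)) := by fun_prop
    rw [lintegral_euclidean_three hm1, lintegral_euclidean_three hm2]
    refine lintegral_congr fun a => ?_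
    rw [← lintegral_neg_eq_self]
    refine lintegral_congr fun q => ?_
    have h1 : ‖(!₂[a, (-q).1, (-q).2] : E3)‖ = ‖(!₂[a, q.1, q.2] : E3)‖ := by
      rw [← sq_eq_sq₀ (norm_nonneg _) (norm_nonneg _), norm_sq_three, norm_sq_three]; simp
    have h2 : S !₂[a, q.1, q.2] = !₂[a, (-q).1, (-q).2] := by
      ext i; fin_cases i <;> simp [hS]; ring
    rw [h2, h1]
    simp
  rw [hR, lintegral_cylindrical (by fun_prop) (by
      intro y hy
      rw [ENNReal.ofReal_of_nonpos (div_nonpos_of_nonpos_of_nonneg hy (norm_nonneg _))]; simp),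
    lintegral_cylindrical (by fun_prop) (by
      intro y hy
      rw [ENNReal.ofReal_of_nonpos (div_nonpos_of_nonpos_of_nonneg hy (norm_nonneg _))]; simp)]
  have hvec : Measurable fun p : ℝ × ℝ × ℝ =>
      (!₂[p.1, p.2.1 * Real.cos p.2.2, p.2.1 * Real.sin p.2.2] : E3) := by
    refine (PiLp.volume_preserving_toLp (Fin 3)).measurable.comp
      (measurable_pi_lambda _ fun i => ?_)
    fin_cases i
    · exact measurable_fst
    · simp; fun_prop
    · simp; fun_prop
  rw [lintegral_lintegral_swap]
  swap
  · apply Measurable.aemeasurable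
    have hbody : Measurable fun p : (ℝ × ℝ) × ℝ =>
        ENNReal.ofReal p.1.2 * (χ (‖(!₂[p.1.1, p.1.2 * Real.cos p.2,
          p.1.2 * Real.sin p.2] : E3)‖ ^ 2)
        * (ENNReal.ofReal ((!₂[p.1.1, p.1.2 * Real.cos p.2, p.1.2 * Real.sin p.2] : E3) 0
            / ‖(!₂[p.1.1, p.1.2 * Real.cos p.2, p.1.2 * Real.sin p.2] : E3)‖)
        * G (((!₂[p.1.1, p.1.2 * Real.cos p.2, p.1.2 * Real.sin p.2] : E3) 0
            / ‖(!₂[p.1.1, p.1.2 * Real.cos p.2, p.1.2 * Real.sin p.2] : E3)‖ ^ 2)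
            • !₂[p.1.1, p.1.2 * Real.cos p.2, p.1.2 * Real.sin p.2]))) := by
      have hv' : Measurable fun p : (ℝ × ℝ) × ℝ =>
          (!₂[p.1.1, p.1.2 * Real.cos p.2, p.1.2 * Real.sin p.2] : E3) :=
        hvec.comp (f := fun p : (ℝ × ℝ) × ℝ => (p.1.1, p.1.2, p.2)) (by fun_prop)
      have hbase : Measurable fun y : E3 => χ (‖y‖ ^ 2) * (ENNReal.ofReal (y 0 / ‖y‖)
        * G ((y 0 / ‖y‖ ^ 2) • y)) := by fun_prop
      exact (by fun_prop : Measurable fun p : (ℝ × ℝ) × ℝ => ENNReal.ofReal p.1.2).mul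
        (hbase.comp hv')
    exact hbody.lintegral_prod_right'
  refine setLIntegral_congr_fun measurableSet_Ioi fun a ha => ?_
  refine setLIntegral_congr_fun measurableSet_Ioi fun ρ hρ => ?_
  refine setLIntegral_congr_fun measurableSet_Ioo fun φ _ => ?_
  have ha' : 0 < a := ha
  have hρ' : 0 < ρ := hρ
  have hn1 : ‖(!₂[a, ρ * Real.cos φ, ρ * Real.sin φ] : E3)‖ ^ 2 = a ^ 2 + ρ ^ 2 := by
    rw [norm_sq_three]; linear_combination ρ ^ 2 * Real.sin_sq_add_cos_sq φ
  have hn2 : ‖(!₂[ρ, a * Real.cos φ, a * Real.sin φ] : E3)‖ ^ 2 = a ^ 2 + ρ ^ 2 := by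
    rw [norm_sq_three]; linear_combination a ^ 2 * Real.sin_sq_add_cos_sq φ
  have hn3 : ‖(!₂[ρ, a * Real.cos φ, a * Real.sin φ] : E3)‖
      = ‖(!₂[a, ρ * Real.cos φ, ρ * Real.sin φ] : E3)‖ := by
    rw [← sq_eq_sq₀ (norm_nonneg _) (norm_nonneg _), hn1, hn2]
  have hpos : a ^ 2 + ρ ^ 2 ≠ 0 := by positivity
  simp only [hn1, hn3]
  have hvec2 : ((ρ / (a ^ 2 + ρ ^ 2)) • !₂[ρ, a * Real.cos φ, a * Real.sin φ] : E3)
      = !₂[1, 0, 0] - (a / (a ^ 2 + ρ ^ 2)) • S !₂[a, ρ * Real.cos φ, ρ * Real.sin φ] := by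
    ext i
    fin_cases i
    · simp [hS]; field_simp; ring
    · simp [hS]; field_simp
    · simp [hS]; field_simp
  have h0 : (![ρ, a * Real.cos φ, a * Real.sin φ] : Fin 3 → ℝ) 0 = ρ := rfl
  have h0' : (![a, ρ * Real.cos φ, ρ * Real.sin φ] : Fin 3 → ℝ) 0 = a := rfl
  rw [h0, h0', hvec2, mul_left_comm, mul_left_comm (ENNReal.ofReal ρ)]
  congr 1
  rw [← mul_assoc, ← mul_assoc, ← ENNReal.ofReal_mul ha'.le, ← ENNReal.ofReal_mul hρ'.le]
  congr 2
  ring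

/-- A homogeneous function on the unit ball integrates to a multiple of its spherical integral. -/
theorem exists_ball_eq_mul_sphere :
    ∃ c : ℝ≥0∞, c ≠ 0 ∧ c ≠ ∞ ∧ ∀ F : E3 → ℝ≥0∞, Measurable F →
      (∀ x : E3, ∀ r : ℝ, 0 < r → F (r • x) = F x) →
      ∫⁻ x in Metric.ball (0 : E3) 1, F x
        = (∫⁻ α : Metric.sphere (0 : E3) 1, F α ∂(volume : Measure E3).toSphere) * c := by
  set c : ℝ≥0∞ := ∫⁻ r in Ioi (0 : ℝ), ENNReal.ofReal (r ^ 2) * (Iio (1 : ℝ)).indicator 1 r with hc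
  have hformula : ∀ F : E3 → ℝ≥0∞, Measurable F →
      (∀ x : E3, ∀ r : ℝ, 0 < r → F (r • x) = F x) →
      ∫⁻ x in Metric.ball (0 : E3) 1, F x
        = (∫⁻ α : Metric.sphere (0 : E3) 1, F α ∂(volume : Measure E3).toSphere) * c := by
    intro F hF hhom
    rw [← lintegral_indicator measurableSet_ball, lintegral_polar (hF.indicator measurableSet_ball),
      ← lintegral_mul_const _ (by fun_prop)]
    refine lintegral_congr fun α => ?_
    rw [hc, ← lintegral_const_mul _ (by
      exact (by fun_prop : Measurable fun r : ℝ => ENNReal.ofReal (r ^ 2)).mul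
        (measurable_one.indicator measurableSet_Iio))]
    refine setLIntegral_congr_fun measurableSet_Ioi fun r hr => ?_
    have hr' : 0 < r := hr
    have hα : ‖(α : E3)‖ = 1 := by simp
    by_cases h1 : r < 1
    · have : r • (α : E3) ∈ Metric.ball (0 : E3) 1 := by
        rw [mem_ball_zero_iff, norm_smul, hα, Real.norm_eq_abs, abs_of_pos hr']; simpa using h1
      simp [this, h1, hhom _ _ hr', mul_comm]
    · have : r • (α : E3) ∉ Metric.ball (0 : E3) 1 := by
        rw [mem_ball_zero_iff, norm_smul, hα, Real.norm_eq_abs, abs_of_pos hr']; simpa using h1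
      simp [this, h1]
  have h1 := hformula (fun _ => 1) measurable_const (fun _ _ _ => rfl)
  simp only [lintegral_const, Measure.restrict_apply_univ, one_mul] at h1
  refine ⟨c, ?_, ?_, hformula⟩
  · intro h0
    rw [h0, mul_zero] at h1
    exact (Metric.measure_ball_pos volume (0 : E3) one_pos).ne' h1
  · intro htop
    rw [htop, ENNReal.mul_top (by simp [Real.pi_pos])] at h1
    exact measure_ball_lt_top.ne h1

/-- Exchanging the two legs of the right triangle with hypotenuse `V` preserves the measure
`(V · α)₊ dα` on the sphere. -/
theorem lintegral_sphere_swap (V : E3) {G : E3 → ℝ≥0∞} (hG : Measurable G) :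
    ∫⁻ α : Metric.sphere (0 : E3) 1, ENNReal.ofReal (inner ℝ V (α : E3))
        * G ((inner ℝ V (α : E3)) • (α : E3)) ∂(volume : Measure E3).toSphere
      = ∫⁻ α : Metric.sphere (0 : E3) 1, ENNReal.ofReal (inner ℝ V (α : E3))
        * G (V - (inner ℝ V (α : E3)) • (α : E3)) ∂(volume : Measure E3).toSphere := by
  rcases eq_or_ne V 0 with rfl | hV
  · simp
  -- Both integrands extend to functions homogeneous of degree zero. The identity on the sphere is
  -- thus equivalent to one on the unit ball, where a rotation takes the first basis vector to the
  -- direction of `V`.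
  obtain ⟨c, hc0, hct, hc⟩ := exists_ball_eq_mul_sphere
  have hn : 0 < ‖V‖ := norm_pos_iff.2 hV
  obtain ⟨R, hR⟩ := exists_isometry_map_first (e := (‖V‖⁻¹ : ℝ) • V)
    (by rw [norm_smul, norm_inv, norm_norm, inv_mul_cancel₀ hn.ne'])
  have hVR : V = ‖V‖ • R !₂[1, 0, 0] := by rw [hR, smul_smul, mul_inv_cancel₀ hn.ne', one_smul]
  have hinner : ∀ y : E3, inner ℝ V (R y) = ‖V‖ * y 0 := by
    intro y
    conv_lhs => rw [hVR]
    rw [real_inner_smul_left, R.inner_map_map, real_inner_comm, inner_first]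
  set G' : E3 → ℝ≥0∞ := fun p => G (‖V‖ • R p) with hG'
  have hG'm : Measurable G' := hG.comp ((R.continuous.measurable).const_smul ‖V‖)
  have hdegree : ∀ (x : E3) (r : ℝ), 0 < r →
      inner ℝ V (r • x) / ‖r • x‖ = inner ℝ V x / ‖x‖ ∧
      (inner ℝ V (r • x) / ‖r • x‖ ^ 2) • (r • x) = (inner ℝ V x / ‖x‖ ^ 2) • x := by
    intro x r hr
    rw [real_inner_smul_right, norm_smul, Real.norm_eq_abs, abs_of_pos hr, smul_smul]
    constructor
    · rw [mul_div_mul_left _ _ hr.ne']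
    · congr 1
      rcases eq_or_ne ‖x‖ 0 with hx | hx
      · simp [hx]
      · field_simp
  have hL := hc (fun x => ENNReal.ofReal (inner ℝ V x / ‖x‖)
    * G ((inner ℝ V x / ‖x‖ ^ 2) • x)) (by fun_prop) (by
      intro x r hr; simp only [(hdegree x r hr).1, (hdegree x r hr).2])
  have hRr := hc (fun x => ENNReal.ofReal (inner ℝ V x / ‖x‖)
    * G (V - (inner ℝ V x / ‖x‖ ^ 2) • x)) (by fun_prop) (by
      intro x r hr; simp only [(hdegree x r hr).1, (hdegree x r hr).2])
  have hsph : ∀ α : Metric.sphere (0 : E3) 1, ‖(α : E3)‖ = 1 := fun α => by simp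
  simp only [hsph, div_one, one_pow] at hL hRr
  have hrot : ∀ F : E3 → ℝ≥0∞, Measurable F →
      ∫⁻ x in Metric.ball (0 : E3) 1, F x = ∫⁻ y in Metric.ball (0 : E3) 1, F (R y) := by
    intro F hF
    have := R.measurePreserving.setLIntegral_comp_preimage
      (measurableSet_ball (x := (0 : E3)) (ε := 1)) hF
    rw [← this]
    congr 2
    ext y
    simp
  rw [hrot _ (by fun_prop)] at hL hRr
  have e1 : ∀ y : E3, ENNReal.ofReal (inner ℝ V (R y) / ‖R y‖)
        * G ((inner ℝ V (R y) / ‖R y‖ ^ 2) • R y)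
      = ENNReal.ofReal ‖V‖ * (ENNReal.ofReal (y 0 / ‖y‖) * G' ((y 0 / ‖y‖ ^ 2) • y)) := by
    intro y
    rw [hinner, R.norm_map, mul_div_assoc, mul_div_assoc, ENNReal.ofReal_mul hn.le, mul_assoc]
    simp only [hG', map_smul, smul_smul]
  have e2 : ∀ y : E3, ENNReal.ofReal (inner ℝ V (R y) / ‖R y‖)
        * G (V - (inner ℝ V (R y) / ‖R y‖ ^ 2) • R y)
      = ENNReal.ofReal ‖V‖ * (ENNReal.ofReal (y 0 / ‖y‖)
        * G' (!₂[1, 0, 0] - (y 0 / ‖y‖ ^ 2) • y)) := by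
    intro y
    rw [hinner, R.norm_map, mul_div_assoc, mul_div_assoc, ENNReal.ofReal_mul hn.le, mul_assoc]
    simp only [hG', map_smul, map_sub, smul_sub, smul_smul]
    rw [← hVR]
  simp only [e1, e2] at hL hRr
  rw [lintegral_const_mul' _ _ ENNReal.ofReal_ne_top] at hL hRr
  rw [lintegral_halfSpace_swap hG'm] at hL
  exact (ENNReal.mul_left_inj hc0 hct).1 (hL.symm.trans hRr)

end Swap

end KineticDomain

end

/-! ### The terms of `K` are dominated by one kernel -/

noncomputable section

namespace KineticDomain

open Filter Topology
open scoped ENNReal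

theorem norm_sub_inner_smul_sq {e : E3} (he : ‖e‖ = 1) (w : E3) :
    ‖w‖ ^ 2 = inner ℝ w e ^ 2 + ‖w - inner ℝ w e • e‖ ^ 2 := by
  rw [norm_sub_sq_real, norm_smul, he, real_inner_smul_right, Real.norm_eq_abs, mul_one, sq_abs]
  ring

/-- Integration over the planes orthogonal to `e`: the singularity `|y|⁻¹` is integrable there. -/
theorem exists_slice_bound {b : ℝ} (hb : 0 < b) :
    ∃ C : ℝ, 0 < C ∧ ∀ e : E3, ‖e‖ = 1 → ∀ u : E3, ∀ H : ℝ → ℝ≥0∞, Measurable H →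
      ∫⁻ y : E3, ENNReal.ofReal ((1 + ‖y‖⁻¹)
          * Real.exp (-b * ‖(y + u) - inner ℝ (y + u) e • e‖ ^ 2)) * H (inner ℝ y e)
        ≤ ENNReal.ofReal C * ∫⁻ a, H a := by
  -- The exponent `1 / 2` is the one of `inv_norm_three_le`: the integral over the plane is bounded
  -- by a product of two one-dimensional integrals.
  obtain ⟨C, hC, hbound⟩ := exists_integral_norm_rpow_mul_exp_le (volume : Measure ℝ)
    (q := 1 / 2) (by norm_num) (by simp; norm_num) hb
  refine ⟨C * C, by positivity, fun e he u H hH => ?_⟩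
  obtain ⟨R, hR⟩ := exists_isometry_map_first he
  set q : E3 := R.symm u with hq
  have hRq : R q = u := by simp [hq]
  set g : ℝ → ℝ → ℝ≥0∞ := fun s t =>
    ENNReal.ofReal ((1 + ‖t‖ ^ (-(1 / 2) : ℝ)) * Real.exp (-b * ‖t - s‖ ^ 2)) with hg
  have hgm : ∀ s, Measurable (g s) := fun s => by simp only [hg]; fun_prop
  rw [← R.measurePreserving.lintegral_comp (by fun_prop)]
  have hin : ∀ y : E3, inner ℝ (R y) e = y 0 := fun y => by
    rw [← hR, R.inner_map_map, inner_first]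
  rw [lintegral_euclidean_three]
  swap
  · have : Measurable fun y : E3 => R y := R.continuous.measurable
    fun_prop
  rw [← lintegral_const_mul _ hH]
  refine lintegral_mono fun a => ?_
  have hae : ∀ᵐ p : ℝ × ℝ, p.1 ≠ 0 ∧ p.2 ≠ 0 := by
    have h0 : ∀ᵐ t : ℝ, t ≠ 0 := Measure.ae_ne volume 0
    exact (Measure.quasiMeasurePreserving_fst.ae h0).and (Measure.quasiMeasurePreserving_snd.ae h0)
  calc ∫⁻ p : ℝ × ℝ, ENNReal.ofReal ((1 + ‖R !₂[a, p.1, p.2]‖⁻¹)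
          * Real.exp (-b * ‖(R !₂[a, p.1, p.2] + u)
            - inner ℝ (R !₂[a, p.1, p.2] + u) e • e‖ ^ 2)) * H (inner ℝ (R !₂[a, p.1, p.2]) e)
      ≤ ∫⁻ p : ℝ × ℝ, (g (-q 1) p.1 * g (-q 2) p.2) * H a := by
        refine lintegral_mono_ae ?_
        filter_upwards [hae] with p hp
        have h1 : inner ℝ (R !₂[a, p.1, p.2]) e = a := by rw [hin]; simp
        rw [h1]
        gcongr
        simp only [hg]
        rw [← ENNReal.ofReal_mul (by positivity)]
        apply ENNReal.ofReal_le_ofReal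
        have h2 : ‖(R !₂[a, p.1, p.2] + u) - inner ℝ (R !₂[a, p.1, p.2] + u) e • e‖ ^ 2
            = ‖p.1 - -q 1‖ ^ 2 + ‖p.2 - -q 2‖ ^ 2 := by
          have h3 : R !₂[a, p.1, p.2] + u = R (!₂[a, p.1, p.2] + q) := by rw [map_add, hRq]
          have h4 := norm_sub_inner_smul_sq he (R (!₂[a, p.1, p.2] + q))
          rw [h3]
          rw [hin, R.norm_map, EuclideanSpace.norm_sq_eq] at h4
          simp only [Fin.sum_univ_three, Real.norm_eq_abs, sq_abs] at h4
          rw [hin]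
          simp only [PiLp.add_apply] at h4 ⊢
          simp only [Real.norm_eq_abs, sq_abs, sub_neg_eq_add]
          simp at h4 ⊢
          linarith
        rw [h2, R.norm_map]
        have h5 : ‖(!₂[a, p.1, p.2] : E3)‖⁻¹
            ≤ |p.1| ^ (-(1 / 2) : ℝ) * |p.2| ^ (-(1 / 2) : ℝ) := by
          rcases inv_norm_three_le a p.1 p.2 with h | h | h
          · exact h
          · exact absurd h hp.1
          · exact absurd h hp.2
        rw [mul_add, Real.exp_add]
        have h6 : 1 + ‖(!₂[a, p.1, p.2] : E3)‖⁻¹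
            ≤ (1 + ‖p.1‖ ^ (-(1 / 2) : ℝ)) * (1 + ‖p.2‖ ^ (-(1 / 2) : ℝ)) := by
          simp only [Real.norm_eq_abs p.1, Real.norm_eq_abs p.2]
          have := Real.rpow_nonneg (abs_nonneg p.1) (-(1 / 2))
          have := Real.rpow_nonneg (abs_nonneg p.2) (-(1 / 2))
          nlinarith
        calc _ ≤ ((1 + ‖p.1‖ ^ (-(1 / 2) : ℝ)) * (1 + ‖p.2‖ ^ (-(1 / 2) : ℝ)))
              * (Real.exp (-b * ‖p.1 - -q 1‖ ^ 2) * Real.exp (-b * ‖p.2 - -q 2‖ ^ 2)) := by gcongr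
          _ = _ := by ring
    _ = ((∫⁻ t, g (-q 1) t) * ∫⁻ t, g (-q 2) t) * H a := by
        rw [lintegral_mul_const _ (by
            exact ((hgm _).comp measurable_fst).mul ((hgm _).comp measurable_snd)),
          Measure.volume_eq_prod,
          lintegral_prod_mul (hgm _).aemeasurable (hgm _).aemeasurable]
    _ ≤ ENNReal.ofReal (C * C) * H a := by
        rw [ENNReal.ofReal_mul hC.le]
        gcongr
        · exact hbound _
        · exact hbound _

/-- Majorant of the kernel of the gain operator. -/
def gradKernel (z : E3) : ℝ := ‖z‖⁻¹ * Real.exp (-(1 / 8) * ‖z‖ ^ 2)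

theorem gradKernel_nonneg (z : E3) : 0 ≤ gradKernel z := by unfold gradKernel; positivity

theorem measurable_gradKernel : Measurable gradKernel := by unfold gradKernel; fun_prop

end KineticDomain

namespace Boltzmann

open KineticDomain
open scoped ENNReal

/-- The measure `dv_* dα`. -/
abbrev collisionMeasure : Measure (E3 × S2) :=
  (volume : Measure E3).prod (volume : Measure E3).toSphere

theorem measurable_postV (v : E3) : Measurable (postV v) := by unfold postV; fun_prop

theorem measurable_postVStar (v : E3) : Measurable (postVStar v) := by unfold postVStar; fun_prop

/-- Majorant of the angular cross-section `B / sin θ` with respect to `dv_* dα`. -/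
def crossMajorant (v : E3) (p : E3 × S2) : ℝ :=
  (1 + ‖p.1 - v‖⁻¹) * inner ℝ (p.1 - v) (p.2 : E3)

/-- The Gaussian factor `e^{-(|a|² + |b|²)/2}`. -/
def gaussPair (a b : E3) : ℝ := Real.exp (-(‖a‖ ^ 2 + ‖b‖ ^ 2) / 2)

/-- For fixed `α`, with `v_* = v + y`, the argument `v' = v + a α` depends on `y` only through `a =
y · α`. The other two directions are integrated out over the plane orthogonal to `α`, where the
Gaussian compensates the factor `1 + ‖y‖⁻¹`. What remains, `a da dα`, is the polar form of `|w -
v|⁻¹ dw`. The Gaussian in `a` survives because `|v_*|² + |v'_*|² = 2 |y + v - (a/2) α|² + a²/2`. -/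
theorem exists_lintegral_postV_le :
    ∃ C : ℝ, 0 < C ∧ ∀ v : E3, ∀ F : E3 → ℝ≥0∞, Measurable F →
      ∫⁻ p, ENNReal.ofReal (crossMajorant v p * gaussPair p.1 (postVStar v p)) * F (postV v p)
          ∂collisionMeasure
        ≤ ENNReal.ofReal C * ∫⁻ w, ENNReal.ofReal (gradKernel (w - v)) * F w := by
  obtain ⟨C, hC, hslice⟩ := exists_slice_bound one_pos
  refine ⟨C, hC, fun v F hF => ?_⟩
  have hmeas : Measurable fun p : E3 × S2 =>
      ENNReal.ofReal (crossMajorant v p * gaussPair p.1 (postVStar v p)) * F (postV v p) := by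
    unfold crossMajorant gaussPair postV postVStar
    fun_prop
  rw [lintegral_prod_symm' _ hmeas]
  have hpolar : ∫⁻ w, ENNReal.ofReal (gradKernel (w - v)) * F w
      = ∫⁻ α : S2, ∫⁻ r in Ioi (0 : ℝ), ENNReal.ofReal (r ^ 2)
        * (ENNReal.ofReal (gradKernel (r • (α : E3))) * F (r • (α : E3) + v))
          ∂volume ∂(volume : Measure E3).toSphere := by
    rw [← lintegral_add_right_eq_self _ v]
    simp only [add_sub_cancel_right]
    exact lintegral_polar (F := fun w => ENNReal.ofReal (gradKernel w) * F (w + v))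
      (by have := measurable_gradKernel; fun_prop)
  rw [hpolar, ← lintegral_const_mul' _ _ ENNReal.ofReal_ne_top]
  refine lintegral_mono fun α => ?_
  have hα : ‖(α : E3)‖ = 1 := by simp
  set H : ℝ → ℝ≥0∞ := fun a => ENNReal.ofReal (a * Real.exp (-(1 / 4) * a ^ 2))
    * F (a • (α : E3) + v) with hH
  have hHm : Measurable H := by simp only [hH]; fun_prop
  calc ∫⁻ x : E3, ENNReal.ofReal (crossMajorant v (x, α) * gaussPair x (postVStar v (x, α)))
          * F (postV v (x, α))
      = ∫⁻ y : E3, ENNReal.ofReal (crossMajorant v (y + v, α)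
          * gaussPair (y + v) (postVStar v (y + v, α))) * F (postV v (y + v, α)) :=
        (lintegral_add_right_eq_self _ v).symm
    _ ≤ ∫⁻ y : E3, ENNReal.ofReal ((1 + ‖y‖⁻¹)
          * Real.exp (-1 * ‖(y + v) - inner ℝ (y + v) (α : E3) • (α : E3)‖ ^ 2))
            * H (inner ℝ y (α : E3)) := by
        refine lintegral_mono fun y => ?_
        simp only [crossMajorant, gaussPair, postV, postVStar, hH, add_sub_cancel_right]
        set a : ℝ := inner ℝ y (α : E3) with ha
        rw [← mul_assoc, add_comm v (a • (α : E3))]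
        gcongr
        rw [← ENNReal.ofReal_mul (by positivity)]
        rcases le_total a 0 with h0 | h0
        · rw [ENNReal.ofReal_of_nonpos]
          · exact zero_le
          · have : 0 ≤ 1 + ‖y‖⁻¹ := by positivity
            exact mul_nonpos_of_nonpos_of_nonneg (mul_nonpos_of_nonneg_of_nonpos this h0)
              (Real.exp_pos _).le
        apply ENNReal.ofReal_le_ofReal
        have h1 : ‖y + v‖ ^ 2 + ‖y + v - a • (α : E3)‖ ^ 2
            = 2 * ‖y + v - (a / 2) • (α : E3)‖ ^ 2 + a ^ 2 / 2 := by
          simp only [norm_sub_sq_real, norm_smul, real_inner_smul_right, hα, Real.norm_eq_abs,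
            mul_one, sq_abs]
          ring
        have h2 : ‖y + v - inner ℝ (y + v) (α : E3) • (α : E3)‖ ^ 2
            ≤ ‖y + v - (a / 2) • (α : E3)‖ ^ 2 := by
          have := norm_sub_inner_smul_sq hα (y + v - (a / 2) • (α : E3))
          rw [inner_sub_left, real_inner_smul_left, real_inner_self_eq_norm_sq, hα, sub_sub,
            ← add_smul] at this
          simp only [one_pow, mul_one, add_sub_cancel] at this
          nlinarith [sq_nonneg (inner ℝ (y + v) (α : E3) - a / 2)]
        have h3 : Real.exp (-(‖y + v‖ ^ 2 + ‖y + v - a • (α : E3)‖ ^ 2) / 2)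
            ≤ Real.exp (-1 * ‖y + v - inner ℝ (y + v) (α : E3) • (α : E3)‖ ^ 2)
              * Real.exp (-(1 / 4) * a ^ 2) := by
          rw [← Real.exp_add, Real.exp_le_exp, h1]
          linarith
        calc (1 + ‖y‖⁻¹) * a * Real.exp (-(‖y + v‖ ^ 2 + ‖y + v - a • (α : E3)‖ ^ 2) / 2)
            ≤ (1 + ‖y‖⁻¹) * a
              * (Real.exp (-1 * ‖y + v - inner ℝ (y + v) (α : E3) • (α : E3)‖ ^ 2)
                * Real.exp (-(1 / 4) * a ^ 2)) := by gcongr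
          _ = _ := by ring
    _ ≤ ENNReal.ofReal C * ∫⁻ a, H a := hslice _ hα v H hHm
    _ ≤ ENNReal.ofReal C * ∫⁻ r in Ioi (0 : ℝ), ENNReal.ofReal (r ^ 2)
        * (ENNReal.ofReal (gradKernel (r • (α : E3))) * F (r • (α : E3) + v)) := by
        refine mul_le_mul_right ?_ _
        rw [← lintegral_indicator measurableSet_Ioi]
        refine lintegral_mono fun r => ?_
        by_cases hr : r ∈ Ioi (0 : ℝ)
        · have hr' : 0 < r := hr
          rw [indicator_of_mem hr, ← mul_assoc, ← ENNReal.ofReal_mul (by positivity)]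
          simp only [hH]
          refine mul_le_mul_left (ENNReal.ofReal_le_ofReal ?_) _
          have : gradKernel (r • (α : E3)) = r⁻¹ * Real.exp (-(1 / 8) * r ^ 2) := by
            simp [gradKernel, norm_smul, hα, abs_of_pos hr']
          rw [this, ← mul_assoc]
          have h7 : r ^ 2 * r⁻¹ = r := by field_simp
          rw [h7]
          gcongr
          nlinarith [sq_nonneg r]
        · have hr' : r ≤ 0 := not_lt.1 hr
          rw [indicator_of_notMem hr]
          simp only [hH]
          rw [ENNReal.ofReal_of_nonpos (mul_nonpos_of_nonpos_of_nonneg hr' (Real.exp_pos _).le),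
            zero_mul]

/-- With `V = v_* - v`, the differences `v' - v` and `v'_* - v` are the two legs of the right
triangle with hypotenuse `V`. For fixed `v_*`, `lintegral_sphere_swap` exchanges them, which reduces
this case to the term at `v'`. -/
theorem exists_lintegral_postVStar_le :
    ∃ C : ℝ, 0 < C ∧ ∀ v : E3, ∀ F : E3 → ℝ≥0∞, Measurable F →
      ∫⁻ p, ENNReal.ofReal (crossMajorant v p * gaussPair p.1 (postV v p)) * F (postVStar v p)
          ∂collisionMeasure
        ≤ ENNReal.ofReal C * ∫⁻ w, ENNReal.ofReal (gradKernel (w - v)) * F w := by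
  obtain ⟨C, hC, hle⟩ := exists_lintegral_postV_le
  refine ⟨C, hC, fun v F hF => (le_of_eq ?_).trans (hle v F hF)⟩
  have hm1 : Measurable fun p : E3 × S2 =>
      ENNReal.ofReal (crossMajorant v p * gaussPair p.1 (postV v p)) * F (postVStar v p) := by
    unfold crossMajorant gaussPair postV postVStar
    fun_prop
  have hm2 : Measurable fun p : E3 × S2 =>
      ENNReal.ofReal (crossMajorant v p * gaussPair p.1 (postVStar v p)) * F (postV v p) := by
    unfold crossMajorant gaussPair postV postVStar
    fun_prop
  rw [lintegral_prod _ hm1.aemeasurable, lintegral_prod _ hm2.aemeasurable]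
  refine lintegral_congr fun x => ?_
  set V := x - v with hV
  set G : E3 → ℝ≥0∞ := fun y => ENNReal.ofReal ((1 + ‖V‖⁻¹) * gaussPair x (x - y)) * F (v + y)
    with hG
  have hGm : Measurable G := by simp only [hG, gaussPair]; fun_prop
  have key := lintegral_sphere_swap V hGm
  have e1 : ∀ α : S2, ENNReal.ofReal (crossMajorant v (x, α) * gaussPair x (postVStar v (x, α)))
        * F (postV v (x, α))
      = ENNReal.ofReal (inner ℝ V (α : E3)) * G ((inner ℝ V (α : E3)) • (α : E3)) := by
    intro α
    simp only [hG, crossMajorant, postVStar, postV, ← hV]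
    rw [← mul_assoc, ← ENNReal.ofReal_mul' (by unfold gaussPair; positivity)]
    congr 2
    ring
  have e2 : ∀ α : S2, ENNReal.ofReal (crossMajorant v (x, α) * gaussPair x (postV v (x, α)))
        * F (postVStar v (x, α))
      = ENNReal.ofReal (inner ℝ V (α : E3)) * G (V - (inner ℝ V (α : E3)) • (α : E3)) := by
    intro α
    simp only [hG, crossMajorant, postVStar, postV, ← hV]
    rw [← mul_assoc, ← ENNReal.ofReal_mul' (by unfold gaussPair; positivity)]
    have h1 : x - (V - inner ℝ V (α : E3) • (α : E3)) = v + inner ℝ V (α : E3) • (α : E3) := by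
      rw [hV]; abel
    have h2 : v + (V - inner ℝ V (α : E3) • (α : E3)) = x - inner ℝ V (α : E3) • (α : E3) := by
      rw [hV]; abel
    rw [h1, h2]
    congr 2
    ring
  simp only [e1, e2]
  exact key.symm

theorem exists_lintegral_loss_le :
    ∃ C : ℝ, 0 < C ∧ ∀ v : E3, ∀ F : E3 → ℝ≥0∞, Measurable F →
      ∫⁻ p, ENNReal.ofReal (crossMajorant v p * gaussPair p.1 v) * F p.1 ∂collisionMeasure
        ≤ ENNReal.ofReal C * ∫⁻ w, ENNReal.ofReal (gradKernel (w - v)) * F w := by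
  set σ : ℝ := (volume : Measure E3).toSphere.real univ with hσ
  have hσ' : (volume : Measure E3).toSphere univ = ENNReal.ofReal σ := by
    rw [hσ, ofReal_measureReal]
  have hσ0 : 0 ≤ σ := measureReal_nonneg
  refine ⟨16 * σ + 1, by positivity, fun v F hF => ?_⟩
  have hm : Measurable fun p : E3 × S2 =>
      ENNReal.ofReal (crossMajorant v p * gaussPair p.1 v) * F p.1 := by
    unfold crossMajorant gaussPair
    fun_prop
  rw [lintegral_prod _ hm.aemeasurable, ← lintegral_const_mul' _ _ ENNReal.ofReal_ne_top]
  refine lintegral_mono fun x => ?_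
  have hpt : ∀ α : S2, crossMajorant v (x, α) * gaussPair x v ≤ 16 * gradKernel (x - v) := by
    intro α
    rcases eq_or_ne (x - v) 0 with h0 | h0
    · simp [crossMajorant, gradKernel, h0]
    set r := ‖x - v‖ with hr
    have hr0 : 0 < r := norm_pos_iff.2 h0
    have h1 : inner ℝ (x - v) (α : E3) ≤ r := by
      have := real_inner_le_norm (x - v) (α : E3)
      simpa using this
    have h2 : gaussPair x v ≤ Real.exp (-(1 / 4) * r ^ 2) := by
      unfold gaussPair
      rw [Real.exp_le_exp]
      have := parallelogram_law_with_norm ℝ x v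
      nlinarith [sq_nonneg ‖x + v‖]
    have h3 : crossMajorant v (x, α) ≤ 1 + r := by
      simp only [crossMajorant, ← hr]
      calc (1 + r⁻¹) * inner ℝ (x - v) (α : E3) ≤ (1 + r⁻¹) * r := by gcongr
        _ = 1 + r := by field_simp; ring
    -- Half of the Gaussian `exp (-r² / 4)` pays for the polynomial growth and for putting the bound
    -- in the form `r⁻¹ exp (-r² / 8)`. The constant 16 is crude: `r + r² ≤ 16 + 2 r²`.
    have h4 : (1 + r) * r ≤ 16 * Real.exp (1 / 8 * r ^ 2) := by
      have := Real.add_one_le_exp (1 / 8 * r ^ 2)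
      nlinarith [sq_nonneg (r - 1)]
    calc crossMajorant v (x, α) * gaussPair x v
        ≤ (1 + r) * Real.exp (-(1 / 4) * r ^ 2) := by
          have : 0 ≤ gaussPair x v := (Real.exp_pos _).le
          exact mul_le_mul h3 h2 this (by positivity)
      _ = ((1 + r) * r) * (r⁻¹ * Real.exp (-(1 / 4) * r ^ 2)) := by field_simp
      _ ≤ (16 * Real.exp (1 / 8 * r ^ 2)) * (r⁻¹ * Real.exp (-(1 / 4) * r ^ 2)) := by gcongr
      _ = 16 * gradKernel (x - v) := by
          unfold gradKernel
          rw [← hr]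
          have : Real.exp (-(1 / 8) * r ^ 2)
              = Real.exp (1 / 8 * r ^ 2) * Real.exp (-(1 / 4) * r ^ 2) := by
            rw [← Real.exp_add]; ring_nf
          rw [this]; ring
  calc ∫⁻ α : S2, ENNReal.ofReal (crossMajorant v (x, α) * gaussPair x v) * F x
        ∂(volume : Measure E3).toSphere
      ≤ ∫⁻ _ : S2, ENNReal.ofReal (16 * gradKernel (x - v)) * F x
        ∂(volume : Measure E3).toSphere := by
        refine lintegral_mono fun α => ?_
        exact mul_le_mul_left (ENNReal.ofReal_le_ofReal (hpt α)) _
    _ = ENNReal.ofReal (16 * σ) * (ENNReal.ofReal (gradKernel (x - v)) * F x) := by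
        rw [lintegral_const, hσ', ENNReal.ofReal_mul (by norm_num),
          ENNReal.ofReal_mul (by norm_num)]
        ring
    _ ≤ _ := by gcongr; linarith

end Boltzmann

end

/-! ### Maxwellians, the cross-section and weighted push-forwards -/

noncomputable section

namespace Boltzmann

open KineticDomain Filter
open scoped ENNReal

theorem maxwellian_pos (v : E3) : 0 < maxwellian v := by
  unfold maxwellian; positivity

theorem sqrt_maxwellian_mul (a b : E3) :
    Real.sqrt (maxwellian a) * Real.sqrt (maxwellian b)
      = Real.pi ^ (-(3 / 2) : ℝ) * gaussPair a b := by
  rw [← Real.sqrt_mul (maxwellian_pos a).le]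
  have h : maxwellian a * maxwellian b = (Real.pi ^ (-(3 / 2) : ℝ) * gaussPair a b) ^ 2 := by
    unfold maxwellian gaussPair
    rw [mul_pow, ← Real.exp_nat_mul]
    have : Real.exp (((2 : ℕ) : ℝ) * (-(‖a‖ ^ 2 + ‖b‖ ^ 2) / 2))
        = Real.exp (-‖a‖ ^ 2) * Real.exp (-‖b‖ ^ 2) := by
      rw [← Real.exp_add]; push_cast; ring_nf
    rw [this]; ring
  rw [h, Real.sqrt_sq]
  unfold gaussPair; positivity

theorem pi_rpow_le_one : Real.pi ^ (-(3 / 2) : ℝ) ≤ 1 :=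
  Real.rpow_le_one_of_one_le_of_nonpos (by linarith [Real.pi_gt_three]) (by norm_num)

/-- This is conservation of energy, `|v'|² + |v'_*|² = |v|² + |v_*|²`. -/
theorem gaussPair_post (v : E3) (p : E3 × S2) :
    gaussPair (postV v p) (postVStar v p) = gaussPair v p.1 := by
  unfold gaussPair
  congr 2
  have hα : ‖(p.2 : E3)‖ = 1 := by simp
  simp only [postV, postVStar, norm_sub_sq_real, norm_add_sq_real, norm_smul,
    real_inner_smul_right, hα, Real.norm_eq_abs, mul_one, sq_abs, inner_sub_left]
  ring

theorem measurable_maxwellian : Measurable maxwellian := by unfold maxwellian; fun_prop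

/-- The cross-section `B / sin θ`, extended by zero outside the hemisphere. -/
def crossWeight (B : ℝ → ℝ → ℝ) (v : E3) (p : E3 × S2) : ℝ :=
  {p : E3 × S2 | 0 < inner ℝ (p.1 - v) (p.2 : E3)}.indicator
    (fun p => B ‖v - p.1‖ (InnerProductGeometry.angle (p.1 - v) (p.2 : E3))
      / Real.sin (InnerProductGeometry.angle (p.1 - v) (p.2 : E3))) p

theorem measurable_crossWeight {B : ℝ → ℝ → ℝ} (hB : Measurable (Function.uncurry B)) :
    Measurable fun q : E3 × (E3 × S2) => crossWeight B q.1 q.2 := by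
  have hang : Measurable fun q : E3 × (E3 × S2) =>
      InnerProductGeometry.angle (q.2.1 - q.1) (q.2.2 : E3) := by
    unfold InnerProductGeometry.angle
    exact Real.continuous_arccos.measurable.comp (by fun_prop)
  have hset : MeasurableSet {q : E3 × (E3 × S2) | 0 < inner ℝ (q.2.1 - q.1) (q.2.2 : E3)} :=
    measurableSet_lt measurable_const (by fun_prop)
  have hbody : Measurable fun q : E3 × (E3 × S2) =>
      B ‖q.1 - q.2.1‖ (InnerProductGeometry.angle (q.2.1 - q.1) (q.2.2 : E3))
      / Real.sin (InnerProductGeometry.angle (q.2.1 - q.1) (q.2.2 : E3)) := by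
    refine Measurable.div ?_ (Real.measurable_sin.comp hang)
    exact hB.comp ((by fun_prop : Measurable fun q : E3 × (E3 × S2) => ‖q.1 - q.2.1‖).prodMk hang)
  exact hbody.indicator hset

theorem collisionIntegral_eq (B : ℝ → ℝ → ℝ) (v : E3) (g : E3 × S2 → ℝ) :
    collisionIntegral B v g = ∫ p, g p * crossWeight B v p ∂collisionMeasure := by
  unfold collisionIntegral
  have hset : MeasurableSet {p : E3 × S2 | 0 < inner ℝ (p.1 - v) (p.2 : E3)} :=
    measurableSet_lt measurable_const (by fun_prop)
  rw [← integral_indicator hset]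
  congr 1
  ext p
  unfold crossWeight
  by_cases hp : p ∈ {p : E3 × S2 | 0 < inner ℝ (p.1 - v) (p.2 : E3)}
  · rw [indicator_of_mem hp, indicator_of_mem hp]
  · rw [indicator_of_notMem hp, indicator_of_notMem hp, mul_zero]

/-- Since `cos θ = V · α / |V|` and `|V|^γ ≤ 1 + |V|` for `0 ≤ γ ≤ 1`, the cutoff gives `B / sin θ ≤
C (1 + |V|⁻¹) V · α`. The alternative of vanishing is needed off the hemisphere, where the majorant
may be negative. -/
theorem AngularCutoff.crossWeight_bounds {γ : ℝ} (hγ0 : 0 ≤ γ) (hγ1 : γ ≤ 1) {B : ℝ → ℝ → ℝ}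
    (hB : AngularCutoff γ B) :
    ∃ C : ℝ, 0 < C ∧ ∀ v p, 0 ≤ crossWeight B v p ∧
      (crossWeight B v p = 0 ∨ crossWeight B v p ≤ C * crossMajorant v p) := by
  obtain ⟨-, C, hC, hbound⟩ := hB
  refine ⟨C, hC, fun v p => ?_⟩
  unfold crossWeight
  by_cases hp : p ∈ {p : E3 × S2 | 0 < inner ℝ (p.1 - v) (p.2 : E3)}
  swap
  · rw [indicator_of_notMem hp]; simp
  rw [indicator_of_mem hp]
  have hpos : 0 < inner ℝ (p.1 - v) (p.2 : E3) := hp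
  set V := p.1 - v with hV
  set θ := InnerProductGeometry.angle V (p.2 : E3) with hθ
  have hV0 : V ≠ 0 := by
    intro h; rw [h, inner_zero_left] at hpos; exact lt_irrefl _ hpos
  have hr : 0 < ‖V‖ := norm_pos_iff.2 hV0
  have hnorm : ‖v - p.1‖ = ‖V‖ := norm_sub_rev _ _
  have hθ2 : θ ≤ Real.pi / 2 := by
    rw [hθ, InnerProductGeometry.angle, Real.arccos_le_pi_div_two]
    positivity
  have hθ0 : 0 ≤ θ := InnerProductGeometry.angle_nonneg _ _
  have hsin : 0 ≤ Real.sin θ := InnerProductGeometry.sin_angle_nonneg _ _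
  have hcos : Real.cos θ = inner ℝ V (p.2 : E3) / ‖V‖ := by
    rw [hθ, InnerProductGeometry.cos_angle]; simp
  obtain ⟨h1, h2⟩ := hbound ‖V‖ θ hr hθ0 hθ2
  rw [hnorm]
  refine ⟨div_nonneg h1 hsin, Or.inr ?_⟩
  have hcos0 : 0 ≤ Real.cos θ := by rw [hcos]; positivity
  have hdiv : B ‖V‖ θ / Real.sin θ ≤ C * ‖V‖ ^ γ * Real.cos θ := by
    rcases hsin.eq_or_lt with h | h
    · rw [← h, div_zero]; positivity
    · rwa [div_le_iff₀ h]
  have hpow : ‖V‖ ^ γ ≤ 1 + ‖V‖ := by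
    rcases le_total ‖V‖ 1 with h | h
    · have := Real.rpow_le_one hr.le h hγ0; linarith
    · have := Real.rpow_le_rpow_of_exponent_le h hγ1
      rw [Real.rpow_one] at this; linarith
  calc B ‖V‖ θ / Real.sin θ ≤ C * ‖V‖ ^ γ * Real.cos θ := hdiv
    _ ≤ C * (1 + ‖V‖) * Real.cos θ := by gcongr
    _ = C * crossMajorant v p := by
        unfold crossMajorant; rw [hcos, ← hV]; field_simp; ring

section Channel

variable {P : Type*} [MeasurableSpace P] {μ : Measure P}

/-- A weighted push-forward dominated by an integrable density `κ` has a kernel bounded by `κ`. -/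
theorem exists_kernel_of_lintegral_le {w : P → E3} (hw : Measurable w) {c : P → ℝ}
    (hc : Measurable c) (hc0 : ∀ p, 0 ≤ c p) {κ : E3 → ℝ} (hκ : Measurable κ)
    (hκ0 : ∀ x, 0 ≤ κ x) (hκi : ∫⁻ x, ENNReal.ofReal (κ x) < ∞)
    (hle : ∀ F : E3 → ℝ≥0∞, Measurable F →
      ∫⁻ p, ENNReal.ofReal (c p) * F (w p) ∂μ ≤ ∫⁻ x, ENNReal.ofReal (κ x) * F x) :
    ∃ k : E3 → ℝ, Measurable k ∧ (∀ x, 0 ≤ k x ∧ k x ≤ κ x) ∧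
      ∀ φ : E3 → ℝ, Measurable φ → ∫⁻ x, ENNReal.ofReal (κ x) * ‖φ x‖ₑ < ∞ →
        Integrable (fun p => c p * φ (w p)) μ ∧ ∫ p, c p * φ (w p) ∂μ = ∫ x, k x * φ x := by
  -- The kernel is the Radon–Nikodym density of the push-forward of `c μ` under `w`. Testing the
  -- hypothesis on indicators shows that this density exists and is at most `κ` almost everywhere;
  -- the minimum with `κ` makes the bound hold at every point.
  set ν : Measure P := μ.withDensity fun p => ENNReal.ofReal (c p) with hν
  set Θ : Measure E3 := ν.map w with hΘ
  have hcm : Measurable fun p => ENNReal.ofReal (c p) := hc.ennreal_ofReal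
  have hκm : Measurable fun x => ENNReal.ofReal (κ x) := hκ.ennreal_ofReal
  have hlint : ∀ F : E3 → ℝ≥0∞, Measurable F →
      ∫⁻ x, F x ∂Θ = ∫⁻ p, ENNReal.ofReal (c p) * F (w p) ∂μ := by
    intro F hF
    rw [hΘ, lintegral_map hF hw, hν,
      lintegral_withDensity_eq_lintegral_mul _ hcm (g := fun p => F (w p))
      (hF.comp hw)]
    rfl
  have hset : ∀ s, MeasurableSet s → Θ s ≤ ∫⁻ x in s, ENNReal.ofReal (κ x) := by
    intro s hs
    rw [← lintegral_indicator_one hs, hlint _ (measurable_one.indicator hs)]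
    refine (hle _ (measurable_one.indicator hs)).trans (le_of_eq ?_)
    rw [← lintegral_indicator hs]
    refine lintegral_congr fun x => ?_
    by_cases hx : x ∈ s <;> simp [hx]
  have hfin : IsFiniteMeasure Θ := ⟨by
    refine (hset univ MeasurableSet.univ).trans_lt ?_
    rwa [Measure.restrict_univ]⟩
  have hac : Θ ≪ (volume : Measure E3) := by
    refine Measure.AbsolutelyContinuous.mk fun s hs h0 => ?_
    have := hset s hs
    rwa [setLIntegral_measure_zero _ _ h0, nonpos_iff_eq_zero] at this
  have hrn : ∀ᵐ x, Θ.rnDeriv volume x ≤ ENNReal.ofReal (κ x) := by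
    refine ae_le_of_forall_setLIntegral_le_of_sigmaFinite (Measure.measurable_rnDeriv _ _) ?_
    intro s hs _
    rw [Measure.setLIntegral_rnDeriv hac]
    exact hset s hs
  set k : E3 → ℝ := fun x => min (Θ.rnDeriv volume x).toReal (κ x) with hk
  have hkeq : ∀ᵐ x, k x = (Θ.rnDeriv volume x).toReal := by
    filter_upwards [hrn] with x hx
    rw [hk]
    exact min_eq_left (ENNReal.toReal_le_of_le_ofReal (hκ0 x) hx)
  refine ⟨k, (Measure.measurable_rnDeriv _ _).ennreal_toReal.min hκ,
    fun x => ⟨le_min ENNReal.toReal_nonneg (hκ0 x), min_le_right _ _⟩, fun φ hφ hφi => ?_⟩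
  have hint : Integrable (fun p => c p * φ (w p)) μ := by
    refine ⟨(hc.mul (hφ.comp hw)).aestronglyMeasurable, ?_⟩
    refine lt_of_le_of_lt ?_ hφi
    refine le_trans (le_of_eq ?_) (hle (fun x => ‖φ x‖ₑ) hφ.enorm)
    refine lintegral_congr fun p => ?_
    rw [enorm_mul, Real.enorm_of_nonneg (hc0 p)]
  refine ⟨hint, ?_⟩
  calc ∫ p, c p * φ (w p) ∂μ = ∫ p, φ (w p) ∂ν := by
        rw [hν, integral_withDensity_eq_integral_toReal_smul hcm (by simp)]
        simp [ENNReal.toReal_ofReal (hc0 _)]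
    _ = ∫ x, φ x ∂Θ := by
        rw [hΘ, integral_map hw.aemeasurable hφ.aestronglyMeasurable]
    _ = ∫ x, (Θ.rnDeriv volume x).toReal • φ x := (integral_rnDeriv_smul hac).symm
    _ = ∫ x, k x * φ x := by
        refine integral_congr_ae ?_
        filter_upwards [hkeq] with x hx
        rw [hx, smul_eq_mul]

/-- Testing the domination on the indicator of a measurable null set containing `N` gives zero. This
is what makes `L` insensitive to null sets of velocities, although it composes `f` with the
collision maps. -/
theorem ae_weight_eq_zero_or_notMem {w : P → E3} {c : P → ℝ}
    (hc : Measurable c) (hc0 : ∀ p, 0 ≤ c p) {κ : E3 → ℝ} (hw : Measurable w)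
    (hle : ∀ F : E3 → ℝ≥0∞, Measurable F →
      ∫⁻ p, ENNReal.ofReal (c p) * F (w p) ∂μ ≤ ∫⁻ x, ENNReal.ofReal (κ x) * F x)
    {N : Set E3} (hN : volume N = 0) : ∀ᵐ p ∂μ, c p = 0 ∨ w p ∉ N := by
  set T := toMeasurable volume N with hT
  have hTm : MeasurableSet T := measurableSet_toMeasurable _ _
  have hT0 : volume T = 0 := by rw [hT, measure_toMeasurable, hN]
  have h1 := hle (T.indicator 1) (measurable_one.indicator hTm)
  have h2 : ∫⁻ x, ENNReal.ofReal (κ x) * T.indicator 1 x = 0 := by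
    rw [lintegral_eq_zero_of_ae_eq_zero]
    have : ∀ᵐ x, x ∉ T := measure_eq_zero_iff_ae_notMem.1 hT0
    filter_upwards [this] with x hx
    simp [hx]
  have hm : Measurable fun p => ENNReal.ofReal (c p) * T.indicator (1 : E3 → ℝ≥0∞) (w p) :=
    hc.ennreal_ofReal.mul ((measurable_one.indicator hTm).comp hw)
  rw [h2, nonpos_iff_eq_zero, lintegral_eq_zero_iff hm] at h1
  filter_upwards [h1] with p hp
  by_cases hpT : w p ∈ T
  · left
    simp only [Pi.zero_apply, hpT, indicator_of_mem, Pi.one_apply, mul_one,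
      ENNReal.ofReal_eq_zero] at hp
    exact le_antisymm hp (hc0 p)
  · exact Or.inr fun h => hpT (subset_toMeasurable volume N h)

end Channel

theorem lintegral_gradKernel_lt_top (v : E3) :
    ∫⁻ x, ENNReal.ofReal (gradKernel (x - v)) < ∞ := by
  rw [lintegral_sub_right_eq_self (fun x => ENNReal.ofReal (gradKernel x)) v]
  have := integrable_norm_rpow_mul_exp (volume : Measure E3) (q := 1) (b := 1 / 8)
    (by simp) (by norm_num)
  have h2 := this.lintegral_lt_top
  simpa [gradKernel, Real.rpow_neg_one] using h2

/-- Weight of the term of `K` that evaluates at `v'_*`. -/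
def gainWeightStar (B : ℝ → ℝ → ℝ) (v : E3) (p : E3 × S2) : ℝ :=
  crossWeight B v p * (Real.sqrt (maxwellian p.1) * Real.sqrt (maxwellian (postV v p)))

/-- Weight of the term of `K` that evaluates at `v'`. -/
def gainWeight (B : ℝ → ℝ → ℝ) (v : E3) (p : E3 × S2) : ℝ :=
  crossWeight B v p * (Real.sqrt (maxwellian p.1) * Real.sqrt (maxwellian (postVStar v p)))

/-- Weight of the term of `K` that evaluates at `v_*`. -/
def lossWeight (B : ℝ → ℝ → ℝ) (v : E3) (p : E3 × S2) : ℝ :=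
  crossWeight B v p * (Real.sqrt (maxwellian p.1) * Real.sqrt (maxwellian v))

section Weights

variable {γ : ℝ} {B : ℝ → ℝ → ℝ}

theorem measurable_crossWeight_right (hB : AngularCutoff γ B) (v : E3) :
    Measurable (crossWeight B v) := by
  obtain ⟨hB1, -⟩ := hB
  have h := measurable_crossWeight hB1
  fun_prop

theorem measurable_gainWeightStar (hB : AngularCutoff γ B) (v : E3) :
    Measurable (gainWeightStar B v) := by
  have := measurable_crossWeight_right hB v
  have := measurable_postV v
  have := measurable_maxwellian
  unfold gainWeightStar; fun_prop

theorem measurable_gainWeight (hB : AngularCutoff γ B) (v : E3) :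
    Measurable (gainWeight B v) := by
  have := measurable_crossWeight_right hB v
  have := measurable_postVStar v
  have := measurable_maxwellian
  unfold gainWeight; fun_prop

theorem measurable_lossWeight (hB : AngularCutoff γ B) (v : E3) :
    Measurable (lossWeight B v) := by
  have := measurable_crossWeight_right hB v
  have := measurable_maxwellian
  unfold lossWeight; fun_prop

theorem ofReal_crossWeight_mul_le {C : ℝ} (hC : 0 < C) {v : E3} {p : E3 × S2}
    (h : 0 ≤ crossWeight B v p ∧
      (crossWeight B v p = 0 ∨ crossWeight B v p ≤ C * crossMajorant v p)) (a b : E3) :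
    ENNReal.ofReal (crossWeight B v p * (Real.sqrt (maxwellian a) * Real.sqrt (maxwellian b)))
      ≤ ENNReal.ofReal C * ENNReal.ofReal (crossMajorant v p * gaussPair a b) := by
  rw [← ENNReal.ofReal_mul hC.le, sqrt_maxwellian_mul]
  have hg : 0 < gaussPair a b := Real.exp_pos _
  rcases h.2 with h0 | h0
  · rw [h0, zero_mul, ENNReal.ofReal_zero]; exact zero_le
  · apply ENNReal.ofReal_le_ofReal
    have h1 : Real.pi ^ (-(3 / 2) : ℝ) * gaussPair a b ≤ gaussPair a b :=
      mul_le_of_le_one_left hg.le pi_rpow_le_one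
    calc _ ≤ crossWeight B v p * gaussPair a b := mul_le_mul_of_nonneg_left h1 h.1
      _ ≤ C * crossMajorant v p * gaussPair a b := mul_le_mul_of_nonneg_right h0 hg.le
      _ = _ := mul_assoc _ _ _

/-- All three terms of `K` are dominated by the kernel `gradKernel`. -/
theorem AngularCutoff.exists_lintegral_le (hγ0 : 0 ≤ γ) (hγ1 : γ ≤ 1) (hB : AngularCutoff γ B) :
    ∃ C : ℝ, 0 < C ∧ ∀ v : E3, ∀ F : E3 → ℝ≥0∞, Measurable F →
      (∫⁻ p, ENNReal.ofReal (gainWeightStar B v p) * F (postVStar v p) ∂collisionMeasure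
        ≤ ∫⁻ x, ENNReal.ofReal (C * gradKernel (x - v)) * F x) ∧
      (∫⁻ p, ENNReal.ofReal (gainWeight B v p) * F (postV v p) ∂collisionMeasure
        ≤ ∫⁻ x, ENNReal.ofReal (C * gradKernel (x - v)) * F x) ∧
      (∫⁻ p, ENNReal.ofReal (lossWeight B v p) * F p.1 ∂collisionMeasure
        ≤ ∫⁻ x, ENNReal.ofReal (C * gradKernel (x - v)) * F x) := by
  obtain ⟨C, hC, hcross⟩ := hB.crossWeight_bounds hγ0 hγ1
  obtain ⟨C1, hC1, h1⟩ := exists_lintegral_postVStar_le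
  obtain ⟨C2, hC2, h2⟩ := exists_lintegral_postV_le
  obtain ⟨C3, hC3, h3⟩ := exists_lintegral_loss_le
  refine ⟨C * (C1 + C2 + C3), by positivity, fun v F hF => ?_⟩
  have hend : ∀ D : ℝ, 0 < D → D ≤ C1 + C2 + C3 →
      ENNReal.ofReal C * (ENNReal.ofReal D * ∫⁻ w, ENNReal.ofReal (gradKernel (w - v)) * F w)
        ≤ ∫⁻ x, ENNReal.ofReal (C * (C1 + C2 + C3) * gradKernel (x - v)) * F x := by
    intro D hD hle
    rw [← mul_assoc, ← ENNReal.ofReal_mul hC.le, ← lintegral_const_mul' _ _ ENNReal.ofReal_ne_top]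
    refine lintegral_mono fun x => ?_
    rw [← mul_assoc, ← ENNReal.ofReal_mul (by positivity)]
    have := gradKernel_nonneg (x - v)
    gcongr
  refine ⟨?_, ?_, ?_⟩
  · refine le_trans ?_ (hend C1 hC1 (by linarith))
    refine le_trans ?_ (mul_le_mul_right (h1 v F hF) _)
    rw [← lintegral_const_mul' _ _ ENNReal.ofReal_ne_top]
    refine lintegral_mono fun p => ?_
    rw [← mul_assoc]
    exact mul_le_mul_left (ofReal_crossWeight_mul_le hC (hcross v p) _ _) _
  · refine le_trans ?_ (hend C2 hC2 (by linarith))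
    refine le_trans ?_ (mul_le_mul_right (h2 v F hF) _)
    rw [← lintegral_const_mul' _ _ ENNReal.ofReal_ne_top]
    refine lintegral_mono fun p => ?_
    rw [← mul_assoc]
    exact mul_le_mul_left (ofReal_crossWeight_mul_le hC (hcross v p) _ _) _
  · refine le_trans ?_ (hend C3 hC3 (by linarith))
    refine le_trans ?_ (mul_le_mul_right (h3 v F hF) _)
    rw [← lintegral_const_mul' _ _ ENNReal.ofReal_ne_top]
    refine lintegral_mono fun p => ?_
    rw [← mul_assoc]
    exact mul_le_mul_left (ofReal_crossWeight_mul_le hC (hcross v p) _ _) _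

end Weights

end Boltzmann

end

/-! ### `K` as an integral operator -/

noncomputable section

namespace Boltzmann

open KineticDomain Filter
open scoped ENNReal

section Kernel

variable {γ : ℝ} {B : ℝ → ℝ → ℝ}

theorem collisionFrequency_nonneg (hγ0 : 0 ≤ γ) (hγ1 : γ ≤ 1) (hB : AngularCutoff γ B) (v : E3) :
    0 ≤ collisionFrequency B v := by
  obtain ⟨C, -, hcross⟩ := hB.crossWeight_bounds hγ0 hγ1
  rw [collisionFrequency, collisionIntegral_eq]
  exact integral_nonneg fun p => mul_nonneg (maxwellian_pos _).le (hcross v p).1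

instance : SFinite collisionMeasure :=
  Measure.prod.instSFinite (μ := (volume : Measure E3)) (ν := (volume : Measure E3).toSphere)

theorem measurable_collisionIntegral {Y : Type*} [MeasurableSpace Y] (hB : AngularCutoff γ B)
    {v : Y → E3} (hv : Measurable v) {g : Y → E3 × S2 → ℝ} (hg : Measurable (Function.uncurry g)) :
    Measurable fun y => collisionIntegral B (v y) (g y) := by
  obtain ⟨hB1, -⟩ := hB
  have h := measurable_crossWeight hB1
  simp only [collisionIntegral_eq]
  have hm : Measurable fun q : Y × (E3 × S2) => g q.1 q.2 * crossWeight B (v q.1) q.2 := by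
    have hg' : Measurable fun q : Y × (E3 × S2) => g q.1 q.2 := hg
    have hc : Measurable fun q : Y × (E3 × S2) => crossWeight B (v q.1) q.2 := by fun_prop
    fun_prop
  exact hm.stronglyMeasurable.integral_prod_right'.measurable

theorem measurable_collisionFrequency (hB : AngularCutoff γ B) :
    Measurable (collisionFrequency B) := by
  have := measurable_maxwellian
  exact measurable_collisionIntegral (v := fun v : E3 => v) (g := fun _ p => maxwellian p.1) hB
    measurable_id (by fun_prop)

theorem measurable_collisionK (hB : AngularCutoff γ B) {f : E3 × E3 → ℝ} (hf : Measurable f) :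
    Measurable (collisionK B f) := by
  have hM := measurable_maxwellian
  have hν := measurable_collisionFrequency hB
  have hpv : Measurable fun q : (E3 × E3) × (E3 × S2) => postV q.1.2 q.2 := by
    unfold postV; fun_prop
  have hps : Measurable fun q : (E3 × E3) × (E3 × S2) => postVStar q.1.2 q.2 := by
    unfold postVStar; fun_prop
  have h1 : Measurable fun y : E3 × E3 =>
      collisionQ B maxwellian (fun w => Real.sqrt (maxwellian w) * f (y.1, w)) y.2 := by
    unfold collisionQ
    refine measurable_collisionIntegral hB measurable_snd ?_
    simp only [Function.uncurry_def]
    fun_prop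
  have h2 : Measurable fun y : E3 × E3 =>
      collisionQ B (fun w => Real.sqrt (maxwellian w) * f (y.1, w)) maxwellian y.2 := by
    unfold collisionQ
    refine measurable_collisionIntegral hB measurable_snd ?_
    simp only [Function.uncurry_def]
    fun_prop
  unfold collisionK linearizedL
  fun_prop

/-- By conservation of energy `M(v') M(v'_*) = M(v) M(v_*)`, so `√M(v)` factors out of both
collision integrands and cancels against the prefactor of `L`. What is left are the three weights
and the integrand of `ν`. -/
theorem gain_identity (v : E3) (p : E3 × S2) (a b c s : ℝ) :
    (maxwellian (postV v p) * (Real.sqrt (maxwellian (postVStar v p)) * a)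
        - maxwellian v * (Real.sqrt (maxwellian p.1) * b)) * s
      = Real.sqrt (maxwellian v) * (s * (Real.sqrt (maxwellian p.1)
          * Real.sqrt (maxwellian (postV v p))) * a
        - s * (Real.sqrt (maxwellian p.1) * Real.sqrt (maxwellian v)) * b) ∧
    (Real.sqrt (maxwellian (postV v p)) * a * maxwellian (postVStar v p)
        - Real.sqrt (maxwellian v) * c * maxwellian p.1) * s
      = Real.sqrt (maxwellian v) * (s * (Real.sqrt (maxwellian p.1)
          * Real.sqrt (maxwellian (postVStar v p))) * a - c * (maxwellian p.1 * s)) := by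
  have h1 : Real.sqrt (maxwellian (postV v p)) * Real.sqrt (maxwellian (postVStar v p))
      = Real.sqrt (maxwellian v) * Real.sqrt (maxwellian p.1) := by
    rw [sqrt_maxwellian_mul, sqrt_maxwellian_mul, gaussPair_post]
  have hsq : ∀ w, maxwellian w = Real.sqrt (maxwellian w) * Real.sqrt (maxwellian w) := fun w =>
    (Real.mul_self_sqrt (maxwellian_pos w).le).symm
  constructor
  · rw [hsq (postV v p), hsq v]
    rw [Real.sqrt_mul_self (Real.sqrt_nonneg _), Real.sqrt_mul_self (Real.sqrt_nonneg _)]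
    linear_combination (Real.sqrt (maxwellian (postV v p)) * a * s) * h1
  · rw [hsq (postVStar v p)]
    rw [Real.sqrt_mul_self (Real.sqrt_nonneg _)]
    linear_combination (Real.sqrt (maxwellian (postVStar v p)) * a * s) * h1

theorem weights_nonneg (hγ0 : 0 ≤ γ) (hγ1 : γ ≤ 1) (hB : AngularCutoff γ B) (v : E3)
    (p : E3 × S2) :
    0 ≤ gainWeightStar B v p ∧ 0 ≤ gainWeight B v p ∧ 0 ≤ lossWeight B v p := by
  obtain ⟨C, -, hcross⟩ := hB.crossWeight_bounds hγ0 hγ1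
  have := (hcross v p).1
  unfold gainWeightStar gainWeight lossWeight
  refine ⟨?_, ?_, ?_⟩ <;> positivity

/-- For each `v` the operator `K` is an integral operator with kernel bounded by `gradKernel`. -/
theorem AngularCutoff.exists_kernel (hγ0 : 0 ≤ γ) (hγ1 : γ ≤ 1) (hB : AngularCutoff γ B) :
    ∃ C : ℝ, 0 < C ∧ ∀ v : E3, ∃ k : E3 → ℝ, Measurable k ∧
      (∀ w, |k w| ≤ C * gradKernel (w - v)) ∧
      ∀ φ : E3 → ℝ, Measurable φ → ∫⁻ w, ENNReal.ofReal (gradKernel (w - v)) * ‖φ w‖ₑ < ∞ →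
        linearizedL B φ v + collisionFrequency B v * φ v = ∫ w, k w * φ w := by
  obtain ⟨C, hC, hle⟩ := hB.exists_lintegral_le hγ0 hγ1
  refine ⟨3 * C, by positivity, fun v => ?_⟩
  set κ : E3 → ℝ := fun x => C * gradKernel (x - v) with hκ
  have hκm : Measurable κ := by have := measurable_gradKernel; simp only [hκ]; fun_prop
  have hκ0 : ∀ x, 0 ≤ κ x := fun x => mul_nonneg hC.le (gradKernel_nonneg _)
  have hκF : ∀ F : E3 → ℝ≥0∞, ∫⁻ x, ENNReal.ofReal (κ x) * F x
      = ENNReal.ofReal C * ∫⁻ x, ENNReal.ofReal (gradKernel (x - v)) * F x := by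
    intro F
    rw [← lintegral_const_mul' _ _ ENNReal.ofReal_ne_top]
    simp only [hκ, ENNReal.ofReal_mul hC.le, mul_assoc]
  have hκi : ∫⁻ x, ENNReal.ofReal (κ x) < ∞ := by
    have := hκF 1
    simp only [Pi.one_apply, mul_one] at this
    rw [this]
    exact ENNReal.mul_lt_top ENNReal.ofReal_lt_top (lintegral_gradKernel_lt_top v)
  have hnn := weights_nonneg hγ0 hγ1 hB v
  obtain ⟨k1, hk1m, hk1, hk1i⟩ := exists_kernel_of_lintegral_le (measurable_postVStar v)
    (measurable_gainWeightStar hB v) (fun p => (hnn p).1) hκm hκ0 hκi (fun F hF => (hle v F hF).1)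
  obtain ⟨k2, hk2m, hk2, hk2i⟩ := exists_kernel_of_lintegral_le (measurable_postV v)
    (measurable_gainWeight hB v) (fun p => (hnn p).2.1) hκm hκ0 hκi
    (fun F hF => (hle v F hF).2.1)
  obtain ⟨k3, hk3m, hk3, hk3i⟩ := exists_kernel_of_lintegral_le measurable_fst
    (measurable_lossWeight hB v) (fun p => (hnn p).2.2) hκm hκ0 hκi
    (fun F hF => (hle v F hF).2.2)
  -- The kernels belong to the values at `v'_*`, at `v'` and at `v_*`, the last one with the sign of
  -- the loss term; each is at most `κ`.
  refine ⟨fun w => k1 w + k2 w - k3 w, (hk1m.add hk2m).sub hk3m, fun w => ?_, fun φ hφ hφi => ?_⟩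
  · have h1 := hk1 w
    have h2 := hk2 w
    have h3 := hk3 w
    simp only [hκ] at h1 h2 h3
    rw [abs_le]
    constructor <;> linarith
  have hfin : ∫⁻ x, ENNReal.ofReal (κ x) * ‖φ x‖ₑ < ∞ := by
    rw [hκF]; exact ENNReal.mul_lt_top ENNReal.ofReal_lt_top hφi
  obtain ⟨i1, e1⟩ := hk1i φ hφ hfin
  obtain ⟨i2, e2⟩ := hk2i φ hφ hfin
  obtain ⟨i3, e3⟩ := hk3i φ hφ hfin
  have hkφ : ∀ k : E3 → ℝ, Measurable k → (∀ x, 0 ≤ k x ∧ k x ≤ κ x) →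
      Integrable fun w => k w * φ w := by
    intro k hkm hk
    refine ⟨(hkm.mul hφ).aestronglyMeasurable, lt_of_le_of_lt (lintegral_mono fun x => ?_) hfin⟩
    rw [enorm_mul, Real.enorm_of_nonneg (hk x).1]
    exact mul_le_mul_left (ENNReal.ofReal_le_ofReal (hk x).2) _
  have hs : 0 < Real.sqrt (maxwellian v) := Real.sqrt_pos.2 (maxwellian_pos v)
  -- The integrand of `ν` is the loss integrand applied to `φ = √M`, divided by `√M(v)`. Its
  -- integrability is required to separate `ν φ` from the second collision integral.
  have iν : Integrable (fun p => maxwellian p.1 * crossWeight B v p) collisionMeasure := by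
    have hbd : ∫⁻ x, ENNReal.ofReal (κ x) * ‖Real.sqrt (maxwellian x)‖ₑ < ∞ := by
      refine lt_of_le_of_lt (lintegral_mono fun x => ?_) hκi
      refine mul_le_of_le_one_right' ?_
      rw [Real.enorm_of_nonneg (Real.sqrt_nonneg _), ← ENNReal.ofReal_one]
      apply ENNReal.ofReal_le_ofReal
      rw [Real.sqrt_le_one, maxwellian]
      have : Real.exp (-‖x‖ ^ 2) ≤ 1 := by rw [Real.exp_le_one_iff]; nlinarith [sq_nonneg ‖x‖]
      have h2 := pi_rpow_le_one
      have h3 : 0 < Real.pi ^ (-(3 / 2) : ℝ) := by positivity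
      nlinarith [Real.exp_pos (-‖x‖ ^ 2)]
    have hi := ((hk3i (fun x => Real.sqrt (maxwellian x))
      measurable_maxwellian.sqrt hbd).1).const_mul (Real.sqrt (maxwellian v))⁻¹
    refine hi.congr (Eventually.of_forall fun p => ?_)
    simp only [lossWeight]
    have := Real.mul_self_sqrt (maxwellian_pos p.1).le
    field_simp
    linear_combination (crossWeight B v p) * this
  have hQ1 : collisionQ B maxwellian (fun w => Real.sqrt (maxwellian w) * φ w) v
      = Real.sqrt (maxwellian v) * ((∫ w, k1 w * φ w) - ∫ w, k3 w * φ w) := by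
    rw [collisionQ, collisionIntegral_eq, ← e1, ← e3, ← integral_sub i1 i3, ← integral_const_mul]
    refine integral_congr_ae (Eventually.of_forall fun p => ?_)
    exact (gain_identity v p (φ (postVStar v p)) (φ p.1) 0 (crossWeight B v p)).1
  have hQ2 : collisionQ B (fun w => Real.sqrt (maxwellian w) * φ w) maxwellian v
      = Real.sqrt (maxwellian v) * ((∫ w, k2 w * φ w) - φ v * collisionFrequency B v) := by
    rw [collisionFrequency, collisionQ, collisionIntegral_eq, collisionIntegral_eq, ← e2,
      ← integral_const_mul, ← integral_sub i2 (iν.const_mul _), ← integral_const_mul]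
    refine integral_congr_ae (Eventually.of_forall fun p => ?_)
    exact (gain_identity v p (φ (postV v p)) 0 (φ v) (crossWeight B v p)).2
  rw [linearizedL, hQ1, hQ2]
  have hsum : ∫ w, (k1 w + k2 w - k3 w) * φ w
      = (∫ w, k1 w * φ w) + (∫ w, k2 w * φ w) - ∫ w, k3 w * φ w := by
    rw [← integral_add (hkφ k1 hk1m hk1) (hkφ k2 hk2m hk2),
      ← integral_sub (f := fun w => k1 w * φ w + k2 w * φ w)
        ((hkφ k1 hk1m hk1).add (hkφ k2 hk2m hk2)) (hkφ k3 hk3m hk3)]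
    congr 1
    ext w
    ring
  rw [hsum]
  field_simp
  ring

/-- The operator `L` does not see null sets of velocities, apart from `v` itself. -/
theorem linearizedL_congr_ae (hγ0 : 0 ≤ γ) (hγ1 : γ ≤ 1) (hB : AngularCutoff γ B)
    {φ ψ : E3 → ℝ} (h : φ =ᵐ[volume] ψ) {v : E3} (hv : φ v = ψ v) :
    linearizedL B φ v = linearizedL B ψ v := by
  obtain ⟨C, hC, hle⟩ := hB.exists_lintegral_le hγ0 hγ1
  have hnn := weights_nonneg hγ0 hγ1 hB v
  have hN : volume {w | ¬ φ w = ψ w} = 0 := h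
  have a1 := ae_weight_eq_zero_or_notMem (measurable_gainWeightStar hB v) (fun p => (hnn p).1)
    (measurable_postVStar v) (fun F hF => (hle v F hF).1) hN
  have a2 := ae_weight_eq_zero_or_notMem (measurable_gainWeight hB v) (fun p => (hnn p).2.1)
    (measurable_postV v) (fun F hF => (hle v F hF).2.1) hN
  have a3 := ae_weight_eq_zero_or_notMem (measurable_lossWeight hB v) (fun p => (hnn p).2.2)
    measurable_fst (fun F hF => (hle v F hF).2.2) hN
  have hpos : ∀ w, Real.sqrt (maxwellian w) ≠ 0 := fun w => (Real.sqrt_pos.2 (maxwellian_pos w)).ne'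
  have hmain : ∀ᵐ p ∂collisionMeasure, crossWeight B v p = 0 ∨
      (φ (postVStar v p) = ψ (postVStar v p) ∧ φ (postV v p) = ψ (postV v p) ∧ φ p.1 = ψ p.1) := by
    filter_upwards [a1, a2, a3] with p h1 h2 h3
    simp only [gainWeightStar, gainWeight, lossWeight, mul_eq_zero, hpos, or_false,
      not_not] at h1 h2 h3
    tauto
  have hQ1 : collisionQ B maxwellian (fun w => Real.sqrt (maxwellian w) * φ w) v
      = collisionQ B maxwellian (fun w => Real.sqrt (maxwellian w) * ψ w) v := by
    rw [collisionQ, collisionQ, collisionIntegral_eq, collisionIntegral_eq]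
    refine integral_congr_ae ?_
    filter_upwards [hmain] with p hp
    rcases hp with hp | ⟨h1, -, h3⟩
    · simp [hp]
    · simp only [h1, h3]
  have hQ2 : collisionQ B (fun w => Real.sqrt (maxwellian w) * φ w) maxwellian v
      = collisionQ B (fun w => Real.sqrt (maxwellian w) * ψ w) maxwellian v := by
    rw [collisionQ, collisionQ, collisionIntegral_eq, collisionIntegral_eq]
    refine integral_congr_ae ?_
    filter_upwards [hmain] with p hp
    rcases hp with hp | ⟨-, h2, -⟩
    · simp [hp]
    · simp only [h2, hv]
  rw [linearizedL, linearizedL, hQ1, hQ2]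

end Kernel

end Boltzmann

end

/-! ### Estimates in the velocity weight -/

noncomputable section

namespace KineticDomain

open Filter
open scoped ENNReal

/-- The velocity weight `1 + |v|^{-5/2}`. -/
def velocityWeight (v : E3) : ℝ≥0∞ := ENNReal.ofReal (1 + ‖v‖ ^ (-(5 / 2) : ℝ))

theorem measurable_velocityWeight : Measurable velocityWeight := by
  unfold velocityWeight; fun_prop

theorem one_le_velocityWeight (v : E3) : 1 ≤ velocityWeight v := by
  rw [velocityWeight, ← ENNReal.ofReal_one]
  refine ENNReal.ofReal_le_ofReal ?_
  have : 0 ≤ ‖v‖ ^ (-(5 / 2) : ℝ) := by positivity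
  linarith

/-- Powers of `‖v‖⁻¹` in terms of the half power. -/
theorem norm_half_power {t : ℝ} (ht : 0 < t) :
    ∃ a : ℝ, 0 < a ∧ t * a ^ 2 = 1 ∧ t ^ (-(5 / 2) : ℝ) = a ^ 5 := by
  refine ⟨t ^ (-(1 / 2) : ℝ), by positivity, ?_, ?_⟩
  · rw [← Real.rpow_natCast, ← Real.rpow_mul ht.le]
    nth_rewrite 1 [← Real.rpow_one t]
    rw [← Real.rpow_add ht]
    norm_num
  · rw [← Real.rpow_natCast, ← Real.rpow_mul ht.le]
    norm_num

theorem ofReal_inv_norm_sq_le_velocityWeight (v : E3) :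
    ENNReal.ofReal (‖v‖⁻¹ ^ 2) ≤ velocityWeight v := by
  refine ENNReal.ofReal_le_ofReal ?_
  rcases eq_or_ne v 0 with rfl | hv
  · simp
  obtain ⟨a, ha, h1, h2⟩ := norm_half_power (norm_pos_iff.2 hv)
  have : ‖v‖⁻¹ = a ^ 2 := by rw [inv_eq_iff_eq_inv]; exact eq_inv_of_mul_eq_one_left h1
  rw [h2, this]
  rcases le_total a 1 with h | h
  · have : (a ^ 2) ^ 2 ≤ 1 := by rw [← pow_mul]; exact pow_le_one₀ ha.le h
    have : 0 < a ^ 5 := by positivity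
    linarith
  · have : (a ^ 2) ^ 2 ≤ a ^ 5 := by rw [← pow_mul]; exact pow_le_pow_right₀ h (by norm_num)
    linarith

/-- Convolution with the Grad kernel, squared. -/
theorem exists_lintegral_gradKernel_mul_sq_le :
    ∃ C : ℝ≥0∞, C ≠ ∞ ∧ ∀ v : E3, ∀ φ : E3 → ℝ≥0∞, Measurable φ →
      (∫⁻ w, ENNReal.ofReal (gradKernel (w - v)) * φ w) ^ 2
        ≤ C * ∫⁻ w, ENNReal.ofReal (Real.exp (-(1 / 8) * ‖w - v‖ ^ 2)) * φ w ^ 2 := by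
  have hi := integrable_norm_rpow_mul_exp (volume : Measure E3) (q := 2) (b := 1 / 8)
    (by simp; norm_num) (by norm_num)
  refine ⟨∫⁻ x : E3, ENNReal.ofReal (‖x‖ ^ (-2 : ℝ) * Real.exp (-(1 / 8) * ‖x‖ ^ 2)),
    (Integrable.lintegral_lt_top hi).ne, fun v φ hφ => ?_⟩
  have hexp : ∀ x : E3, Real.exp (-(1 / 16) * ‖x‖ ^ 2) * Real.exp (-(1 / 16) * ‖x‖ ^ 2)
      = Real.exp (-(1 / 8) * ‖x‖ ^ 2) := by
    intro x; rw [← Real.exp_add]; congr 1; ring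
  -- The Gaussian is shared equally between the factors. The square of the singular factor is `‖x‖⁻²
  -- exp (-‖x‖² / 8)`, integrable in dimension three, and a Gaussian remains with `φ²`.
  have h := lintegral_mul_sq_le (volume : Measure E3)
    (f := fun w => ENNReal.ofReal (‖w - v‖⁻¹ * Real.exp (-(1 / 16) * ‖w - v‖ ^ 2)))
    (g := fun w => ENNReal.ofReal (Real.exp (-(1 / 16) * ‖w - v‖ ^ 2)) * φ w)
    (by fun_prop) (by fun_prop)
  refine le_trans (le_of_eq ?_) (h.trans (le_of_eq ?_))
  · congr 1
    refine lintegral_congr fun w => ?_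
    rw [← mul_assoc, ← ENNReal.ofReal_mul (by positivity), mul_assoc, hexp, gradKernel]
  · congr 1
    · rw [← lintegral_sub_right_eq_self (fun x : E3 =>
        ENNReal.ofReal (‖x‖ ^ (-2 : ℝ) * Real.exp (-(1 / 8) * ‖x‖ ^ 2))) v]
      refine lintegral_congr fun w => ?_
      rw [← ENNReal.ofReal_pow (by positivity), mul_pow, pow_two (Real.exp _), hexp]
      congr 2
      rw [Real.rpow_neg (norm_nonneg _), inv_pow]
      norm_num
    · refine lintegral_congr fun w => ?_
      rw [mul_pow, ← ENNReal.ofReal_pow (by positivity), pow_two (Real.exp _), hexp]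

/-- Convolution with the Grad kernel maps `L²` to the weighted space. -/
theorem exists_lintegral_velocityWeight_mul_le :
    ∃ C : ℝ≥0∞, C ≠ ∞ ∧ ∀ φ : E3 → ℝ≥0∞, Measurable φ →
      ∫⁻ v, velocityWeight v * (∫⁻ w, ENNReal.ofReal (gradKernel (w - v)) * φ w) ^ 2
        ≤ C * ∫⁻ w, φ w ^ 2 := by
  obtain ⟨C₁, hC₁, h₁⟩ := exists_lintegral_gradKernel_mul_sq_le
  -- By Tonelli only the weight integrated against a Gaussian centred at `w` matters; this is
  -- bounded uniformly in `w` because `5 / 2 < 3`.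
  obtain ⟨C₂, -, h₂⟩ := exists_integral_norm_rpow_mul_exp_le (volume : Measure E3) (q := 5 / 2)
    (b := 1 / 8) (by norm_num) (by simp; norm_num) (by norm_num)
  have hW := measurable_velocityWeight
  refine ⟨C₁ * ENNReal.ofReal C₂, ENNReal.mul_ne_top hC₁ ENNReal.ofReal_ne_top, fun φ hφ => ?_⟩
  calc ∫⁻ v, velocityWeight v * (∫⁻ w, ENNReal.ofReal (gradKernel (w - v)) * φ w) ^ 2
      ≤ ∫⁻ v, ∫⁻ w, C₁ * (velocityWeight v
          * ENNReal.ofReal (Real.exp (-(1 / 8) * ‖w - v‖ ^ 2)) * φ w ^ 2) := by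
        refine lintegral_mono fun v => ?_
        rw [lintegral_const_mul _ (by fun_prop)]
        calc velocityWeight v * (∫⁻ w, ENNReal.ofReal (gradKernel (w - v)) * φ w) ^ 2
            ≤ velocityWeight v * (C₁ *
              ∫⁻ w, ENNReal.ofReal (Real.exp (-(1 / 8) * ‖w - v‖ ^ 2)) * φ w ^ 2) := by
              gcongr; exact h₁ v φ hφ
          _ = C₁ * ∫⁻ w, velocityWeight v
                * ENNReal.ofReal (Real.exp (-(1 / 8) * ‖w - v‖ ^ 2)) * φ w ^ 2 := by
              simp only [mul_assoc]
              rw [lintegral_const_mul _ (by fun_prop)]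
              ring
    _ = ∫⁻ w, ∫⁻ v, C₁ * (velocityWeight v
          * ENNReal.ofReal (Real.exp (-(1 / 8) * ‖w - v‖ ^ 2)) * φ w ^ 2) :=
        lintegral_lintegral_swap (by fun_prop)
    _ ≤ ∫⁻ w, C₁ * ENNReal.ofReal C₂ * φ w ^ 2 := by
        refine lintegral_mono fun w => ?_
        rw [lintegral_const_mul _ (by fun_prop), lintegral_mul_const _ (by fun_prop), mul_assoc]
        gcongr
        refine le_trans (le_of_eq ?_) (h₂ w)
        refine lintegral_congr fun v => ?_
        rw [velocityWeight, ← ENNReal.ofReal_mul (by positivity), norm_sub_rev v w]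
    _ = _ := lintegral_const_mul _ (by fun_prop)

/-- Here `a`, `b`, `t` stand for `|v|^(-1/2)`, `|v - w|^(-1/2)`, `|w|^(-1/2)`, and the hypothesis is
the triangle inequality for square roots, `1 / t ≤ 1 / a + 1 / b`. The product `a⁴ b²` has degree
six, that is `|·|⁻³`, just not locally integrable; replacing `a b` by `t (a + b)` lowers the degree
to five, that is `|·|^(-5/2)`, at the price of a factor `t`. -/
theorem half_power_inequality {a b t : ℝ} (ha : 0 < a) (hb : 0 < b) (ht : 0 < t)
    (hab : a * b ≤ t * (a + b)) :
    (a ^ 4 + a ^ 2) * b ^ 2 ≤ 8 * (1 + t) * (1 + a ^ 5 + b ^ 5) := by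
  have hb2 : b ^ 2 ≤ 1 + b ^ 5 := by
    rcases le_total b 1 with h | h
    · have := pow_le_one₀ (n := 2) hb.le h
      have : 0 < b ^ 5 := by positivity
      linarith
    · have := pow_le_pow_right₀ h (by norm_num : 2 ≤ 5)
      linarith
  have h5 : 0 < a ^ 5 := by positivity
  have h6 : 0 < b ^ 5 := by positivity
  have h32 : a ^ 3 * b ^ 2 ≤ a ^ 5 + b ^ 5 := by
    rcases le_total a b with h | h
    · have : a ^ 3 * b ^ 2 ≤ b ^ 3 * b ^ 2 := by gcongr
      have e : b ^ 3 * b ^ 2 = b ^ 5 := by ring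
      linarith
    · have : a ^ 3 * b ^ 2 ≤ a ^ 3 * a ^ 2 := by gcongr
      have e : a ^ 3 * a ^ 2 = a ^ 5 := by ring
      linarith
  have h41 : a ^ 4 * b ≤ a ^ 5 + b ^ 5 := by
    rcases le_total a b with h | h
    · have : a ^ 4 * b ≤ b ^ 4 * b := by gcongr
      have e : b ^ 4 * b = b ^ 5 := by ring
      linarith
    · have : a ^ 4 * b ≤ a ^ 4 * a := by gcongr
      have e : a ^ 4 * a = a ^ 5 := by ring
      linarith
  have h42 : a ^ 4 * b ^ 2 ≤ t * (2 * (a ^ 5 + b ^ 5)) := by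
    calc a ^ 4 * b ^ 2 = (a ^ 3 * b) * (a * b) := by ring
      _ ≤ (a ^ 3 * b) * (t * (a + b)) := by gcongr
      _ = t * (a ^ 4 * b + a ^ 3 * b ^ 2) := by ring
      _ ≤ _ := by gcongr; linarith
  have h22 : a ^ 2 * b ^ 2 ≤ a ^ 4 * b ^ 2 + b ^ 2 := by
    have : a ^ 2 ≤ a ^ 4 + 1 := by nlinarith [sq_nonneg (a ^ 2 - 1)]
    calc a ^ 2 * b ^ 2 ≤ (a ^ 4 + 1) * b ^ 2 := by gcongr
      _ = _ := by ring
  have h7 := mul_pos ht h5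
  have h8 := mul_pos ht h6
  linarith

/-- The integral is bounded by a multiple of `1 + |w|^(-1/2)`, and multiplying by `|w|⁻²` gives at
most a multiple of `1 + |w|^(-5/2)`. This bound is where the exponent of the weight comes from. -/
theorem exists_lintegral_weighted_gradKernel_le :
    ∃ C : ℝ≥0∞, C ≠ ∞ ∧ ∀ w : E3, w ≠ 0 →
      ENNReal.ofReal (‖w‖⁻¹ ^ 2)
          * ∫⁻ v, ENNReal.ofReal (‖v‖⁻¹ ^ 2 * (1 + ‖v‖) * gradKernel (w - v))
        ≤ C * velocityWeight w := by
  obtain ⟨C₂, hC₂, h₂⟩ := exists_integral_norm_rpow_mul_exp_le (volume : Measure E3) (q := 5 / 2)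
    (b := 1 / 8) (by norm_num) (by simp; norm_num) (by norm_num)
  have hi := integrable_norm_rpow_mul_exp (volume : Measure E3) (q := 5 / 2) (b := 1 / 8)
    (by simp; norm_num) (by norm_num)
  set I := ∫⁻ x : E3, ENNReal.ofReal (‖x‖ ^ (-(5 / 2) : ℝ) * Real.exp (-(1 / 8) * ‖x‖ ^ 2)) with hI
  have hIfin : I ≠ ∞ := (Integrable.lintegral_lt_top hi).ne
  refine ⟨16 * (ENNReal.ofReal C₂ + I), ENNReal.mul_ne_top (by norm_num)
    (ENNReal.add_ne_top.2 ⟨ENNReal.ofReal_ne_top, hIfin⟩), fun w hw => ?_⟩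
  obtain ⟨t, ht, htw, ht5⟩ := norm_half_power (norm_pos_iff.2 hw)
  have hshift : ∫⁻ v : E3, ENNReal.ofReal (‖v - w‖ ^ (-(5 / 2) : ℝ)
      * Real.exp (-(1 / 8) * ‖v - w‖ ^ 2)) = I :=
    lintegral_sub_right_eq_self (fun x : E3 =>
      ENNReal.ofReal (‖x‖ ^ (-(5 / 2) : ℝ) * Real.exp (-(1 / 8) * ‖x‖ ^ 2))) w
  have hae : ∀ᵐ v : E3, v ≠ 0 ∧ v ≠ w := by
    have h0 : ∀ᵐ v : E3, v ≠ 0 := by simp [ae_iff]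
    have h1 : ∀ᵐ v : E3, v ≠ w := by simp [ae_iff]
    filter_upwards [h0, h1] with v a b using ⟨a, b⟩
  have hinv : ‖w‖⁻¹ = t ^ 2 := by rw [inv_eq_iff_eq_inv]; exact eq_inv_of_mul_eq_one_left htw
  have hWw : velocityWeight w = ENNReal.ofReal (1 + t ^ 5) := by rw [velocityWeight, ht5]
  have key : ∫⁻ v, ENNReal.ofReal (‖v‖⁻¹ ^ 2 * (1 + ‖v‖) * gradKernel (w - v))
      ≤ ENNReal.ofReal (8 * (1 + t)) * (ENNReal.ofReal C₂ + I) := by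
    calc ∫⁻ v, ENNReal.ofReal (‖v‖⁻¹ ^ 2 * (1 + ‖v‖) * gradKernel (w - v))
        ≤ ∫⁻ v, ENNReal.ofReal (8 * (1 + t)) *
            (ENNReal.ofReal ((1 + ‖v‖ ^ (-(5 / 2) : ℝ)) * Real.exp (-(1 / 8) * ‖v - w‖ ^ 2))
            + ENNReal.ofReal (‖v - w‖ ^ (-(5 / 2) : ℝ)
              * Real.exp (-(1 / 8) * ‖v - w‖ ^ 2))) := by
          refine lintegral_mono_ae ?_
          filter_upwards [hae] with v hv
          rw [← ENNReal.ofReal_add (by positivity) (by positivity),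
            ← ENNReal.ofReal_mul (by positivity)]
          refine ENNReal.ofReal_le_ofReal ?_
          obtain ⟨a, ha, hav, ha5⟩ := norm_half_power (norm_pos_iff.2 hv.1)
          obtain ⟨b, hb, hbv, hb5⟩ := norm_half_power (norm_pos_iff.2 (sub_ne_zero.2 hv.2))
          rw [gradKernel, norm_sub_rev w v, ha5, hb5]
          have htri : ‖w‖ ≤ ‖v‖ + ‖v - w‖ := by
            have := norm_sub_le v (v - w); simpa using this
          have hva : ‖v‖⁻¹ = a ^ 2 := by
            rw [inv_eq_iff_eq_inv]; exact eq_inv_of_mul_eq_one_left hav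
          have hvb : ‖v - w‖⁻¹ = b ^ 2 := by
            rw [inv_eq_iff_eq_inv]; exact eq_inv_of_mul_eq_one_left hbv
          have hva' : ‖v‖ = (a ^ 2)⁻¹ := by rw [← hva, inv_inv]
          have hvb' : ‖v - w‖ = (b ^ 2)⁻¹ := by rw [← hvb, inv_inv]
          have hw' : ‖w‖ = (t ^ 2)⁻¹ := by rw [← hinv, inv_inv]
          rw [hva, hvb]
          have hpoly : (a ^ 2) ^ 2 * (1 + ‖v‖) * b ^ 2 ≤ 8 * (1 + t) * (1 + a ^ 5 + b ^ 5) := by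
            rw [hva', hvb', hw'] at htri
            have hhalf : t⁻¹ ≤ a⁻¹ + b⁻¹ := by
              refine abs_le_of_sq_le_sq' ?_ (by positivity) |>.2
              have : 0 < a⁻¹ * b⁻¹ := by positivity
              have e : (t⁻¹) ^ 2 = (t ^ 2)⁻¹ := by rw [inv_pow]
              have e2 : (a⁻¹ + b⁻¹) ^ 2 = (a ^ 2)⁻¹ + (b ^ 2)⁻¹ + 2 * (a⁻¹ * b⁻¹) := by
                rw [← inv_pow, ← inv_pow]; ring
              rw [e, e2]; linarith
            have hab : a * b ≤ t * (a + b) := by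
              have h := mul_le_mul_of_nonneg_left hhalf (by positivity : 0 ≤ t * a * b)
              have e1 : t * a * b * t⁻¹ = a * b := by field_simp
              have e2 : t * a * b * (a⁻¹ + b⁻¹) = t * (a + b) := by field_simp; ring
              linarith
            have e3 : (a ^ 2) ^ 2 * (1 + ‖v‖) * b ^ 2 = (a ^ 4 + a ^ 2) * b ^ 2 := by
              rw [hva']; field_simp
            rw [e3]
            exact half_power_inequality ha hb ht hab
          have he := Real.exp_pos (-(1 / 8) * ‖v - w‖ ^ 2)
          calc (a ^ 2) ^ 2 * (1 + ‖v‖) * (b ^ 2 * Real.exp (-(1 / 8) * ‖v - w‖ ^ 2))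
              = (a ^ 2) ^ 2 * (1 + ‖v‖) * b ^ 2 * Real.exp (-(1 / 8) * ‖v - w‖ ^ 2) := by ring
            _ ≤ 8 * (1 + t) * (1 + a ^ 5 + b ^ 5) * Real.exp (-(1 / 8) * ‖v - w‖ ^ 2) := by
                gcongr
            _ = _ := by ring
      _ = ENNReal.ofReal (8 * (1 + t)) * ((∫⁻ v : E3, ENNReal.ofReal ((1 + ‖v‖ ^ (-(5 / 2) : ℝ))
              * Real.exp (-(1 / 8) * ‖v - w‖ ^ 2))) + I) := by
          rw [lintegral_const_mul _ (by fun_prop), lintegral_add_left (by fun_prop), hshift]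
      _ ≤ _ := by
          gcongr
          exact h₂ w
  calc _ ≤ ENNReal.ofReal ((t ^ 2) ^ 2)
        * (ENNReal.ofReal (8 * (1 + t)) * (ENNReal.ofReal C₂ + I)) := by
        rw [hinv]; gcongr
    _ = ENNReal.ofReal ((t ^ 2) ^ 2 * (8 * (1 + t))) * (ENNReal.ofReal C₂ + I) := by
        rw [ENNReal.ofReal_mul (p := (t ^ 2) ^ 2) (by positivity), mul_assoc]
    _ ≤ ENNReal.ofReal (16 * (1 + t ^ 5)) * (ENNReal.ofReal C₂ + I) := by
        refine mul_le_mul_left (ENNReal.ofReal_le_ofReal ?_) _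
        have : (t ^ 2) ^ 2 ≤ 1 + t ^ 5 := by
          rcases le_total t 1 with h | h
          · have : (t ^ 2) ^ 2 ≤ 1 := by rw [← pow_mul]; exact pow_le_one₀ ht.le h
            have : 0 < t ^ 5 := by positivity
            linarith
          · have : (t ^ 2) ^ 2 ≤ t ^ 5 := by rw [← pow_mul]; exact pow_le_pow_right₀ h (by norm_num)
            linarith
        nlinarith
    _ = _ := by
        rw [hWw, ENNReal.ofReal_mul (by norm_num)]
        norm_num
        ring

end KineticDomain

end

/-! ### Transport as a Fourier multiplier -/

noncomputable section

namespace KineticDomain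

open Filter Complex
open scoped ENNReal FourierTransform

variable {d a : ℝ}

theorem enorm_complex_ofReal (t : ℝ) : ‖(t : ℂ)‖ₑ = ‖t‖ₑ := by
  rw [← ofReal_norm, ← ofReal_norm, Complex.norm_real]

/-- The Fourier multiplier of `lineTransport`. -/
def transportSymbol (d a : ℝ) (v ξ : E3) : ℂ :=
  ∫ s in Ioc 0 (d / ‖v‖), cexp (-(a + (2 * Real.pi * inner ℝ v ξ : ℝ) * I) * s)

theorem norm_transportSymbol_le (hd : 0 ≤ d) (ha : 0 ≤ a) (v ξ : E3) :
    ‖transportSymbol d a v ξ‖ ≤ d / ‖v‖ := by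
  have h := norm_setIntegral_le_of_norm_le_const (μ := volume) (s := Ioc 0 (d / ‖v‖)) (C := 1)
    (f := fun s : ℝ => cexp (-(a + (2 * Real.pi * inner ℝ v ξ : ℝ) * I) * s)) (by simp) (by
      intro s hs
      rw [Complex.norm_exp, Real.exp_le_one_iff]
      simp
      exact mul_nonneg ha hs.1.le)
  refine h.trans (le_of_eq ?_)
  have : 0 ≤ d / ‖v‖ := by positivity
  simp [this]

/-- The explicit value is `(exp (c T) - 1) / c` with `Re c = -a ≤ 0`, so the numerator is at most 2,
while `|c| ≥ 2 |v · ξ|`. The bound is uniform in the attenuation and in the travel time. -/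
theorem abs_inner_mul_norm_transportSymbol_le (hd : 0 ≤ d) (ha : 0 ≤ a) (v ξ : E3) :
    |inner ℝ v ξ| * ‖transportSymbol d a v ξ‖ ≤ 1 := by
  rcases eq_or_ne (inner ℝ v ξ) 0 with h0 | h0
  · simp [h0]
  set c : ℂ := -(a + (2 * Real.pi * inner ℝ v ξ : ℝ) * I) with hc
  have him : c.im = -(2 * Real.pi * inner ℝ v ξ) := by simp [hc]
  have hre : c.re = -a := by simp [hc]
  have hc0 : c ≠ 0 := by
    intro h
    rw [h] at him
    simp at him
    exact h0 (by simpa using him)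
  have hT : 0 ≤ d / ‖v‖ := by positivity
  have hm : transportSymbol d a v ξ = (cexp (c * (d / ‖v‖ : ℝ)) - cexp (c * (0 : ℝ))) / c := by
    rw [transportSymbol, ← intervalIntegral.integral_of_le hT, integral_exp_mul_complex hc0]
  have hnum : ‖cexp (c * (d / ‖v‖ : ℝ)) - cexp (c * (0 : ℝ))‖ ≤ 2 := by
    refine (norm_sub_le _ _).trans ?_
    have h1 : ‖cexp (c * (d / ‖v‖ : ℝ))‖ ≤ 1 := by
      rw [Complex.norm_exp, Real.exp_le_one_iff, Complex.re_mul_ofReal, hre]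
      nlinarith
    have h2 : ‖cexp (c * (0 : ℝ))‖ ≤ 1 := by simp
    linarith
  have hcn : 2 * |inner ℝ v ξ| ≤ ‖c‖ := by
    refine le_trans ?_ (Complex.abs_im_le_norm c)
    rw [him, abs_neg, abs_mul, abs_of_pos (by positivity : (0 : ℝ) < 2 * Real.pi)]
    gcongr
    linarith [Real.pi_gt_three]
  have hcpos : 0 < ‖c‖ := norm_pos_iff.2 hc0
  rw [hm, norm_div, mul_div_assoc', div_le_one hcpos]
  nlinarith [abs_nonneg (inner ℝ v ξ)]

/-- The Fourier transform turns `lineTransport` into multiplication by `transportSymbol`. -/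
theorem fourier_lineTransport (ha : 0 ≤ a) (v : E3) {h : E3 → ℝ}
    (hh : Measurable h) (hi : Integrable h) (ξ : E3) :
    𝓕 (fun x => (lineTransport d a v h x : ℂ)) ξ
      = transportSymbol d a v ξ * 𝓕 (fun x => (h x : ℂ)) ξ := by
  set μ : Measure ℝ := volume.restrict (Ioc 0 (d / ‖v‖)) with hμ
  rw [Real.fourier_eq']
  have hF : Integrable (Function.uncurry fun (x : E3) (s : ℝ) =>
      cexp (((-2 * Real.pi * inner ℝ x ξ : ℝ) : ℂ) * I)
        * ((Real.exp (-a * s) * h (x - s • v) : ℝ) : ℂ)) (volume.prod μ) := by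
    have hm : Measurable (Function.uncurry fun (x : E3) (s : ℝ) =>
        cexp (((-2 * Real.pi * inner ℝ x ξ : ℝ) : ℂ) * I)
          * ((Real.exp (-a * s) * h (x - s • v) : ℝ) : ℂ)) := by
      simp only [Function.uncurry_def]
      fun_prop
    refine ⟨hm.aestronglyMeasurable, ?_⟩
    rw [hasFiniteIntegral_iff_enorm, lintegral_prod_symm' _ (by fun_prop)]
    calc _ ≤ ∫⁻ s, (∫⁻ x, ‖h x‖ₑ) ∂μ := by
          refine setLIntegral_mono' measurableSet_Ioc fun s hs => ?_
          rw [← lintegral_sub_right_eq_self (fun x => ‖h x‖ₑ) (s • v)]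
          refine lintegral_mono fun x => ?_
          simp only [Function.uncurry_apply_pair]
          rw [enorm_mul, ← ofReal_norm (cexp _), Complex.norm_exp_ofReal_mul_I,
            ENNReal.ofReal_one, one_mul, enorm_complex_ofReal]
          exact enorm_exp_mul_le ha hs.1 _
      _ < ∞ := by
          rw [lintegral_const]
          exact ENNReal.mul_lt_top hi.2 (by simp [hμ])
  have h1 : ∀ x, cexp (((-2 * Real.pi * inner ℝ x ξ : ℝ) : ℂ) * I)
      • (lineTransport d a v h x : ℂ) = ∫ s, cexp (((-2 * Real.pi * inner ℝ x ξ : ℝ) : ℂ) * I)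
        * ((Real.exp (-a * s) * h (x - s • v) : ℝ) : ℂ) ∂μ := by
    intro x
    rw [integral_const_mul, integral_complex_ofReal, smul_eq_mul, lineTransport]
  simp only [h1]
  rw [integral_integral_swap hF, transportSymbol, ← integral_mul_const]
  refine setIntegral_congr_fun measurableSet_Ioc fun s hs => ?_
  rw [← integral_add_right_eq_self _ (s • v), Real.fourier_eq', ← integral_const_mul]
  refine integral_congr_ae (Eventually.of_forall fun x => ?_)
  simp only [add_sub_cancel_right, smul_eq_mul]
  rw [Complex.ofReal_mul (Real.exp _), Complex.ofReal_exp, ← mul_assoc, ← mul_assoc,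
    ← Complex.exp_add, ← Complex.exp_add]
  congr 2
  rw [inner_add_left, real_inner_smul_left]
  push_cast
  ring

theorem measurable_lineTransport {ν : E3 → ℝ} (hν : Measurable ν) {A : E3 × E3 → ℝ}
    (hA : Measurable A) :
    Measurable fun p : E3 × E3 =>
      lineTransport d (ν p.2) p.2 (fun y => A (y, p.2)) p.1 := by
  have hs : MeasurableSet {q : (E3 × E3) × ℝ | q.2 ∈ Ioc 0 (d / ‖q.1.2‖)} :=
    (measurableSet_lt measurable_const measurable_snd).inter
      (measurableSet_le measurable_snd (by fun_prop))
  have hm : Measurable ({q : (E3 × E3) × ℝ | q.2 ∈ Ioc 0 (d / ‖q.1.2‖)}.indicator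
      fun q => Real.exp (-(ν q.1.2) * q.2) * A (q.1.1 - q.2 • q.1.2, q.1.2)) :=
    Measurable.indicator (by fun_prop) hs
  convert (hm.stronglyMeasurable.integral_prod_right' (ν := (volume : Measure ℝ))).measurable
    using 2 with p
  rw [lineTransport, ← integral_indicator measurableSet_Ioc]
  rfl

theorem measurable_transportSymbol {ν : E3 → ℝ} (hν : Measurable ν) (ξ : E3) :
    Measurable fun w : E3 => transportSymbol d (ν w) w ξ := by
  have hs : MeasurableSet {q : E3 × ℝ | q.2 ∈ Ioc 0 (d / ‖q.1‖)} :=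
    (measurableSet_lt measurable_const measurable_snd).inter
      (measurableSet_le measurable_snd (by fun_prop))
  have hm : Measurable ({q : E3 × ℝ | q.2 ∈ Ioc 0 (d / ‖q.1‖)}.indicator
      fun q => cexp (-(ν q.1 + (2 * Real.pi * inner ℝ q.1 ξ : ℝ) * I) * q.2)) :=
    Measurable.indicator (by fun_prop) hs
  convert (hm.stronglyMeasurable.integral_prod_right' (ν := (volume : Measure ℝ))).measurable
    using 2 with p
  rw [transportSymbol, ← integral_indicator measurableSet_Ioc]
  rfl

theorem measurable_fourier_slice {A : E3 × E3 → ℝ} (hA : Measurable A) :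
    Measurable fun p : E3 × E3 => 𝓕 (fun x => (A (x, p.2) : ℂ)) p.1 := by
  simp only [Real.fourier_eq']
  have hm : Measurable fun q : (E3 × E3) × E3 =>
      cexp (((-2 * Real.pi * inner ℝ q.2 q.1.1 : ℝ) : ℂ) * I) • (A (q.2, q.1.2) : ℂ) := by
    fun_prop
  exact (hm.stronglyMeasurable.integral_prod_right' (ν := (volume : Measure E3))).measurable

/-- The polynomial is absorbed by half of the Gaussian: `(1 + n)² ≤ 2 + 2 n² ≤ 34 (1 + n² / 16)` and
`1 + x ≤ exp x`. -/
theorem one_add_sq_mul_exp_le (n : ℝ) :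
    (1 + n) ^ 2 * Real.exp (-(1 / 8) * n ^ 2) ≤ 34 * Real.exp (-(1 / 16) * n ^ 2) := by
  have h1 := Real.add_one_le_exp ((1 / 16) * n ^ 2)
  have e : Real.exp (-(1 / 8) * n ^ 2)
      = Real.exp (-(1 / 16) * n ^ 2) * Real.exp (-((1 / 16) * n ^ 2)) := by
    rw [← Real.exp_add]; congr 1; ring
  have h2 : (1 + n) ^ 2 * Real.exp (-((1 / 16) * n ^ 2)) ≤ 34 := by
    rw [Real.exp_neg, ← div_eq_mul_inv, div_le_iff₀ (Real.exp_pos _)]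
    nlinarith [sq_nonneg (n - 1)]
  rw [e]
  nlinarith [Real.exp_pos (-(1 / 16) * n ^ 2)]

theorem lintegral_cauchy_profile {c : ℝ} (hc : 0 < c) (d u : ℝ) :
    ∫⁻ t : ℝ, ENNReal.ofReal (2 * d ^ 2 * (1 + (c * (t + u)) ^ 2)⁻¹)
      = ENNReal.ofReal (2 * d ^ 2 * (c⁻¹ * Real.pi)) := by
  rw [lintegral_add_right_eq_self
    (fun t : ℝ => ENNReal.ofReal (2 * d ^ 2 * (1 + (c * t) ^ 2)⁻¹)) u,
    ← ofReal_integral_eq_lintegral_ofReal, integral_const_mul,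
    Measure.integral_comp_mul_left (fun t : ℝ => (1 + t ^ 2)⁻¹) c, integral_univ_inv_one_add_sq,
    abs_of_pos (by positivity), smul_eq_mul]
  · exact (integrable_inv_one_add_sq.comp_mul_left' hc.ne').const_mul _
  · exact Eventually.of_forall fun t => by positivity

/-- Averaging in velocity gains half a power of the frequency. -/
theorem exists_lintegral_transportSymbol_le (hd : 0 < d) :
    ∃ C : ℝ≥0∞, C ≠ ∞ ∧ ∀ ν : E3 → ℝ, (∀ w, 0 ≤ ν w) → ∀ v ξ : E3, ξ ≠ 0 →
      ∫⁻ w, ENNReal.ofReal (gradKernel (w - v))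
          * (ENNReal.ofReal ‖w‖ * ‖transportSymbol d (ν w) w ξ‖ₑ) ^ 2
        ≤ C * ENNReal.ofReal ((1 + ‖v‖) / ‖ξ‖) := by
  obtain ⟨C₁, hC₁, h₁⟩ := exists_slice_bound (b := 1 / 16) (by norm_num)
  refine ⟨ENNReal.ofReal (34 * C₁ * (2 * Real.pi * d)), ENNReal.ofReal_ne_top,
    fun ν hν v ξ hξ => ?_⟩
  have hξ' : 0 < ‖ξ‖ := norm_pos_iff.2 hξ
  set e : E3 := ‖ξ‖⁻¹ • ξ with he
  have he1 : ‖e‖ = 1 := by rw [he, norm_smul, norm_inv, norm_norm]; field_simp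
  have hξe : ξ = ‖ξ‖ • e := by rw [he, smul_smul, mul_inv_cancel₀ hξ'.ne', one_smul]
  -- This scale balances the two bounds on `X = |w| |m(w, ξ)|`: with `t = w · e` one has `X ≤ d` and
  -- `|c t| X ≤ d (1 + n)`. Together they give a Cauchy profile in `t` of integral proportional to
  -- `1 / c`, hence to `(1 + ‖v‖) / ‖ξ‖`. The factor `(1 + n)²` is absorbed by the Gaussian, and the
  -- directions orthogonal to `ξ` are integrated out by `exists_slice_bound`.
  set c : ℝ := d * ‖ξ‖ / (1 + ‖v‖) with hc
  have hv1 : 0 < 1 + ‖v‖ := by positivity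
  have hc0 : 0 < c := by positivity
  set H : ℝ → ℝ≥0∞ := fun t =>
    ENNReal.ofReal (2 * d ^ 2 * (1 + (c * (t + inner ℝ v e)) ^ 2)⁻¹) with hH
  have hHm : Measurable H := by simp only [hH]; fun_prop
  calc ∫⁻ w, ENNReal.ofReal (gradKernel (w - v))
          * (ENNReal.ofReal ‖w‖ * ‖transportSymbol d (ν w) w ξ‖ₑ) ^ 2
      ≤ ∫⁻ w, ENNReal.ofReal 34 * (ENNReal.ofReal ((1 + ‖w - v‖⁻¹)
          * Real.exp (-(1 / 16) * ‖(w - v + 0) - inner ℝ (w - v + 0) e • e‖ ^ 2))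
          * H (inner ℝ (w - v) e)) := by
        refine lintegral_mono fun w => ?_
        set X := ‖w‖ * ‖transportSymbol d (ν w) w ξ‖ with hX
        have hX0 : 0 ≤ X := by positivity
        have hXd : X ≤ d := by
          rcases eq_or_ne w 0 with rfl | hw
          · simp [hX, hd.le]
          · have := norm_transportSymbol_le hd.le (hν w) w ξ
            rw [le_div_iff₀ (norm_pos_iff.2 hw)] at this
            rw [hX]; linarith
        set n := ‖w - v‖ with hn
        have hwn : ‖w‖ ≤ (1 + ‖v‖) * (1 + n) := by
          have := norm_add_le (w - v) v
          rw [sub_add_cancel] at this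
          nlinarith [norm_nonneg v, norm_nonneg (w - v)]
        set t := inner ℝ (w - v) e + inner ℝ v e with ht
        have ht' : inner ℝ w ξ = ‖ξ‖ * t := by
          rw [ht, ← inner_add_left, sub_add_cancel]
          nth_rewrite 1 [hξe]
          rw [real_inner_smul_right]
        have hct : |c * t| * X ≤ d * (1 + n) := by
          have h := abs_inner_mul_norm_transportSymbol_le hd.le (hν w) w ξ
          rw [ht', abs_mul, abs_norm] at h
          rw [abs_mul, abs_of_pos hc0, hc, hX]
          have hmul := mul_le_mul h hwn (norm_nonneg _) zero_le_one
          have e1 : d * ‖ξ‖ / (1 + ‖v‖) * |t| * (‖w‖ * ‖transportSymbol d (ν w) w ξ‖)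
              = d / (1 + ‖v‖) * (‖ξ‖ * |t| * ‖transportSymbol d (ν w) w ξ‖ * ‖w‖) := by ring
          rw [e1]
          calc _ ≤ d / (1 + ‖v‖) * (1 * ((1 + ‖v‖) * (1 + n))) := by gcongr
            _ = _ := by field_simp
        have hXsq : X ^ 2 ≤ (1 + n) ^ 2 * (2 * d ^ 2 * (1 + (c * t) ^ 2)⁻¹) := by
          rw [← mul_assoc, ← div_eq_mul_inv, le_div_iff₀ (by positivity)]
          have h2 : (c * t) ^ 2 * X ^ 2 ≤ (d * (1 + n)) ^ 2 := by
            rw [← sq_abs (c * t), ← mul_pow]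
            gcongr
          have h3 : X ^ 2 ≤ d ^ 2 := by gcongr
          have hn0 : 0 ≤ n := norm_nonneg _
          nlinarith [mul_nonneg (sq_nonneg d) hn0, mul_nonneg (sq_nonneg d) (sq_nonneg n)]
        have hproj : ‖(w - v + 0) - inner ℝ (w - v + 0) e • e‖ ^ 2 ≤ n ^ 2 := by
          have := norm_sub_inner_smul_sq he1 (w - v)
          rw [add_zero, hn, this]
          nlinarith [sq_nonneg (inner ℝ (w - v) e)]
        have hexp : Real.exp (-(1 / 16) * n ^ 2)
            ≤ Real.exp (-(1 / 16) * ‖(w - v + 0) - inner ℝ (w - v + 0) e • e‖ ^ 2) := by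
          apply Real.exp_le_exp.2; linarith
        rw [← ofReal_norm, ← ENNReal.ofReal_mul (norm_nonneg _), ← hX,
          ← ENNReal.ofReal_pow hX0, ← ENNReal.ofReal_mul (gradKernel_nonneg _), hH]
        simp only
        rw [← ht, ← ENNReal.ofReal_mul (by positivity), ← ENNReal.ofReal_mul (by norm_num)]
        refine ENNReal.ofReal_le_ofReal ?_
        rw [gradKernel, ← hn]
        have hq := one_add_sq_mul_exp_le n
        have hR : 0 ≤ 2 * d ^ 2 * (1 + (c * t) ^ 2)⁻¹ := by positivity
        have hn0 : 0 ≤ n⁻¹ := inv_nonneg.2 (norm_nonneg _)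
        calc n⁻¹ * Real.exp (-(1 / 8) * n ^ 2) * X ^ 2
            ≤ n⁻¹ * Real.exp (-(1 / 8) * n ^ 2)
              * ((1 + n) ^ 2 * (2 * d ^ 2 * (1 + (c * t) ^ 2)⁻¹)) := by gcongr
          _ = n⁻¹ * ((1 + n) ^ 2 * Real.exp (-(1 / 8) * n ^ 2))
              * (2 * d ^ 2 * (1 + (c * t) ^ 2)⁻¹) := by ring
          _ ≤ (1 + n⁻¹) * (34 * Real.exp (-(1 / 16)
              * ‖(w - v + 0) - inner ℝ (w - v + 0) e • e‖ ^ 2))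
              * (2 * d ^ 2 * (1 + (c * t) ^ 2)⁻¹) := by
              refine mul_le_mul_of_nonneg_right ?_ hR
              exact mul_le_mul (by linarith) (by linarith) (by positivity) (by positivity)
          _ = _ := by ring
    _ = ENNReal.ofReal 34 * ∫⁻ y : E3, ENNReal.ofReal ((1 + ‖y‖⁻¹)
          * Real.exp (-(1 / 16) * ‖(y + 0) - inner ℝ (y + 0) e • e‖ ^ 2))
          * H (inner ℝ y e) := by
        rw [lintegral_const_mul' _ _ ENNReal.ofReal_ne_top,
          lintegral_sub_right_eq_self (fun y : E3 => ENNReal.ofReal ((1 + ‖y‖⁻¹)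
          * Real.exp (-(1 / 16) * ‖(y + 0) - inner ℝ (y + 0) e • e‖ ^ 2))
          * H (inner ℝ y e)) v]
    _ ≤ ENNReal.ofReal 34 * (ENNReal.ofReal C₁ * ∫⁻ t, H t) := by
        gcongr
        exact h₁ e he1 0 H hHm
    _ = _ := by
        rw [hH, lintegral_cauchy_profile hc0, ← ENNReal.ofReal_mul (by positivity),
          ← ENNReal.ofReal_mul (by positivity), ← ENNReal.ofReal_mul (by positivity)]
        congr 1
        rw [hc]
        field_simp

end KineticDomain

end

/-! ### Velocity averaging -/

noncomputable section

namespace KineticDomain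

open Filter Complex
open scoped ENNReal FourierTransform

theorem memLp_two_of_lintegral {α E : Type*} [MeasurableSpace α] {μ : Measure α}
    [NormedAddCommGroup E] {f : α → E} (hf : AEStronglyMeasurable f μ)
    (h : ∫⁻ x, ‖f x‖ₑ ^ 2 ∂μ < ∞) : MemLp f 2 μ := by
  refine ⟨hf, ?_⟩
  rw [eLpNorm_lt_top_iff_lintegral_rpow_enorm_lt_top (by norm_num) (by norm_num)]
  simpa using h

section Averaging

variable {Ω : Set E3} {d Ck : ℝ} {ν : E3 → ℝ} {A : E3 × E3 → ℝ} {v : E3} {k : E3 → ℝ}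

/-- The velocity average against `k` of the transported function. -/
def transportAverage (d : ℝ) (ν : E3 → ℝ) (A : E3 × E3 → ℝ) (k : E3 → ℝ) (x : E3) : ℝ :=
  ∫ w, k w * lineTransport d (ν w) w (fun y => A (y, w)) x

theorem enorm_kernel_le (hCk : 0 ≤ Ck) (hk : ∀ w, |k w| ≤ Ck * gradKernel (w - v)) (w : E3) :
    ‖k w‖ₑ ≤ ENNReal.ofReal Ck * ENNReal.ofReal (gradKernel (w - v)) := by
  rw [← ENNReal.ofReal_mul hCk, ← ofReal_norm]
  exact ENNReal.ofReal_le_ofReal (hk w)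

theorem measurable_lintegral_slice_sq (hA : Measurable A) :
    Measurable fun w => ∫⁻ x, ‖A (x, w)‖ₑ ^ 2 :=
  Measurable.lintegral_prod_left' (f := fun p : E3 × E3 => ‖A p‖ₑ ^ 2) (by fun_prop)

theorem ae_lintegral_slice_sq_lt_top (hA : Measurable A)
    (hfin : ∫⁻ w, velocityWeight w * ∫⁻ x, ‖A (x, w)‖ₑ ^ 2 < ∞) :
    ∀ᵐ w, ∫⁻ x, ‖A (x, w)‖ₑ ^ 2 < ∞ := by
  have hN := measurable_lintegral_slice_sq hA
  refine ae_lt_top hN (lt_of_le_of_lt (lintegral_mono fun w => ?_) hfin).ne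
  exact le_mul_of_one_le_left' (one_le_velocityWeight w)

theorem lintegral_inv_norm_sq_lt_top (hd : 0 ≤ d)
    (hfin : ∫⁻ w, velocityWeight w * ∫⁻ x, ‖A (x, w)‖ₑ ^ 2 < ∞) :
    ∫⁻ w, ENNReal.ofReal (d / ‖w‖) ^ 2 * ∫⁻ x, ‖A (x, w)‖ₑ ^ 2 < ∞ := by
  calc _ ≤ ∫⁻ w, ENNReal.ofReal (d ^ 2) * (velocityWeight w * ∫⁻ x, ‖A (x, w)‖ₑ ^ 2) := by
        refine lintegral_mono fun w => ?_
        rw [← mul_assoc]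
        gcongr
        rw [div_eq_mul_inv, ENNReal.ofReal_mul hd, mul_pow, ← ENNReal.ofReal_pow hd,
          ← ENNReal.ofReal_pow (by positivity)]
        gcongr
        exact ofReal_inv_norm_sq_le_velocityWeight w
    _ < ∞ := by
        rw [lintegral_const_mul' _ _ ENNReal.ofReal_ne_top]
        exact ENNReal.mul_lt_top ENNReal.ofReal_lt_top hfin

/-- A function supported in a set of finite measure: `L²` controls `L¹`. -/
theorem lintegral_enorm_sq_le_of_support {h : E3 → ℝ} (hΩ : MeasurableSet Ω) (hh : Measurable h)
    (hsupp : ∀ x ∉ Ω, h x = 0) :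
    (∫⁻ x, ‖h x‖ₑ) ^ 2 ≤ volume Ω * ∫⁻ x, ‖h x‖ₑ ^ 2 := by
  have h1 := lintegral_mul_sq_le (volume : Measure E3) (f := Ω.indicator 1) (g := fun x => ‖h x‖ₑ)
    (measurable_one.indicator hΩ).aemeasurable (by fun_prop)
  have e1 : ∫⁻ x, (Ω.indicator 1 x : ℝ≥0∞) * ‖h x‖ₑ = ∫⁻ x, ‖h x‖ₑ := by
    refine lintegral_congr fun x => ?_
    by_cases hx : x ∈ Ω <;> simp [hx, hsupp]
  have e2 : ∫⁻ x, (Ω.indicator 1 x : ℝ≥0∞) ^ 2 = volume Ω := by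
    rw [← lintegral_indicator_one hΩ]
    refine lintegral_congr fun x => ?_
    by_cases hx : x ∈ Ω <;> simp [hx]
  rwa [e1, e2] at h1

theorem integrable_of_support {h : E3 → ℝ} (hΩ : MeasurableSet Ω) (hvol : volume Ω < ∞)
    (hh : Measurable h) (hsupp : ∀ x ∉ Ω, h x = 0) (hfin : ∫⁻ x, ‖h x‖ₑ ^ 2 < ∞) :
    Integrable h := by
  refine ⟨hh.aestronglyMeasurable, ?_⟩
  have h2 := lt_of_le_of_lt (lintegral_enorm_sq_le_of_support hΩ hh hsupp)
    (ENNReal.mul_lt_top hvol hfin)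
  rw [hasFiniteIntegral_iff_enorm]
  simpa using (ENNReal.pow_lt_top_iff (n := 2)).1 h2

/-- This justifies Fubini in the Fourier integral. Support in a set of finite measure turns the `L²`
bound on each slice into an `L¹` bound, and the velocity weight pays for the factor `(d / ‖w‖)²`. -/
theorem integrable_kernel_mul_lineTransport (hΩ : MeasurableSet Ω) (hvol : volume Ω < ∞)
    (hd : 0 ≤ d) (hCk : 0 ≤ Ck) (hν : Measurable ν) (hν0 : ∀ w, 0 ≤ ν w) (hA : Measurable A)
    (hsupp : ∀ x ∉ Ω, ∀ w, A (x, w) = 0)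
    (hfin : ∫⁻ w, velocityWeight w * ∫⁻ x, ‖A (x, w)‖ₑ ^ 2 < ∞)
    (hkm : Measurable k) (hk : ∀ w, |k w| ≤ Ck * gradKernel (w - v)) :
    Integrable (fun p : E3 × E3 => k p.2 * lineTransport d (ν p.2) p.2 (fun y => A (y, p.2)) p.1)
      (volume.prod volume) := by
  obtain ⟨C₁, hC₁, h₁⟩ := exists_lintegral_gradKernel_mul_sq_le
  have hG := measurable_lineTransport (d := d) hν hA
  refine ⟨((hkm.comp measurable_snd).mul hG).aestronglyMeasurable, ?_⟩
  rw [hasFiniteIntegral_iff_enorm, lintegral_prod_symm' _ (by fun_prop)]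
  have hφ : Measurable fun w => ∫⁻ x, ‖lineTransport d (ν w) w (fun y => A (y, w)) x‖ₑ :=
    Measurable.lintegral_prod_left'
      (f := fun p : E3 × E3 => ‖lineTransport d (ν p.2) p.2 (fun y => A (y, p.2)) p.1‖ₑ)
      (by fun_prop)
  have hsq : (∫⁻ w, ENNReal.ofReal (gradKernel (w - v))
      * ∫⁻ x, ‖lineTransport d (ν w) w (fun y => A (y, w)) x‖ₑ) ^ 2 < ∞ := by
    refine lt_of_le_of_lt (h₁ v _ hφ) (ENNReal.mul_lt_top hC₁.lt_top ?_)
    calc _ ≤ ∫⁻ w, volume Ω * (ENNReal.ofReal (d / ‖w‖) ^ 2 * ∫⁻ x, ‖A (x, w)‖ₑ ^ 2) := by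
          refine lintegral_mono fun w => ?_
          have hAw : Measurable fun y => A (y, w) := by fun_prop
          have e1 : ENNReal.ofReal (Real.exp (-(1 / 8) * ‖w - v‖ ^ 2)) ≤ 1 := by
            rw [ENNReal.ofReal_le_one, Real.exp_le_one_iff]
            nlinarith [sq_nonneg ‖w - v‖]
          refine (mul_le_of_le_one_left' e1).trans ?_
          calc _ ≤ (ENNReal.ofReal (d / ‖w‖) * ∫⁻ x, ‖A (x, w)‖ₑ) ^ 2 := by
                gcongr; exact lintegral_lineTransport_le (hν0 w) w hAw
            _ ≤ ENNReal.ofReal (d / ‖w‖) ^ 2 * (volume Ω * ∫⁻ x, ‖A (x, w)‖ₑ ^ 2) := by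
                rw [mul_pow]
                gcongr
                exact lintegral_enorm_sq_le_of_support hΩ hAw fun x hx => hsupp x hx w
            _ = _ := by ring
      _ < ∞ := by
          rw [lintegral_const_mul' _ _ hvol.ne]
          exact ENNReal.mul_lt_top hvol (lintegral_inv_norm_sq_lt_top hd hfin)
  have hlt := (ENNReal.pow_lt_top_iff (n := 2)).1 hsq
  simp only [OfNat.ofNat_ne_zero, or_false] at hlt
  calc _ ≤ ∫⁻ w, ENNReal.ofReal Ck * (ENNReal.ofReal (gradKernel (w - v))
        * ∫⁻ x, ‖lineTransport d (ν w) w (fun y => A (y, w)) x‖ₑ) := by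
        refine lintegral_mono fun w => ?_
        simp only [enorm_mul]
        rw [lintegral_const_mul' _ _ enorm_ne_top, ← mul_assoc]
        gcongr
        exact enorm_kernel_le hCk hk w
    _ < ∞ := by
        rw [lintegral_const_mul' _ _ ENNReal.ofReal_ne_top]
        exact ENNReal.mul_lt_top ENNReal.ofReal_lt_top hlt

theorem lintegral_transportAverage_sq_lt_top
    (hd : 0 ≤ d) (hCk : 0 ≤ Ck) (hν : Measurable ν) (hν0 : ∀ w, 0 ≤ ν w) (hA : Measurable A)
    (hfin : ∫⁻ w, velocityWeight w * ∫⁻ x, ‖A (x, w)‖ₑ ^ 2 < ∞)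
    (hk : ∀ w, |k w| ≤ Ck * gradKernel (w - v)) :
    ∫⁻ x, ‖transportAverage d ν A k x‖ₑ ^ 2 < ∞ := by
  obtain ⟨C₁, hC₁, h₁⟩ := exists_lintegral_gradKernel_mul_sq_le
  have hG := measurable_lineTransport (d := d) hν hA
  calc ∫⁻ x, ‖transportAverage d ν A k x‖ₑ ^ 2
      ≤ ∫⁻ x, ENNReal.ofReal Ck ^ 2 * C₁
          * ∫⁻ w, ‖lineTransport d (ν w) w (fun y => A (y, w)) x‖ₑ ^ 2 := by
        refine lintegral_mono fun x => ?_
        have hGx : Measurable fun w => ‖lineTransport d (ν w) w (fun y => A (y, w)) x‖ₑ :=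
          (hG.comp (measurable_prodMk_left (x := x))).enorm
        calc ‖transportAverage d ν A k x‖ₑ ^ 2
            ≤ (ENNReal.ofReal Ck * ∫⁻ w, ENNReal.ofReal (gradKernel (w - v))
                * ‖lineTransport d (ν w) w (fun y => A (y, w)) x‖ₑ) ^ 2 := by
              gcongr
              refine (enorm_integral_le_lintegral_enorm _).trans ?_
              rw [← lintegral_const_mul' _ _ ENNReal.ofReal_ne_top]
              refine lintegral_mono fun w => ?_
              rw [enorm_mul, ← mul_assoc]
              gcongr
              exact enorm_kernel_le hCk hk w
          _ ≤ ENNReal.ofReal Ck ^ 2 * (C₁ * ∫⁻ w, ENNReal.ofReal (Real.exp (-(1 / 8)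
                * ‖w - v‖ ^ 2)) * ‖lineTransport d (ν w) w (fun y => A (y, w)) x‖ₑ ^ 2) := by
              rw [mul_pow]; gcongr; exact h₁ v _ hGx
          _ ≤ _ := by
              rw [← mul_assoc]
              gcongr with w
              refine mul_le_of_le_one_left' ?_
              rw [ENNReal.ofReal_le_one, Real.exp_le_one_iff]
              nlinarith [sq_nonneg ‖w - v‖]
    _ = ENNReal.ofReal Ck ^ 2 * C₁ * ∫⁻ w, ∫⁻ x,
          ‖lineTransport d (ν w) w (fun y => A (y, w)) x‖ₑ ^ 2 := by
        rw [lintegral_const_mul' _ _ (by finiteness), lintegral_lintegral_swap]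
        exact (hG.enorm.pow_const 2).aemeasurable
    _ ≤ ENNReal.ofReal Ck ^ 2 * C₁ * ∫⁻ w, ENNReal.ofReal (d / ‖w‖) ^ 2
          * ∫⁻ x, ‖A (x, w)‖ₑ ^ 2 := by
        gcongr with w
        exact lintegral_lineTransport_sq_le (hν0 w) w (by fun_prop)
    _ < ∞ := ENNReal.mul_lt_top (by finiteness) (lintegral_inv_norm_sq_lt_top hd hfin)

theorem fourier_transportAverage (hΩ : MeasurableSet Ω) (hvol : volume Ω < ∞)
    (hd : 0 ≤ d) (hCk : 0 ≤ Ck) (hν : Measurable ν) (hν0 : ∀ w, 0 ≤ ν w) (hA : Measurable A)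
    (hsupp : ∀ x ∉ Ω, ∀ w, A (x, w) = 0)
    (hfin : ∫⁻ w, velocityWeight w * ∫⁻ x, ‖A (x, w)‖ₑ ^ 2 < ∞)
    (hkm : Measurable k) (hk : ∀ w, |k w| ≤ Ck * gradKernel (w - v)) (ξ : E3) :
    𝓕 (fun x => (transportAverage d ν A k x : ℂ)) ξ
      = ∫ w, (k w : ℂ) * (transportSymbol d (ν w) w ξ * 𝓕 (fun x => (A (x, w) : ℂ)) ξ) := by
  have hi := integrable_kernel_mul_lineTransport hΩ hvol hd hCk hν hν0 hA hsupp hfin hkm hk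
  have hG := measurable_lineTransport (d := d) hν hA
  have hF : Integrable (Function.uncurry fun (x w : E3) =>
      cexp (((-2 * Real.pi * inner ℝ x ξ : ℝ) : ℂ) * I)
        * ((k w * lineTransport d (ν w) w (fun y => A (y, w)) x : ℝ) : ℂ))
      (volume.prod volume) := by
    refine (hi.norm).mono' ?_ (Eventually.of_forall fun p => ?_)
    · refine Measurable.aestronglyMeasurable ?_
      simp only [Function.uncurry_def]
      fun_prop
    · simp only [Function.uncurry_def]
      rw [norm_mul, Complex.norm_exp_ofReal_mul_I, one_mul, Complex.norm_real]
  rw [Real.fourier_eq']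
  have h1 : ∀ x, cexp (((-2 * Real.pi * inner ℝ x ξ : ℝ) : ℂ) * I)
      • (transportAverage d ν A k x : ℂ) = ∫ w, cexp (((-2 * Real.pi * inner ℝ x ξ : ℝ) : ℂ) * I)
        * ((k w * lineTransport d (ν w) w (fun y => A (y, w)) x : ℝ) : ℂ) := by
    intro x
    rw [integral_const_mul, integral_complex_ofReal, smul_eq_mul, transportAverage]
  simp only [h1]
  rw [integral_integral_swap hF]
  refine integral_congr_ae ?_
  filter_upwards [ae_lintegral_slice_sq_lt_top hA hfin] with w hw
  have hAw : Measurable fun y => A (y, w) := by fun_prop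
  have hAi := integrable_of_support hΩ hvol hAw (fun x hx => hsupp x hx w) hw
  rw [← fourier_lineTransport (hν0 w) w hAw hAi, Real.fourier_eq', ← integral_const_mul]
  refine integral_congr_ae (Eventually.of_forall fun x => ?_)
  simp only [smul_eq_mul]
  push_cast
  ring

theorem measurable_fourier_slice_right (hA : Measurable A) (ξ : E3) :
    Measurable fun w : E3 => 𝓕 (fun x => (A (x, w) : ℂ)) ξ := by
  simp only [Real.fourier_eq']
  have hm : Measurable fun q : E3 × E3 =>
      cexp (((-2 * Real.pi * inner ℝ q.2 ξ : ℝ) : ℂ) * I) • (A (q.2, q.1) : ℂ) := by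
    fun_prop
  exact (hm.stronglyMeasurable.integral_prod_right' (ν := (volume : Measure E3))).measurable

/-- Cauchy–Schwarz for an average against a kernel bounded by the Grad kernel. -/
theorem enorm_integral_kernel_sq_le (hCk : 0 ≤ Ck) (hk : ∀ w, |k w| ≤ Ck * gradKernel (w - v))
    {m g : E3 → ℂ} (hm : Measurable m) (hg : Measurable g) :
    ‖∫ w, (k w : ℂ) * (m w * g w)‖ₑ ^ 2
      ≤ ENNReal.ofReal Ck ^ 2 * ((∫⁻ w, ENNReal.ofReal (gradKernel (w - v))
          * (ENNReal.ofReal ‖w‖ * ‖m w‖ₑ) ^ 2)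
        * ∫⁻ w, ENNReal.ofReal (gradKernel (w - v)) * (ENNReal.ofReal (‖w‖⁻¹ ^ 2)
            * ‖g w‖ₑ ^ 2)) := by
  have hgm := measurable_gradKernel
  -- The kernel is divided equally by its square root, and `1 = ‖w‖ ‖w‖⁻¹` is inserted: `‖w‖ |m|` is
  -- bounded near `w = 0`, and the factor `‖w‖⁻²` falls on the data.
  set r : E3 → ℝ≥0∞ := fun w => ENNReal.ofReal (Real.sqrt (gradKernel (w - v))) with hr
  have hrm : Measurable r := by simp only [hr]; fun_prop
  have hrr : ∀ w, r w ^ 2 = ENNReal.ofReal (gradKernel (w - v)) := fun w => by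
    rw [hr]
    simp only
    rw [← ENNReal.ofReal_pow (Real.sqrt_nonneg _), Real.sq_sqrt (gradKernel_nonneg _)]
  have hcs := lintegral_mul_sq_le (volume : Measure E3)
    (f := fun w => r w * (ENNReal.ofReal ‖w‖ * ‖m w‖ₑ))
    (g := fun w => r w * (ENNReal.ofReal ‖w‖⁻¹ * ‖g w‖ₑ)) (by fun_prop) (by fun_prop)
  have hle : ‖∫ w, (k w : ℂ) * (m w * g w)‖ₑ
      ≤ ENNReal.ofReal Ck * ∫⁻ w, (r w * (ENNReal.ofReal ‖w‖ * ‖m w‖ₑ))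
        * (r w * (ENNReal.ofReal ‖w‖⁻¹ * ‖g w‖ₑ)) := by
    refine (enorm_integral_le_lintegral_enorm _).trans ?_
    rw [← lintegral_const_mul' _ _ ENNReal.ofReal_ne_top]
    have h0 : ∀ᵐ w : E3, w ≠ 0 := by simp [ae_iff]
    refine lintegral_mono_ae ?_
    filter_upwards [h0] with w hw
    have hw' : ENNReal.ofReal ‖w‖ * ENNReal.ofReal ‖w‖⁻¹ = 1 := by
      rw [← ENNReal.ofReal_mul (norm_nonneg _), mul_inv_cancel₀ (norm_ne_zero_iff.2 hw),
        ENNReal.ofReal_one]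
    rw [enorm_mul, enorm_mul, enorm_complex_ofReal]
    calc _ ≤ (ENNReal.ofReal Ck * r w ^ 2) * (‖m w‖ₑ * ‖g w‖ₑ) := by
          gcongr
          rw [hrr]
          exact enorm_kernel_le hCk hk w
      _ = (ENNReal.ofReal Ck * r w ^ 2) * (‖m w‖ₑ * ‖g w‖ₑ)
          * (ENNReal.ofReal ‖w‖ * ENNReal.ofReal ‖w‖⁻¹) := by
          rw [hw', mul_one]
      _ = _ := by ring
  calc _ ≤ (ENNReal.ofReal Ck * ∫⁻ w, (r w * (ENNReal.ofReal ‖w‖ * ‖m w‖ₑ))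
        * (r w * (ENNReal.ofReal ‖w‖⁻¹ * ‖g w‖ₑ))) ^ 2 := by gcongr
    _ ≤ _ := by
        rw [mul_pow]
        gcongr
        refine hcs.trans (le_of_eq ?_)
        congr 1
        · refine lintegral_congr fun w => ?_
          rw [mul_pow, hrr]
        · refine lintegral_congr fun w => ?_
          rw [mul_pow, hrr, mul_pow, ENNReal.ofReal_pow (inv_nonneg.2 (norm_nonneg _))]

/-- Velocity averaging: the average of the transported function has half a derivative. -/
theorem exists_lintegral_transportAverage_translate_le (hd : 0 < d) (hCk : 0 ≤ Ck) :
    ∃ C : ℝ≥0∞, C ≠ ∞ ∧ ∀ (Ω : Set E3) (ν : E3 → ℝ) (A : E3 × E3 → ℝ) (v : E3) (k : E3 → ℝ),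
      MeasurableSet Ω → volume Ω < ∞ → Measurable ν → (∀ w, 0 ≤ ν w) → Measurable A →
      (∀ x ∉ Ω, ∀ w, A (x, w) = 0) →
      ∫⁻ w, velocityWeight w * ∫⁻ x, ‖A (x, w)‖ₑ ^ 2 < ∞ →
      Measurable k → (∀ w, |k w| ≤ Ck * gradKernel (w - v)) → ∀ z : E3,
      ∫⁻ x, ‖transportAverage d ν A k (x + z) - transportAverage d ν A k x‖ₑ ^ 2
        ≤ C * ENNReal.ofReal ‖z‖ * ENNReal.ofReal (1 + ‖v‖)
          * ∫⁻ w, ENNReal.ofReal (gradKernel (w - v)) * (ENNReal.ofReal (‖w‖⁻¹ ^ 2)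
            * ∫⁻ x, ‖A (x, w)‖ₑ ^ 2) := by
  obtain ⟨C₁, hC₁, h₁⟩ := exists_lintegral_transportSymbol_le hd
  refine ⟨ENNReal.ofReal (4 * Real.pi) * (ENNReal.ofReal Ck ^ 2 * C₁), by finiteness, ?_⟩
  intro Ω ν A v k hΩ hvol hν hν0 hA hsupp hfin hkm hk z
  have hi := integrable_kernel_mul_lineTransport hΩ hvol hd.le hCk hν hν0 hA hsupp hfin hkm hk
  have hPi : Integrable (transportAverage d ν A k) := hi.integral_prod_left
  have hPi' : Integrable fun x => (transportAverage d ν A k x : ℂ) := hPi.ofReal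
  have hP2 : MemLp (fun x => (transportAverage d ν A k x : ℂ)) 2 :=
    memLp_two_of_lintegral hPi'.1 (by
      simp only [enorm_complex_ofReal]
      exact lintegral_transportAverage_sq_lt_top hd.le hCk hν hν0 hA hfin hk)
  have hgm := measurable_gradKernel
  have hFm := measurable_fourier_slice hA
  have hpoint : ∀ ξ : E3, ξ ≠ 0 →
      ‖𝓕 (fun x => (transportAverage d ν A k x : ℂ)) ξ‖ₑ ^ 2
        ≤ ENNReal.ofReal Ck ^ 2 * ((C₁ * ENNReal.ofReal ((1 + ‖v‖) / ‖ξ‖))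
          * ∫⁻ w, ENNReal.ofReal (gradKernel (w - v)) * (ENNReal.ofReal (‖w‖⁻¹ ^ 2)
            * ‖𝓕 (fun x => (A (x, w) : ℂ)) ξ‖ₑ ^ 2)) := by
    intro ξ hξ
    rw [fourier_transportAverage hΩ hvol hd.le hCk hν hν0 hA hsupp hfin hkm hk]
    refine (enorm_integral_kernel_sq_le hCk hk (measurable_transportSymbol (d := d) hν ξ)
      (measurable_fourier_slice_right hA ξ)).trans ?_
    exact mul_le_mul_right (mul_le_mul_left (h₁ ν hν0 v ξ hξ) _) _
  have hplanch : ∀ᵐ w, ∫⁻ ξ, ‖𝓕 (fun x => (A (x, w) : ℂ)) ξ‖ₑ ^ 2 = ∫⁻ x, ‖A (x, w)‖ₑ ^ 2 := by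
    filter_upwards [ae_lintegral_slice_sq_lt_top hA hfin] with w hw
    have hAw : Measurable fun y => A (y, w) := by fun_prop
    have hAi := integrable_of_support hΩ hvol hAw (fun x hx => hsupp x hx w) hw
    have hAc : Integrable fun x => (A (x, w) : ℂ) := hAi.ofReal
    rw [lintegral_enorm_fourier_sq hAc (memLp_two_of_lintegral hAc.1 (by
      simpa only [enorm_complex_ofReal] using hw))]
    simp only [enorm_complex_ofReal]
  have hξ0 : ∀ᵐ ξ : E3, ξ ≠ 0 := by simp [ae_iff]
  -- The factor `‖ξ‖` cancels the decay `(1 + ‖v‖) / ‖ξ‖` exactly, so this homogeneous `H^(1/2)`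
  -- energy is bounded by Plancherel on the slices of `A`, without any loss.
  have hfour : ∫⁻ ξ, ENNReal.ofReal ‖ξ‖ * ‖𝓕 (fun x => (transportAverage d ν A k x : ℂ)) ξ‖ₑ ^ 2
      ≤ ENNReal.ofReal Ck ^ 2 * C₁ * ENNReal.ofReal (1 + ‖v‖)
        * ∫⁻ w, ENNReal.ofReal (gradKernel (w - v)) * (ENNReal.ofReal (‖w‖⁻¹ ^ 2)
          * ∫⁻ x, ‖A (x, w)‖ₑ ^ 2) := by
    calc _ ≤ ∫⁻ ξ, ENNReal.ofReal Ck ^ 2 * C₁ * ENNReal.ofReal (1 + ‖v‖)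
          * ∫⁻ w, ENNReal.ofReal (gradKernel (w - v)) * (ENNReal.ofReal (‖w‖⁻¹ ^ 2)
            * ‖𝓕 (fun x => (A (x, w) : ℂ)) ξ‖ₑ ^ 2) := by
          refine lintegral_mono_ae ?_
          filter_upwards [hξ0] with ξ hξ
          refine (mul_le_mul_right (hpoint ξ hξ) _).trans (le_of_eq ?_)
          have hn : ENNReal.ofReal (1 + ‖v‖)
              = ENNReal.ofReal ‖ξ‖ * ENNReal.ofReal ((1 + ‖v‖) / ‖ξ‖) := by
            rw [← ENNReal.ofReal_mul (norm_nonneg _),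
              mul_div_cancel₀ _ (norm_ne_zero_iff.2 hξ)]
          rw [hn]
          ring
      _ = ENNReal.ofReal Ck ^ 2 * C₁ * ENNReal.ofReal (1 + ‖v‖)
          * ∫⁻ w, ∫⁻ ξ, ENNReal.ofReal (gradKernel (w - v)) * (ENNReal.ofReal (‖w‖⁻¹ ^ 2)
            * ‖𝓕 (fun x => (A (x, w) : ℂ)) ξ‖ₑ ^ 2) := by
          rw [lintegral_const_mul' _ _ (by finiteness), lintegral_lintegral_swap]
          simp only [Function.uncurry_def]
          fun_prop
      _ = _ := by
          congr 1
          refine lintegral_congr_ae ?_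
          filter_upwards [hplanch] with w hw
          rw [lintegral_const_mul' _ _ ENNReal.ofReal_ne_top,
            lintegral_const_mul' _ _ ENNReal.ofReal_ne_top, hw]
  have hmain := lintegral_translate_sub_sq hPi' hP2 z
  simp only [← Complex.ofReal_sub, enorm_complex_ofReal] at hmain
  refine hmain.trans ((mul_le_mul_right hfour _).trans (le_of_eq ?_))
  rw [ENNReal.ofReal_mul (by positivity : 0 ≤ 4 * Real.pi)]
  ring

end Averaging

end KineticDomain

end

/-! ### Moduli of continuity after cutting off by the domain -/

noncomputable section

namespace KineticDomain

open Filter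
open scoped ENNReal

variable {Ω : Set E3} {c d Ck : ℝ} {ν : E3 → ℝ} {A h : E3 × E3 → ℝ} {k : E3 → E3 → ℝ}

/-- The weighted squared `L²` norm. -/
def weightedEnergy (A : E3 × E3 → ℝ) : ℝ≥0∞ :=
  ∫⁻ w, velocityWeight w * ∫⁻ x, ‖A (x, w)‖ₑ ^ 2

/-- Convolution in velocity of the transported function with the Grad kernel. -/
def transportMajorant (d : ℝ) (ν : E3 → ℝ) (A : E3 × E3 → ℝ) (x v : E3) : ℝ≥0∞ :=
  ∫⁻ w, ENNReal.ofReal (gradKernel (w - v)) * ‖lineTransport d (ν w) w (fun y => A (y, w)) x‖ₑ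

theorem measurable_transportMajorant (hν : Measurable ν) (hA : Measurable A) :
    Measurable fun p : E3 × E3 => transportMajorant d ν A p.1 p.2 := by
  have hG := measurable_lineTransport (d := d) hν hA
  have hg := measurable_gradKernel
  have hG' : Measurable fun q : (E3 × E3) × E3 =>
      lineTransport d (ν q.2) q.2 (fun y => A (y, q.2)) q.1.1 :=
    hG.comp (f := fun q : (E3 × E3) × E3 => (q.1.1, q.2)) (by fun_prop)
  exact Measurable.lintegral_prod_right' (f := fun q : (E3 × E3) × E3 =>
    ENNReal.ofReal (gradKernel (q.2 - q.1.2))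
      * ‖lineTransport d (ν q.2) q.2 (fun y => A (y, q.2)) q.1.1‖ₑ) (by fun_prop)

theorem measurable_transportMajorant_comp (hν : Measurable ν) (hA : Measurable A) {Y : Type*}
    [MeasurableSpace Y] {X V : Y → E3} (hX : Measurable X) (hV : Measurable V) :
    Measurable fun y => transportMajorant d ν A (X y) (V y) :=
  Measurable.comp (g := fun p : E3 × E3 => transportMajorant d ν A p.1 p.2)
    (f := fun y => (X y, V y)) (measurable_transportMajorant hν hA) (hX.prodMk hV)

theorem measurable_lineTransport_comp (hν : Measurable ν) (hA : Measurable A) {Y : Type*}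
    [MeasurableSpace Y] {X V : Y → E3} (hX : Measurable X) (hV : Measurable V) :
    Measurable fun y => lineTransport d (ν (V y)) (V y) (fun x => A (x, V y)) (X y) :=
  Measurable.comp (g := fun p : E3 × E3 => lineTransport d (ν p.2) p.2 (fun x => A (x, p.2)) p.1)
    (f := fun y => (X y, V y)) (measurable_lineTransport hν hA) (hX.prodMk hV)

theorem enorm_transportAverage_le (hCk : 0 ≤ Ck) {v : E3} {k : E3 → ℝ}
    (hk : ∀ w, |k w| ≤ Ck * gradKernel (w - v)) (x : E3) :
    ‖transportAverage d ν A k x‖ₑ ≤ ENNReal.ofReal Ck * transportMajorant d ν A x v := by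
  refine (enorm_integral_le_lintegral_enorm _).trans ?_
  rw [transportMajorant, ← lintegral_const_mul' _ _ ENNReal.ofReal_ne_top]
  refine lintegral_mono fun w => ?_
  rw [enorm_mul, ← mul_assoc]
  gcongr
  exact enorm_kernel_le hCk hk w

/-- The convolution acts in the velocity alone, so it may be localised to any set `S` of positions:
the whole space for the energy bound, the exit sets for the boundary terms. -/
theorem exists_lintegral_transportMajorant_le (hν : Measurable ν) :
    ∃ C : ℝ≥0∞, C ≠ ∞ ∧ ∀ A : E3 × E3 → ℝ, Measurable A → ∀ S : Set E3,
      ∫⁻ v, velocityWeight v * ∫⁻ x in S, transportMajorant d ν A x v ^ 2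
        ≤ C * ∫⁻ w, ∫⁻ x in S, ‖lineTransport d (ν w) w (fun y => A (y, w)) x‖ₑ ^ 2 := by
  obtain ⟨C, hC, h⟩ := exists_lintegral_velocityWeight_mul_le
  refine ⟨C, hC, fun A hA S => ?_⟩
  have hQ := measurable_transportMajorant (d := d) hν hA
  have hG := measurable_lineTransport (d := d) hν hA
  have hW := measurable_velocityWeight
  calc ∫⁻ v, velocityWeight v * ∫⁻ x in S, transportMajorant d ν A x v ^ 2
      = ∫⁻ v, ∫⁻ x in S, velocityWeight v * transportMajorant d ν A x v ^ 2 := by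
        refine lintegral_congr fun v => ?_
        rw [lintegral_const_mul]
        exact (measurable_transportMajorant_comp hν hA measurable_id measurable_const).pow_const 2
    _ = ∫⁻ x in S, ∫⁻ v, velocityWeight v * transportMajorant d ν A x v ^ 2 := by
        rw [lintegral_lintegral_swap]
        have hQ' : Measurable fun p : E3 × E3 => transportMajorant d ν A p.2 p.1 :=
          measurable_transportMajorant_comp hν hA measurable_snd measurable_fst
        exact ((hW.comp measurable_fst).mul (hQ'.pow_const 2)).aemeasurable
    _ ≤ ∫⁻ x in S, C * ∫⁻ w, ‖lineTransport d (ν w) w (fun y => A (y, w)) x‖ₑ ^ 2 := by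
        refine lintegral_mono fun x => h _ ?_
        exact (measurable_lineTransport_comp hν hA measurable_const measurable_id).enorm
    _ = _ := by
        rw [lintegral_const_mul' _ _ hC, lintegral_lintegral_swap]
        exact (hG.enorm.pow_const 2).aemeasurable

theorem lintegral_ofReal_div_le_weightedEnergy {C : ℝ} (hC : 0 ≤ C) :
    ∫⁻ w, ENNReal.ofReal (C / ‖w‖ ^ 2) * ∫⁻ x, ‖A (x, w)‖ₑ ^ 2
      ≤ ENNReal.ofReal C * weightedEnergy A := by
  rw [weightedEnergy, ← lintegral_const_mul' _ _ ENNReal.ofReal_ne_top]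
  refine lintegral_mono fun w => ?_
  rw [← mul_assoc]
  gcongr
  rw [div_eq_mul_inv, ENNReal.ofReal_mul hC, ← inv_pow]
  gcongr
  exact ofReal_inv_norm_sq_le_velocityWeight w

/-- The points of `Ω` that leave `Ω` under translation by `z`. -/
def exitSet (Ω : Set E3) (z : E3) : Set E3 := {x | x ∈ Ω ∧ x + z ∉ Ω}

theorem measurableSet_exitSet (hΩ : MeasurableSet Ω) (z : E3) : MeasurableSet (exitSet Ω z) :=
  hΩ.inter ((measurable_add_const z) hΩ).compl

/-- Comparing the translates of a function cut off by `Ω`. -/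
theorem lintegral_indicator_translate_sub_sq_le (hΩ : MeasurableSet Ω) {P : E3 → ℝ}
    (hP : Measurable P) (z : E3) :
    ∫⁻ x, ‖Ω.indicator P (x + z) - Ω.indicator P x‖ₑ ^ 2
      ≤ (∫⁻ x, ‖P (x + z) - P x‖ₑ ^ 2) + (∫⁻ x in exitSet Ω z, ‖P x‖ₑ ^ 2)
        + ∫⁻ x in exitSet Ω (-z), ‖P x‖ₑ ^ 2 := by
  have hS := measurableSet_exitSet hΩ
  have h3 : ∫⁻ x in exitSet Ω (-z), ‖P x‖ₑ ^ 2
      = ∫⁻ x, (exitSet Ω (-z)).indicator (fun x => ‖P x‖ₑ ^ 2) (x + z) := by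
    rw [lintegral_add_right_eq_self (fun x => (exitSet Ω (-z)).indicator (fun x => ‖P x‖ₑ ^ 2) x),
      lintegral_indicator (hS _)]
  have hm2 : Measurable ((exitSet Ω z).indicator fun x => ‖P x‖ₑ ^ 2) :=
    Measurable.indicator (by fun_prop) (hS _)
  rw [h3, ← lintegral_indicator (hS _), ← lintegral_add_left (by fun_prop),
    ← lintegral_add_left (by fun_prop)]
  refine lintegral_mono fun x => ?_
  -- If both points are in `Ω` the first term suffices. If only `x` is, then `x` is in the exit set
  -- of `z`; if only `x + z` is, then `x + z` is in the exit set of `-z`.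
  by_cases h1 : x ∈ Ω <;> by_cases h2 : x + z ∈ Ω <;> simp [exitSet, indicator, h1, h2]

theorem setLIntegral_exitSet_transport_le (hν0 : ∀ w, 0 ≤ ν w) (hop : IsOpen Ω)
    (hc : 0 < c) (hsc : StronglyConvexSet c Ω) (hd : ∀ x ∈ Ω, ∀ y ∈ Ω, ‖x - y‖ ≤ d)
    (hA : Measurable A) (hsupp : ∀ x ∉ Ω, ∀ w, A (x, w) = 0) (z : E3) :
    ∫⁻ w, ∫⁻ x in exitSet Ω z, ‖lineTransport d (ν w) w (fun y => A (y, w)) x‖ₑ ^ 2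
      ≤ ENNReal.ofReal (4 / c * ‖z‖) * weightedEnergy A := by
  refine le_trans (lintegral_mono_ae ?_)
    (lintegral_ofReal_div_le_weightedEnergy (A := A) (by positivity : 0 ≤ 4 / c * ‖z‖))
  have h0 : ∀ᵐ w : E3, w ≠ 0 := by simp [ae_iff]
  filter_upwards [h0] with w hw
  exact setLIntegral_boundary_lineTransport_sq_le hop hc hsc hd (hν0 w) hw
    (by fun_prop : Measurable fun y => A (y, w)) (fun x hx => hsupp x hx w) z

theorem lintegral_transport_sq_le (hν0 : ∀ w, 0 ≤ ν w) (hd0 : 0 ≤ d) (hA : Measurable A) :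
    ∫⁻ w, ∫⁻ x, ‖lineTransport d (ν w) w (fun y => A (y, w)) x‖ₑ ^ 2
      ≤ ENNReal.ofReal (d ^ 2) * weightedEnergy A := by
  refine le_trans (lintegral_mono fun w => ?_)
    (lintegral_ofReal_div_le_weightedEnergy (A := A) (sq_nonneg d))
  refine (lintegral_lineTransport_sq_le (hν0 w) w (by fun_prop)).trans (le_of_eq ?_)
  rw [← ENNReal.ofReal_pow (by positivity), div_pow]

theorem exists_lintegral_average_weight_le :
    ∃ C : ℝ≥0∞, C ≠ ∞ ∧ ∀ A : E3 × E3 → ℝ, Measurable A →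
      ∫⁻ v, ENNReal.ofReal (‖v‖⁻¹ ^ 2) * (ENNReal.ofReal (1 + ‖v‖)
        * ∫⁻ w, ENNReal.ofReal (gradKernel (w - v)) * (ENNReal.ofReal (‖w‖⁻¹ ^ 2)
            * ∫⁻ x, ‖A (x, w)‖ₑ ^ 2)) ≤ C * weightedEnergy A := by
  obtain ⟨C, hC, h⟩ := exists_lintegral_weighted_gradKernel_le
  refine ⟨C, hC, fun A hA => ?_⟩
  have hN := measurable_lintegral_slice_sq hA
  have hg := measurable_gradKernel
  calc _ = ∫⁻ v, ∫⁻ w, ENNReal.ofReal (‖v‖⁻¹ ^ 2 * (1 + ‖v‖) * gradKernel (w - v))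
        * (ENNReal.ofReal (‖w‖⁻¹ ^ 2) * ∫⁻ x, ‖A (x, w)‖ₑ ^ 2) := by
        refine lintegral_congr fun v => ?_
        rw [← lintegral_const_mul' _ _ ENNReal.ofReal_ne_top,
          ← lintegral_const_mul' _ _ ENNReal.ofReal_ne_top]
        refine lintegral_congr fun w => ?_
        rw [ENNReal.ofReal_mul (by positivity), ENNReal.ofReal_mul (by positivity)]
        ring
    _ = ∫⁻ w, ∫⁻ v, ENNReal.ofReal (‖v‖⁻¹ ^ 2 * (1 + ‖v‖) * gradKernel (w - v))
        * (ENNReal.ofReal (‖w‖⁻¹ ^ 2) * ∫⁻ x, ‖A (x, w)‖ₑ ^ 2) := by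
        rw [lintegral_lintegral_swap]
        have hN' : Measurable fun p : E3 × E3 => ∫⁻ x, ‖A (x, p.2)‖ₑ ^ 2 :=
          hN.comp measurable_snd
        exact Measurable.aemeasurable (by simp only [Function.uncurry_def]; fun_prop)
    _ ≤ ∫⁻ w, C * (velocityWeight w * ∫⁻ x, ‖A (x, w)‖ₑ ^ 2) := by
        have h0 : ∀ᵐ w : E3, w ≠ 0 := by simp [ae_iff]
        refine lintegral_mono_ae ?_
        filter_upwards [h0] with w hw
        rw [lintegral_mul_const _ (by fun_prop), ← mul_assoc, ← mul_assoc]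
        refine mul_le_mul_left ?_ _
        rw [mul_comm]
        exact h w hw
    _ = _ := lintegral_const_mul' _ _ hC

/-- The velocity average of a transported function, cut off by `Ω`, in the weighted space. -/
theorem exists_weightedEnergy_average_le (hd0 : 0 ≤ d) (hCk : 0 ≤ Ck) (hν : Measurable ν)
    (hν0 : ∀ w, 0 ≤ ν w) (hk : ∀ v w, |k v w| ≤ Ck * gradKernel (w - v)) :
    ∃ C : ℝ≥0∞, C ≠ ∞ ∧ ∀ A h : E3 × E3 → ℝ, Measurable A →
      (∀ v, ∀ᵐ x, h (x, v) = Ω.indicator (transportAverage d ν A (k v)) x) →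
      weightedEnergy h ≤ C * weightedEnergy A := by
  obtain ⟨C, hC, hC'⟩ := exists_lintegral_transportMajorant_le (d := d) hν
  refine ⟨ENNReal.ofReal Ck ^ 2 * (C * ENNReal.ofReal (d ^ 2)), by finiteness, ?_⟩
  intro A h hA hh
  calc weightedEnergy h ≤ ∫⁻ v, ENNReal.ofReal Ck ^ 2 * (velocityWeight v
          * ∫⁻ x in univ, transportMajorant d ν A x v ^ 2) := by
        refine lintegral_mono fun v => ?_
        rw [mul_left_comm, Measure.restrict_univ]
        refine mul_le_mul_right ?_ _
        rw [← lintegral_const_mul' (ENNReal.ofReal Ck ^ 2) _ (by finiteness)]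
        refine lintegral_mono_ae ?_
        filter_upwards [hh v] with x hx
        rw [hx, ← mul_pow]
        gcongr
        refine le_trans ?_ (enorm_transportAverage_le hCk (hk v) x)
        by_cases hxΩ : x ∈ Ω <;> simp [hxΩ]
    _ = ENNReal.ofReal Ck ^ 2 * ∫⁻ v, velocityWeight v
          * ∫⁻ x in univ, transportMajorant d ν A x v ^ 2 :=
        lintegral_const_mul' _ _ (by finiteness)
    _ ≤ ENNReal.ofReal Ck ^ 2 * (C * (ENNReal.ofReal (d ^ 2) * weightedEnergy A)) := by
        gcongr
        refine (hC' A hA univ).trans ?_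
        gcongr
        simpa using lintegral_transport_sq_le hν0 hd0 hA
    _ = _ := by ring

/-- Translates of the velocity average of a transported function, cut off by `Ω`. -/
theorem exists_lintegral_average_translate_le (hop : IsOpen Ω) (hvol : volume Ω < ∞) (hc : 0 < c)
    (hsc : StronglyConvexSet c Ω) (hd : ∀ x ∈ Ω, ∀ y ∈ Ω, ‖x - y‖ ≤ d) (hd0 : 0 < d)
    (hCk : 0 ≤ Ck) (hν : Measurable ν) (hν0 : ∀ w, 0 ≤ ν w) (hkm : ∀ v, Measurable (k v))
    (hk : ∀ v w, |k v w| ≤ Ck * gradKernel (w - v)) :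
    ∃ C : ℝ≥0∞, C ≠ ∞ ∧ ∀ A h : E3 × E3 → ℝ, Measurable A →
      (∀ x ∉ Ω, ∀ w, A (x, w) = 0) → weightedEnergy A < ∞ →
      (∀ v, ∀ᵐ x, h (x, v) = Ω.indicator (transportAverage d ν A (k v)) x) → ∀ z : E3,
      ∫⁻ v, ENNReal.ofReal (‖v‖⁻¹ ^ 2) * ∫⁻ x, ‖h (x + z, v) - h (x, v)‖ₑ ^ 2
        ≤ C * ENNReal.ofReal ‖z‖ * weightedEnergy A := by
  obtain ⟨C₁, hC₁, h₁⟩ := exists_lintegral_transportAverage_translate_le hd0 hCk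
  obtain ⟨C₂, hC₂, h₂⟩ := exists_lintegral_average_weight_le
  obtain ⟨C₃, hC₃, h₃⟩ := exists_lintegral_transportMajorant_le (d := d) hν
  refine ⟨C₁ * C₂ + 2 * (ENNReal.ofReal Ck ^ 2 * (C₃ * ENNReal.ofReal (4 / c))), by finiteness, ?_⟩
  intro A h hA hsupp hfin hh z
  have hQ := measurable_transportMajorant (d := d) hν hA
  have hG := measurable_lineTransport (d := d) hν hA
  have hΩ := hop.measurableSet
  have hQS : ∀ S : Set E3, Measurable fun v => ∫⁻ x in S, transportMajorant d ν A x v ^ 2 :=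
    fun S => Measurable.lintegral_prod_left'
      (f := fun p : E3 × E3 => transportMajorant d ν A p.1 p.2 ^ 2) (hQ.pow_const 2)
  have hfix : ∀ v, ∫⁻ x, ‖h (x + z, v) - h (x, v)‖ₑ ^ 2
      ≤ C₁ * ENNReal.ofReal ‖z‖ * (ENNReal.ofReal (1 + ‖v‖)
          * ∫⁻ w, ENNReal.ofReal (gradKernel (w - v)) * (ENNReal.ofReal (‖w‖⁻¹ ^ 2)
            * ∫⁻ x, ‖A (x, w)‖ₑ ^ 2))
        + (ENNReal.ofReal Ck ^ 2 * (∫⁻ x in exitSet Ω z, transportMajorant d ν A x v ^ 2)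
        + ENNReal.ofReal Ck ^ 2 * ∫⁻ x in exitSet Ω (-z), transportMajorant d ν A x v ^ 2) := by
    intro v
    have hPm : Measurable (transportAverage d ν A (k v)) := by
      have hkv := hkm v
      have hm : Measurable fun p : E3 × E3 =>
          k v p.2 * lineTransport d (ν p.2) p.2 (fun y => A (y, p.2)) p.1 :=
        (hkv.comp measurable_snd).mul hG
      exact (hm.stronglyMeasurable.integral_prod_right' (ν := (volume : Measure E3))).measurable
    have hshift : ∀ᵐ x, h (x + z, v) = Ω.indicator (transportAverage d ν A (k v)) (x + z) :=
      (measurePreserving_add_right (volume : Measure E3) z).quasiMeasurePreserving.ae (hh v)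
    have hbd : ∀ S : Set E3, ∫⁻ x in S, ‖transportAverage d ν A (k v) x‖ₑ ^ 2
        ≤ ENNReal.ofReal Ck ^ 2 * ∫⁻ x in S, transportMajorant d ν A x v ^ 2 := by
      intro S
      rw [← lintegral_const_mul' _ _ (by finiteness)]
      refine lintegral_mono fun x => ?_
      rw [← mul_pow]
      gcongr
      exact enorm_transportAverage_le hCk (hk v) x
    calc ∫⁻ x, ‖h (x + z, v) - h (x, v)‖ₑ ^ 2
        = ∫⁻ x, ‖Ω.indicator (transportAverage d ν A (k v)) (x + z)
            - Ω.indicator (transportAverage d ν A (k v)) x‖ₑ ^ 2 := by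
          refine lintegral_congr_ae ?_
          filter_upwards [hh v, hshift] with x h1 h2
          rw [h1, h2]
      _ ≤ _ := lintegral_indicator_translate_sub_sq_le hΩ hPm z
      _ ≤ _ := by
          rw [add_assoc]
          refine add_le_add ?_ (add_le_add (hbd _) (hbd _))
          refine (h₁ Ω ν A v (k v) hΩ hvol hν hν0 hA hsupp hfin (hkm v) (hk v) z).trans
            (le_of_eq ?_)
          ring
  have hinv : ∀ v : E3, ENNReal.ofReal (‖v‖⁻¹ ^ 2) ≤ velocityWeight v :=
    ofReal_inv_norm_sq_le_velocityWeight
  -- The average is not itself a transported density, so its boundary mass is passed to the inner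
  -- transport by the majorant, and there the chord estimate applies.
  have hexit : ∀ z' : E3, ‖z'‖ = ‖z‖ → ∫⁻ v, ENNReal.ofReal (‖v‖⁻¹ ^ 2) * (ENNReal.ofReal Ck ^ 2
      * ∫⁻ x in exitSet Ω z', transportMajorant d ν A x v ^ 2)
      ≤ ENNReal.ofReal Ck ^ 2 * (C₃ * ENNReal.ofReal (4 / c)) * ENNReal.ofReal ‖z‖
        * weightedEnergy A := by
    intro z' hz'
    calc _ ≤ ∫⁻ v, ENNReal.ofReal Ck ^ 2 * (velocityWeight v
          * ∫⁻ x in exitSet Ω z', transportMajorant d ν A x v ^ 2) := by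
          refine lintegral_mono fun v => ?_
          rw [mul_left_comm]
          gcongr
          exact hinv v
      _ ≤ ENNReal.ofReal Ck ^ 2 * (C₃ * (ENNReal.ofReal (4 / c * ‖z'‖) * weightedEnergy A)) := by
          rw [lintegral_const_mul' _ _ (by finiteness)]
          gcongr
          refine (h₃ A hA _).trans ?_
          gcongr
          exact setLIntegral_exitSet_transport_le hν0 hop hc hsc hd hA hsupp z'
      _ = _ := by
          rw [hz', ENNReal.ofReal_mul (by positivity)]
          ring
  calc _ ≤ ∫⁻ v, (C₁ * ENNReal.ofReal ‖z‖ * (ENNReal.ofReal (‖v‖⁻¹ ^ 2)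
          * (ENNReal.ofReal (1 + ‖v‖)
          * ∫⁻ w, ENNReal.ofReal (gradKernel (w - v)) * (ENNReal.ofReal (‖w‖⁻¹ ^ 2)
            * ∫⁻ x, ‖A (x, w)‖ₑ ^ 2)))
        + (ENNReal.ofReal (‖v‖⁻¹ ^ 2) * (ENNReal.ofReal Ck ^ 2
            * ∫⁻ x in exitSet Ω z, transportMajorant d ν A x v ^ 2)
        + ENNReal.ofReal (‖v‖⁻¹ ^ 2) * (ENNReal.ofReal Ck ^ 2
            * ∫⁻ x in exitSet Ω (-z), transportMajorant d ν A x v ^ 2))) := by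
        refine lintegral_mono fun v => (mul_le_mul_right (hfix v) _).trans (le_of_eq ?_)
        ring
    _ ≤ C₁ * ENNReal.ofReal ‖z‖ * (C₂ * weightedEnergy A)
        + (ENNReal.ofReal Ck ^ 2 * (C₃ * ENNReal.ofReal (4 / c)) * ENNReal.ofReal ‖z‖
          * weightedEnergy A + ENNReal.ofReal Ck ^ 2 * (C₃ * ENNReal.ofReal (4 / c))
            * ENNReal.ofReal ‖z‖ * weightedEnergy A) := by
        have hm1 := hQS (exitSet Ω z)
        have hm2 := hQS (exitSet Ω (-z))
        rw [lintegral_add_right _ (by fun_prop), lintegral_add_right _ (by fun_prop),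
          lintegral_const_mul' _ _ (by finiteness)]
        gcongr
        · exact h₂ A hA
        · exact hexit z rfl
        · exact hexit (-z) (norm_neg z)
    _ = _ := by ring

/-- Translates of the transport of a function, cut off by `Ω`. -/
theorem lintegral_transport_translate_le (hop : IsOpen Ω) (hc : 0 < c)
    (hsc : StronglyConvexSet c Ω) (hd : ∀ x ∈ Ω, ∀ y ∈ Ω, ‖x - y‖ ≤ d) (hd0 : 0 < d)
    (hν : Measurable ν) (hν0 : ∀ w, 0 ≤ ν w) (hh : Measurable h)
    (hsupp : ∀ x ∉ Ω, ∀ w, h (x, w) = 0) (hfin : weightedEnergy h < ∞) (z : E3) :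
    ∫⁻ v, ∫⁻ x, ‖Ω.indicator (lineTransport d (ν v) v fun y => h (y, v)) (x + z)
        - Ω.indicator (lineTransport d (ν v) v fun y => h (y, v)) x‖ₑ ^ 2
      ≤ ENNReal.ofReal (d ^ 2) * (∫⁻ v, ENNReal.ofReal (‖v‖⁻¹ ^ 2)
          * ∫⁻ x, ‖h (x + z, v) - h (x, v)‖ₑ ^ 2)
        + 2 * (ENNReal.ofReal (4 / c * ‖z‖) * weightedEnergy h) := by
  have hΩ := hop.measurableSet
  have hG := measurable_lineTransport (d := d) hν hh
  have hS := measurableSet_exitSet hΩ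
  have hGS : ∀ S : Set E3, Measurable fun v =>
      ∫⁻ x in S, ‖lineTransport d (ν v) v (fun y => h (y, v)) x‖ₑ ^ 2 :=
    fun S => Measurable.lintegral_prod_left' (f := fun p : E3 × E3 =>
      ‖lineTransport d (ν p.2) p.2 (fun y => h (y, p.2)) p.1‖ₑ ^ 2) (hG.enorm.pow_const 2)
  calc _ ≤ ∫⁻ v, (ENNReal.ofReal (d ^ 2) * (ENNReal.ofReal (‖v‖⁻¹ ^ 2)
          * ∫⁻ x, ‖h (x + z, v) - h (x, v)‖ₑ ^ 2)
        + ((∫⁻ x in exitSet Ω z, ‖lineTransport d (ν v) v (fun y => h (y, v)) x‖ₑ ^ 2)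
        + ∫⁻ x in exitSet Ω (-z), ‖lineTransport d (ν v) v (fun y => h (y, v)) x‖ₑ ^ 2)) := by
        refine lintegral_mono_ae ?_
        filter_upwards [ae_lintegral_slice_sq_lt_top hh hfin] with v hv
        have hhv : Measurable fun y => h (y, v) := by fun_prop
        have hm : Measurable (lineTransport d (ν v) v fun y => h (y, v)) :=
          measurable_lineTransport_comp hν hh measurable_id measurable_const
        refine (lintegral_indicator_translate_sub_sq_le hΩ hm z).trans ?_
        rw [add_assoc]
        gcongr
        -- The factor `(d / ‖v‖)²` lost here explains the weight `‖v‖⁻²` in the modulus estimate for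
        -- the average.
        refine (lintegral_lineTransport_translate_sub_sq_le (hν0 v) v hhv hv z).trans
          (le_of_eq ?_)
        rw [← mul_assoc, ← ENNReal.ofReal_mul (sq_nonneg d), ← ENNReal.ofReal_pow (by positivity),
          div_eq_mul_inv, mul_pow]
    _ ≤ _ := by
        have hm1 := hGS (exitSet Ω z)
        have hm2 := hGS (exitSet Ω (-z))
        rw [lintegral_add_right _ (by fun_prop),
          lintegral_add_right _ (hGS _), lintegral_const_mul' _ _ (by finiteness), two_mul]
        gcongr
        · exact setLIntegral_exitSet_transport_le hν0 hop hc hsc hd hh hsupp z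
        · have := setLIntegral_exitSet_transport_le hν0 hop hc hsc hd hh hsupp (-z)
          rwa [norm_neg] at this

end KineticDomain

end

/-! ### The Slobodeckij energy in terms of translates -/

noncomputable section

namespace KineticDomain

open Filter
open scoped ENNReal

theorem lintegral_Ioc_rpow {p : ℝ} (hp : 0 < p) :
    ∫⁻ r in Ioc (0 : ℝ) 1, ENNReal.ofReal (r ^ (p - 1)) = ENNReal.ofReal p⁻¹ := by
  have hi : IntegrableOn (fun r : ℝ => r ^ (p - 1)) (Ioc 0 1) :=
    (intervalIntegrable_iff_integrableOn_Ioc_of_le zero_le_one).1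
      (intervalIntegral.intervalIntegrable_rpow' (by linarith))
  rw [← ofReal_integral_eq_lintegral_ofReal hi
    ((ae_restrict_iff' measurableSet_Ioc).2 (Eventually.of_forall fun r hr =>
      Real.rpow_nonneg hr.1.le _)), ← intervalIntegral.integral_of_le zero_le_one,
    integral_rpow (Or.inl (by linarith))]
  congr 1
  rw [sub_add_cancel, Real.one_rpow, Real.zero_rpow hp.ne']
  simp

theorem lintegral_Ioi_rpow {p : ℝ} (hp : 0 < p) :
    ∫⁻ r in Ioi (1 : ℝ), ENNReal.ofReal (r ^ (-p - 1)) = ENNReal.ofReal p⁻¹ := by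
  rw [← ofReal_integral_eq_lintegral_ofReal (integrableOn_Ioi_rpow_of_lt (by linarith) one_pos)
    ((ae_restrict_iff' measurableSet_Ioi).2 (Eventually.of_forall fun r hr =>
      Real.rpow_nonneg (zero_le_one.trans hr.le) _)),
    integral_Ioi_rpow_of_lt (by linarith) one_pos]
  congr 1
  rw [Real.one_rpow]
  simp [neg_div]

/-- The singular integral of `min (|z|, 1)` against the Slobodeckij kernel. -/
theorem lintegral_norm_rpow_mul_min {ε : ℝ} (h0 : 0 < ε) (h1 : ε < 1 / 2) :
    ∫⁻ z : E3, ENNReal.ofReal (‖z‖ ^ (-(4 - 2 * ε))) * min (ENNReal.ofReal ‖z‖) 1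
      = (volume : Measure E3).toSphere univ * ENNReal.ofReal (1 / (2 * (ε * (1 - 2 * ε)))) := by
  rw [lintegral_polar (by fun_prop)]
  have hr : ∀ α : Metric.sphere (0 : E3) 1, ∫⁻ r in Ioi (0 : ℝ), ENNReal.ofReal (r ^ 2)
      * (ENNReal.ofReal (‖r • (α : E3)‖ ^ (-(4 - 2 * ε))) * min (ENNReal.ofReal ‖r • (α : E3)‖) 1)
      = ENNReal.ofReal (1 / (2 * (ε * (1 - 2 * ε)))) := by
    intro α
    have hα : ‖(α : E3)‖ = 1 := by simp
    -- The unit ball contributes `1 / (2 ε)` and its complement `1 / (1 - 2 ε)`; the sum is `1 / (2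
    -- ε (1 - 2 ε))`.
    rw [← Ioc_union_Ioi_eq_Ioi (zero_le_one (α := ℝ)),
      lintegral_union measurableSet_Ioi Ioc_disjoint_Ioi_same]
    have e1 : ∫⁻ r in Ioc (0 : ℝ) 1, ENNReal.ofReal (r ^ 2)
        * (ENNReal.ofReal (‖r • (α : E3)‖ ^ (-(4 - 2 * ε)))
          * min (ENNReal.ofReal ‖r • (α : E3)‖) 1) = ENNReal.ofReal (2 * ε)⁻¹ := by
      rw [← lintegral_Ioc_rpow (by positivity : 0 < 2 * ε)]
      refine setLIntegral_congr_fun measurableSet_Ioc fun r hr => ?_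
      have hr0 : 0 < r := hr.1
      simp only [norm_smul, hα, mul_one, Real.norm_eq_abs, abs_of_pos hr0]
      rw [min_eq_left (by rw [ENNReal.ofReal_le_one]; exact hr.2),
        ← ENNReal.ofReal_mul (by positivity), ← ENNReal.ofReal_mul (by positivity)]
      congr 1
      rw [← Real.rpow_natCast r 2]
      nth_rewrite 3 [← Real.rpow_one r]
      rw [← Real.rpow_add hr0, ← Real.rpow_add hr0]
      congr 1
      push_cast
      ring
    have e2 : ∫⁻ r in Ioi (1 : ℝ), ENNReal.ofReal (r ^ 2)
        * (ENNReal.ofReal (‖r • (α : E3)‖ ^ (-(4 - 2 * ε)))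
          * min (ENNReal.ofReal ‖r • (α : E3)‖) 1) = ENNReal.ofReal (1 - 2 * ε)⁻¹ := by
      rw [← lintegral_Ioi_rpow (by linarith : 0 < 1 - 2 * ε)]
      refine setLIntegral_congr_fun measurableSet_Ioi fun r hr => ?_
      have hr1 : 1 < r := hr
      have hr0 : 0 < r := by linarith
      simp only [norm_smul, hα, mul_one, Real.norm_eq_abs, abs_of_pos hr0]
      rw [min_eq_right (by rw [ENNReal.one_le_ofReal]; exact hr1.le), mul_one,
        ← ENNReal.ofReal_mul (by positivity)]
      congr 1
      rw [← Real.rpow_natCast r 2, ← Real.rpow_add hr0]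
      congr 1
      push_cast
      ring
    have h2 : 0 < 1 - 2 * ε := by linarith
    rw [e1, e2, ← ENNReal.ofReal_add (by positivity) (by positivity)]
    congr 1
    field_simp
    ring
  simp only [hr]
  rw [lintegral_const, mul_comm]

theorem slobodeckijEnergy_congr_ae {s : ℝ} {u u' : E3 × E3 → ℝ}
    (h : ∀ᵐ v, ∀ᵐ x, u (x, v) = u' (x, v)) :
    slobodeckijEnergy s univ u = slobodeckijEnergy s univ u' := by
  rw [slobodeckijEnergy, slobodeckijEnergy]
  refine lintegral_congr_ae ?_
  filter_upwards [h] with v hv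
  simp only [Measure.restrict_univ]
  refine lintegral_congr_ae ?_
  filter_upwards [hv] with y hy
  refine lintegral_congr_ae ?_
  filter_upwards [hv] with x hx
  rw [hx, hy]

/-- The Slobodeckij energy in terms of translates. -/
theorem slobodeckijEnergy_eq_lintegral_translate {s : ℝ} {u : E3 × E3 → ℝ} (hu : Measurable u) :
    slobodeckijEnergy s univ u = ∫⁻ z : E3, ENNReal.ofReal (‖z‖ ^ (-(3 + 2 * s)))
      * ∫⁻ v, ∫⁻ x, ‖u (x + z, v) - u (x, v)‖ₑ ^ 2 := by
  simp only [slobodeckijEnergy, Measure.restrict_univ]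
  have hm1 : Measurable fun q : (E3 × E3) × E3 =>
      ENNReal.ofReal (‖q.2‖ ^ (-(3 + 2 * s)))
        * ‖u (q.1.1 + q.2, q.1.2) - u (q.1.1, q.1.2)‖ₑ ^ 2 := by
    fun_prop
  have hpt : ∀ v y : E3, ∫⁻ x : E3, ENNReal.ofReal (|u (x, v) - u (y, v)| ^ 2
      / ‖x - y‖ ^ (3 + 2 * s)) = ∫⁻ z : E3, ENNReal.ofReal (‖z‖ ^ (-(3 + 2 * s)))
        * ‖u (y + z, v) - u (y, v)‖ₑ ^ 2 := by
    intro v y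
    rw [← lintegral_add_left_eq_self (fun x : E3 => ENNReal.ofReal (|u (x, v) - u (y, v)| ^ 2
      / ‖x - y‖ ^ (3 + 2 * s))) y]
    refine lintegral_congr fun z => ?_
    rw [add_sub_cancel_left, Real.rpow_neg (norm_nonneg _), ← ofReal_norm, Real.norm_eq_abs,
      ← ENNReal.ofReal_pow (abs_nonneg _), ← ENNReal.ofReal_mul (by positivity), div_eq_inv_mul]
  simp only [hpt]
  have hm2 : Measurable fun q : E3 × E3 => ∫⁻ x, ‖u (x + q.2, q.1) - u (x, q.1)‖ₑ ^ 2 :=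
    Measurable.lintegral_prod_right' (f := fun p : (E3 × E3) × E3 =>
      ‖u (p.2 + p.1.2, p.1.1) - u (p.2, p.1.1)‖ₑ ^ 2) (by fun_prop)
  calc ∫⁻ v : E3, ∫⁻ y : E3, ∫⁻ z : E3, ENNReal.ofReal (‖z‖ ^ (-(3 + 2 * s)))
        * ‖u (y + z, v) - u (y, v)‖ₑ ^ 2
      = ∫⁻ v : E3, ∫⁻ z : E3, ENNReal.ofReal (‖z‖ ^ (-(3 + 2 * s)))
        * ∫⁻ y : E3, ‖u (y + z, v) - u (y, v)‖ₑ ^ 2 := by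
        refine lintegral_congr fun v => ?_
        rw [lintegral_lintegral_swap (by simp only [Function.uncurry_def]; fun_prop)]
        refine lintegral_congr fun z => ?_
        rw [lintegral_const_mul' _ _ ENNReal.ofReal_ne_top]
    _ = ∫⁻ z : E3, ∫⁻ v : E3, ENNReal.ofReal (‖z‖ ^ (-(3 + 2 * s)))
        * ∫⁻ y : E3, ‖u (y + z, v) - u (y, v)‖ₑ ^ 2 := by
        rw [lintegral_lintegral_swap (by simp only [Function.uncurry_def]; fun_prop)]
    _ = _ := by
        refine lintegral_congr fun z => ?_
        rw [lintegral_const_mul' _ _ ENNReal.ofReal_ne_top]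

/-- The linear bound is used for `‖z‖ ≤ 1` and the constant one beyond. Order exactly `1 / 2` would
diverge logarithmically at `z = 0` with these bounds, which is the loss in `ε`. -/
theorem slobodeckijEnergy_le_of_translate {ε : ℝ} (h0 : 0 < ε) (h1 : ε < 1 / 2)
    {u : E3 × E3 → ℝ} (hu : Measurable u) {M : ℝ≥0∞}
    (hlin : ∀ z, ∫⁻ v, ∫⁻ x, ‖u (x + z, v) - u (x, v)‖ₑ ^ 2 ≤ ENNReal.ofReal ‖z‖ * M)
    (hbdd : ∀ z, ∫⁻ v, ∫⁻ x, ‖u (x + z, v) - u (x, v)‖ₑ ^ 2 ≤ M) :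
    slobodeckijEnergy (1 / 2 - ε) univ u
      ≤ (volume : Measure E3).toSphere univ * ENNReal.ofReal (1 / (2 * (ε * (1 - 2 * ε)))) * M := by
  rw [slobodeckijEnergy_eq_lintegral_translate hu, ← lintegral_norm_rpow_mul_min h0 h1,
    ← lintegral_mul_const _ (by fun_prop)]
  refine lintegral_mono fun z => ?_
  have e : -(3 + 2 * (1 / 2 - ε)) = -(4 - 2 * ε) := by ring
  rw [e, mul_assoc]
  gcongr
  rcases le_total (ENNReal.ofReal ‖z‖) 1 with h | h
  · rw [min_eq_left h]; exact hlin z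
  · rw [min_eq_right h, one_mul]; exact hbdd z

theorem enorm_sub_sq_le_two_mul (a b : ℝ) : ‖a - b‖ₑ ^ 2 ≤ 2 * ‖a‖ₑ ^ 2 + 2 * ‖b‖ₑ ^ 2 := by
  simp only [← ofReal_norm, ← ENNReal.ofReal_pow (norm_nonneg _)]
  have h2 : (2 : ℝ≥0∞) = ENNReal.ofReal 2 := by norm_num
  rw [h2, ← ENNReal.ofReal_mul (by norm_num), ← ENNReal.ofReal_mul (by norm_num),
    ← ENNReal.ofReal_add (by positivity) (by positivity)]
  refine ENNReal.ofReal_le_ofReal ?_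
  simp only [Real.norm_eq_abs, sq_abs]
  nlinarith [sq_nonneg (a + b)]

theorem lintegral_translate_sub_sq_le_four {u : E3 × E3 → ℝ} (hu : Measurable u) (z : E3) :
    ∫⁻ v, ∫⁻ x, ‖u (x + z, v) - u (x, v)‖ₑ ^ 2 ≤ 4 * ∫⁻ v, ∫⁻ x, ‖u (x, v)‖ₑ ^ 2 := by
  rw [← lintegral_const_mul' _ _ (by norm_num)]
  refine lintegral_mono fun v => ?_
  calc ∫⁻ x, ‖u (x + z, v) - u (x, v)‖ₑ ^ 2
      ≤ ∫⁻ x, (2 * ‖u (x + z, v)‖ₑ ^ 2 + 2 * ‖u (x, v)‖ₑ ^ 2) := by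
        refine lintegral_mono fun x => ?_
        exact enorm_sub_sq_le_two_mul _ _
    _ = 2 * (∫⁻ x, ‖u (x, v)‖ₑ ^ 2) + 2 * ∫⁻ x, ‖u (x, v)‖ₑ ^ 2 := by
        rw [lintegral_add_left (by fun_prop), lintegral_const_mul' _ _ (by norm_num),
          lintegral_const_mul' _ _ (by norm_num),
          lintegral_add_right_eq_self (fun x => ‖u (x, v)‖ₑ ^ 2) z]
    _ = _ := by ring

end KineticDomain

end

/-! ### Independence of representatives and assembly -/

noncomputable section

namespace KineticDomain

open Filter
open scoped ENNReal

variable {Ω : Set E3} {d : ℝ} {ν : E3 → ℝ}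

theorem phaseMeasure_eq_restrict (Ω : Set E3) :
    phaseMeasure Ω = ((volume : Measure E3).prod volume).restrict (Ω ×ˢ univ) := by
  rw [phaseMeasure, ← Measure.prod_restrict, Measure.restrict_univ]

theorem ae_phaseMeasure_iff (hΩ : MeasurableSet Ω) {P : E3 × E3 → Prop} :
    (∀ᵐ p ∂phaseMeasure Ω, P p)
      ↔ ∀ᵐ p ∂(volume : Measure E3).prod (volume : Measure E3), p.1 ∈ Ω → P p := by
  rw [phaseMeasure_eq_restrict, ae_restrict_iff' (hΩ.prod MeasurableSet.univ)]
  simp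

/-- Moving along the characteristics does not charge null sets. -/
theorem quasiMeasurePreserving_characteristic :
    Measure.QuasiMeasurePreserving (fun q : (E3 × E3) × ℝ => (q.1.1 - q.2 • q.1.2, q.1.2))
      (((volume : Measure E3).prod volume).prod volume) ((volume : Measure E3).prod volume) := by
  refine ⟨by fun_prop, Measure.AbsolutelyContinuous.mk fun S hS h0 => ?_⟩
  have hm : Measurable fun q : (E3 × E3) × ℝ => (q.1.1 - q.2 • q.1.2, q.1.2) := by fun_prop
  have hind : Measurable (S.indicator (1 : E3 × E3 → ℝ≥0∞)) := measurable_one.indicator hS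
  rw [Measure.map_apply hm hS, ← lintegral_indicator_one (hm hS),
    lintegral_prod_symm' _ (measurable_one.indicator (hm hS))]
  rw [lintegral_eq_zero_iff' (Measurable.lintegral_prod_left'
    (measurable_one.indicator (hm hS))).aemeasurable]
  refine Eventually.of_forall fun s => ?_
  have h1 : Measurable fun p : E3 × E3 => S.indicator (1 : E3 × E3 → ℝ≥0∞) (p.1 - s • p.2, p.2) :=
    hind.comp (by fun_prop)
  have e : ∫⁻ p : E3 × E3, ((fun q : (E3 × E3) × ℝ => (q.1.1 - q.2 • q.1.2, q.1.2)) ⁻¹' S).indicator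
      (1 : (E3 × E3) × ℝ → ℝ≥0∞) (p, s) ∂((volume : Measure E3).prod volume)
      = ∫⁻ p : E3 × E3, S.indicator (1 : E3 × E3 → ℝ≥0∞) (p.1 - s • p.2, p.2)
        ∂((volume : Measure E3).prod volume) := rfl
  simp only [Pi.zero_apply]
  rw [e, lintegral_prod_symm' _ h1]
  have e2 : ∀ v : E3, ∫⁻ x : E3, S.indicator (1 : E3 × E3 → ℝ≥0∞) (x - s • v, v)
      = ∫⁻ x : E3, S.indicator (1 : E3 × E3 → ℝ≥0∞) (x, v) := fun v =>
    lintegral_sub_right_eq_self (fun x : E3 => S.indicator (1 : E3 × E3 → ℝ≥0∞) (x, v)) (s • v)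
  simp only [e2]
  rw [← lintegral_prod_symm' _ hind, lintegral_indicator_one hS, h0]

theorem ae_snd_ne_zero :
    ∀ᵐ p ∂(volume : Measure E3).prod (volume : Measure E3), p.2 ≠ 0 := by
  have h0 : ∀ᵐ w : E3, w ≠ 0 := by simp [ae_iff]
  exact Measure.quasiMeasurePreserving_snd.ae h0

/-- The characteristic map in `(x, v, s)` does not charge null sets, so by Fubini almost every
characteristic meets the exceptional set only for a null set of times. -/
theorem transport_congr_ae (hop : IsOpen Ω) (hconv : Convex ℝ Ω)
    (hd : ∀ x ∈ Ω, ∀ y ∈ Ω, ‖x - y‖ ≤ d) {h h' : E3 × E3 → ℝ}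
    (hh : h =ᵐ[phaseMeasure Ω] h') :
    transport Ω ν h =ᵐ[phaseMeasure Ω] transport Ω ν h' := by
  have hΩ := hop.measurableSet
  have h1 := (ae_phaseMeasure_iff hΩ).1 hh
  have h2 := Measure.ae_ae_of_ae_prod (quasiMeasurePreserving_characteristic.ae h1)
  refine (ae_phaseMeasure_iff hΩ).2 ?_
  filter_upwards [h2, ae_snd_ne_zero] with p hp hp0 hpΩ
  obtain ⟨x, v⟩ := p
  rw [transport_eq_lineTransport hop hconv hd ν h hpΩ hp0,
    transport_eq_lineTransport hop hconv hd ν h' hpΩ hp0, lineTransport, lineTransport]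
  refine integral_congr_ae (ae_restrict_of_ae ?_)
  filter_upwards [hp] with s hs
  congr 1
  by_cases hm : x - s • v ∈ Ω
  · simp [zeroExtension, hm, hs hm]
  · simp [zeroExtension, hm]

theorem zeroExtension_of_mem (h : E3 × E3 → ℝ) {x : E3} (hx : x ∈ Ω) (v : E3) :
    zeroExtension Ω h (x, v) = h (x, v) := by
  simp [zeroExtension, hx]

theorem zeroExtension_of_notMem (h : E3 × E3 → ℝ) {x : E3} (hx : x ∉ Ω) (v : E3) :
    zeroExtension Ω h (x, v) = 0 := by
  simp [zeroExtension, hx]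

theorem measurable_zeroExtension (hΩ : MeasurableSet Ω) {h : E3 × E3 → ℝ} (hh : Measurable h) :
    Measurable (zeroExtension Ω h) :=
  hh.indicator (hΩ.prod MeasurableSet.univ)

theorem eLpNorm_two_sq {α : Type*} [MeasurableSpace α] {μ : Measure α} (f : α → ℝ) :
    eLpNorm f 2 μ ^ 2 = ∫⁻ x, ‖f x‖ₑ ^ 2 ∂μ := by
  rw [eLpNorm_eq_lintegral_rpow_enorm_toReal (by norm_num) (by norm_num), ← ENNReal.rpow_natCast,
    ← ENNReal.rpow_mul]
  simp

theorem eLpNorm_zeroExtension_sq (hΩ : MeasurableSet Ω) {f : E3 × E3 → ℝ} (hf : Measurable f) :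
    eLpNorm f 2 (phaseMeasure Ω) ^ 2 = ∫⁻ w, ∫⁻ x, ‖zeroExtension Ω f (x, w)‖ₑ ^ 2 := by
  rw [eLpNorm_two_sq, phaseMeasure_eq_restrict,
    ← lintegral_indicator (hΩ.prod MeasurableSet.univ), lintegral_prod_symm']
  · refine lintegral_congr fun w => lintegral_congr fun x => ?_
    by_cases hx : x ∈ Ω <;> simp [zeroExtension, hx]
  · exact Measurable.indicator (by fun_prop) (hΩ.prod MeasurableSet.univ)

end KineticDomain

namespace Boltzmann

open KineticDomain Filter
open scoped ENNReal

variable {Ω : Set E3} {γ d Ck : ℝ} {B : ℝ → ℝ → ℝ}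

/-- Agreement at the point itself is needed for the local terms in `f(x, v)`, and agreement for
almost every velocity at the same `x` for the integral terms. -/
theorem collisionK_congr_ae (hγ0 : 0 ≤ γ) (hγ1 : γ ≤ 1) (hB : AngularCutoff γ B)
    {f f' : E3 × E3 → ℝ} (h : f =ᵐ[phaseMeasure Ω] f') :
    collisionK B f =ᵐ[phaseMeasure Ω] collisionK B f' := by
  have h1 : ∀ᵐ x ∂(volume : Measure E3).restrict Ω, ∀ᵐ w, f (x, w) = f' (x, w) :=
    Measure.ae_ae_of_ae_prod h
  have h2 : ∀ᵐ p ∂phaseMeasure Ω, ∀ᵐ w, f (p.1, w) = f' (p.1, w) :=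
    Measure.quasiMeasurePreserving_fst.ae h1
  filter_upwards [h, h2] with p hp hp2
  rw [collisionK, collisionK, hp, linearizedL_congr_ae hγ0 hγ1 hB hp2 hp]

theorem transportK_congr_ae (hop : IsOpen Ω) (hconv : Convex ℝ Ω)
    (hd : ∀ x ∈ Ω, ∀ y ∈ Ω, ‖x - y‖ ≤ d) (hγ0 : 0 ≤ γ) (hγ1 : γ ≤ 1) (hB : AngularCutoff γ B)
    {f f' : E3 × E3 → ℝ} (h : f =ᵐ[phaseMeasure Ω] f') :
    transportK Ω B f =ᵐ[phaseMeasure Ω] transportK Ω B f' :=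
  transport_congr_ae hop hconv hd (collisionK_congr_ae hγ0 hγ1 hB h)

theorem lintegral_gradKernel_mul_lt_top (v : E3) {φ : E3 → ℝ} (hφ : Measurable φ)
    (hfin : ∫⁻ w, ‖φ w‖ₑ ^ 2 < ∞) :
    ∫⁻ w, ENNReal.ofReal (gradKernel (w - v)) * ‖φ w‖ₑ < ∞ := by
  obtain ⟨C, hC, h⟩ := exists_lintegral_gradKernel_mul_sq_le
  have h1 : (∫⁻ w, ENNReal.ofReal (gradKernel (w - v)) * ‖φ w‖ₑ) ^ 2 < ∞ := by
    refine lt_of_le_of_lt (h v _ hφ.enorm) (ENNReal.mul_lt_top hC.lt_top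
      (lt_of_le_of_lt (lintegral_mono fun w => ?_) hfin))
    refine mul_le_of_le_one_left' ?_
    rw [ENNReal.ofReal_le_one, Real.exp_le_one_iff]
    nlinarith [sq_nonneg ‖w - v‖]
  simpa using (ENNReal.pow_lt_top_iff (n := 2)).1 h1

/-- The operator `K` maps `L²` to the weighted space. -/
theorem exists_weightedEnergy_collisionK_le (hΩ : MeasurableSet Ω) (hB : AngularCutoff γ B)
    (hCk : 0 ≤ Ck) {k : E3 → E3 → ℝ} (hk : ∀ v w, |k v w| ≤ Ck * gradKernel (w - v))
    (hkφ : ∀ v, ∀ φ : E3 → ℝ, Measurable φ →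
      ∫⁻ w, ENNReal.ofReal (gradKernel (w - v)) * ‖φ w‖ₑ < ∞ →
        linearizedL B φ v + collisionFrequency B v * φ v = ∫ w, k v w * φ w) :
    ∃ C : ℝ≥0∞, C ≠ ∞ ∧ ∀ f : E3 × E3 → ℝ, Measurable f →
      ∫⁻ w, ∫⁻ x, ‖f (x, w)‖ₑ ^ 2 < ∞ →
      weightedEnergy (zeroExtension Ω (collisionK B f)) ≤ C * ∫⁻ w, ∫⁻ x, ‖f (x, w)‖ₑ ^ 2 := by
  obtain ⟨C, hC, h⟩ := exists_lintegral_velocityWeight_mul_le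
  refine ⟨ENNReal.ofReal Ck ^ 2 * C, by finiteness, fun f hf hfin => ?_⟩
  have hAm := measurable_zeroExtension hΩ (measurable_collisionK hB hf)
  have hW := measurable_velocityWeight
  have hswap : ∫⁻ w, ∫⁻ x, ‖f (x, w)‖ₑ ^ 2 = ∫⁻ x, ∫⁻ w, ‖f (x, w)‖ₑ ^ 2 :=
    lintegral_lintegral_swap (by simp only [Function.uncurry_def]; fun_prop)
  have hae : ∀ᵐ x, ∫⁻ w, ‖f (x, w)‖ₑ ^ 2 < ∞ :=
    ae_lt_top (Measurable.lintegral_prod_right' (f := fun p : E3 × E3 => ‖f p‖ₑ ^ 2)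
      (by fun_prop)) (by rw [← hswap]; exact hfin.ne)
  calc weightedEnergy (zeroExtension Ω (collisionK B f))
      = ∫⁻ v, ∫⁻ x, velocityWeight v * ‖zeroExtension Ω (collisionK B f) (x, v)‖ₑ ^ 2 := by
        refine lintegral_congr fun v => ?_
        rw [lintegral_const_mul _ (by fun_prop)]
    _ = ∫⁻ x, ∫⁻ v, velocityWeight v * ‖zeroExtension Ω (collisionK B f) (x, v)‖ₑ ^ 2 :=
        lintegral_lintegral_swap (by simp only [Function.uncurry_def]; fun_prop)
    _ ≤ ∫⁻ x, ENNReal.ofReal Ck ^ 2 * C * ∫⁻ w, ‖f (x, w)‖ₑ ^ 2 := by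
        refine lintegral_mono_ae ?_
        filter_upwards [hae] with x hx
        have hfx : Measurable fun w => f (x, w) := by fun_prop
        calc _ ≤ ∫⁻ v, ENNReal.ofReal Ck ^ 2 * (velocityWeight v
              * (∫⁻ w, ENNReal.ofReal (gradKernel (w - v)) * ‖f (x, w)‖ₑ) ^ 2) := by
              refine lintegral_mono fun v => ?_
              rw [mul_left_comm, ← mul_pow]
              gcongr
              have h1 : ‖zeroExtension Ω (collisionK B f) (x, v)‖ₑ ≤ ‖collisionK B f (x, v)‖ₑ := by
                by_cases hxΩ : x ∈ Ω <;> simp [zeroExtension, hxΩ]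
              refine h1.trans ?_
              rw [collisionK]
              rw [hkφ v _ hfx (lintegral_gradKernel_mul_lt_top v hfx hx)]
              refine (enorm_integral_le_lintegral_enorm _).trans ?_
              rw [← lintegral_const_mul' _ _ ENNReal.ofReal_ne_top]
              refine lintegral_mono fun w => ?_
              rw [enorm_mul, ← mul_assoc]
              gcongr
              exact enorm_kernel_le hCk (hk v) w
          _ ≤ _ := by
              rw [lintegral_const_mul' _ _ (by finiteness), mul_assoc]
              gcongr
              exact h _ hfx.enorm
    _ = _ := by rw [lintegral_const_mul' _ _ (by finiteness), hswap]

/-- Translates of `S K S K f`. -/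
theorem exists_translate_bound (hΩ : IsPositivelyCurved Ω) (hγ0 : 0 ≤ γ) (hγ1 : γ ≤ 1)
    (hB : AngularCutoff γ B) :
    ∃ C : ℝ≥0∞, C ≠ ∞ ∧ ∀ f : E3 × E3 → ℝ, Measurable f →
      ∫⁻ w, ∫⁻ x, ‖f (x, w)‖ₑ ^ 2 < ∞ →
      ∃ u : E3 × E3 → ℝ, Measurable u ∧
        (∀ x v, v ≠ 0 → zeroExtension Ω (transportK Ω B (transportK Ω B f)) (x, v) = u (x, v)) ∧
        ∫⁻ v, ∫⁻ x, ‖u (x, v)‖ₑ ^ 2 ≤ C * ∫⁻ w, ∫⁻ x, ‖f (x, w)‖ₑ ^ 2 ∧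
        ∀ z, ∫⁻ v, ∫⁻ x, ‖u (x + z, v) - u (x, v)‖ₑ ^ 2
          ≤ ENNReal.ofReal ‖z‖ * (C * ∫⁻ w, ∫⁻ x, ‖f (x, w)‖ₑ ^ 2) := by
  obtain ⟨c, hc, hsc⟩ := hΩ.exists_stronglyConvexSet
  have hop := hΩ.isOpen
  have hconv := hΩ.convex
  have hΩm := hop.measurableSet
  obtain ⟨d, hd0, hd⟩ : ∃ d : ℝ, 0 < d ∧ ∀ x ∈ Ω, ∀ y ∈ Ω, ‖x - y‖ ≤ d := by
    obtain ⟨D, hD⟩ := Metric.isBounded_iff.1 hΩ.isBounded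
    refine ⟨max D 1, by positivity, fun x hx y hy => ?_⟩
    rw [← dist_eq_norm]
    exact (hD hx hy).trans (le_max_left _ _)
  have hvol : volume Ω < ∞ := hΩ.isBounded.measure_lt_top
  obtain ⟨Ck, hCk, hker⟩ := hB.exists_kernel hγ0 hγ1
  choose k hkm hk hkφ using hker
  set ν := collisionFrequency B with hνdef
  have hν : Measurable ν := measurable_collisionFrequency hB
  have hν0 : ∀ w, 0 ≤ ν w := collisionFrequency_nonneg hγ0 hγ1 hB
  obtain ⟨C₁, hC₁, h₁⟩ := exists_weightedEnergy_collisionK_le (Ω := Ω) hΩm hB hCk.le hk hkφ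
  obtain ⟨C₂, hC₂, h₂⟩ :=
    exists_weightedEnergy_average_le (Ω := Ω) (d := d) hd0.le hCk.le hν hν0 hk
  obtain ⟨C₃, hC₃, h₃⟩ :=
    exists_lintegral_average_translate_le hop hvol hc hsc hd hd0 hCk.le hν hν0 hkm hk
  refine ⟨ENNReal.ofReal (d ^ 2) * (C₂ * C₁) + (ENNReal.ofReal (d ^ 2) * (C₃ * C₁)
    + 2 * (ENNReal.ofReal (4 / c) * (C₂ * C₁))), by finiteness, fun f hf hfin => ?_⟩
  set N := ∫⁻ w, ∫⁻ x, ‖f (x, w)‖ₑ ^ 2 with hN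
  set A := zeroExtension Ω (collisionK B f) with hA
  have hAm : Measurable A := measurable_zeroExtension hΩm (measurable_collisionK hB hf)
  have hAs : ∀ x ∉ Ω, ∀ w, A (x, w) = 0 := fun x hx w => zeroExtension_of_notMem _ hx w
  have hAN : weightedEnergy A ≤ C₁ * N := h₁ f hf hfin
  have hAfin : weightedEnergy A < ∞ := lt_of_le_of_lt hAN (ENNReal.mul_lt_top hC₁.lt_top hfin)
  -- `g` is a jointly measurable model of `S K f`, and `h` below one of `K S K f`; in `Ω` they agree
  -- with the operators for every nonzero velocity. This suffices because neither transport nor `L`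
  -- sees the velocity zero.
  set g : E3 × E3 → ℝ := zeroExtension Ω fun p =>
    lineTransport d (ν p.2) p.2 (fun y => A (y, p.2)) p.1 with hg
  have hgm : Measurable g := measurable_zeroExtension hΩm (measurable_lineTransport hν hAm)
  set h := zeroExtension Ω (collisionK B g) with hh
  have hhm : Measurable h := measurable_zeroExtension hΩm (measurable_collisionK hB hgm)
  have hhs : ∀ x ∉ Ω, ∀ w, h (x, w) = 0 := fun x hx w => zeroExtension_of_notMem _ hx w
  have hgfin : ∀ᵐ x, ∫⁻ w, ‖g (x, w)‖ₑ ^ 2 < ∞ := by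
    refine ae_lt_top (Measurable.lintegral_prod_right' (f := fun p : E3 × E3 => ‖g p‖ₑ ^ 2)
      (by fun_prop)) ?_
    rw [lintegral_lintegral_swap (by simp only [Function.uncurry_def]; fun_prop)]
    refine (lt_of_le_of_lt (lintegral_mono fun w => lintegral_mono fun x => ?_)
      (lt_of_le_of_lt (lintegral_transport_sq_le hν0 hd0.le hAm)
        (ENNReal.mul_lt_top ENNReal.ofReal_lt_top hAfin))).ne
    by_cases hx : x ∈ Ω <;> simp [hg, zeroExtension, hx]
  -- For every `v`, with one exceptional null set of positions, `K` may be written with its kernel.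
  -- Inside `Ω` the cut-off in `g` is invisible, as `K` does not move `x`, so `h` is a velocity
  -- average over the whole space multiplied by the indicator of `Ω`.
  have hhP : ∀ v, ∀ᵐ x, h (x, v) = Ω.indicator (transportAverage d ν A (k v)) x := by
    intro v
    filter_upwards [hgfin] with x hx
    by_cases hxΩ : x ∈ Ω
    · have hgx : Measurable fun w => g (x, w) := by fun_prop
      rw [hh, zeroExtension_of_mem _ hxΩ, collisionK, indicator_of_mem hxΩ]
      rw [hkφ v _ hgx (lintegral_gradKernel_mul_lt_top v hgx hx), transportAverage]
      refine integral_congr_ae (Eventually.of_forall fun w => ?_)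
      simp only [hg, zeroExtension_of_mem _ hxΩ]
    · rw [hhs x hxΩ, indicator_of_notMem hxΩ]
  have hhN : weightedEnergy h ≤ C₂ * (C₁ * N) :=
    (h₂ A h hAm hhP).trans (mul_le_mul_right hAN _)
  have hhfin : weightedEnergy h < ∞ := lt_of_le_of_lt hhN (by finiteness)
  have hfirst : ∀ x ∈ Ω, ∀ w, w ≠ 0 → transportK Ω B f (x, w) = g (x, w) := by
    intro x hx w hw
    rw [hg, zeroExtension_of_mem _ hx, transportK,
      transport_eq_lineTransport hop hconv hd _ _ hx hw]
  have hsecond : ∀ y v, v ≠ 0 →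
      zeroExtension Ω (collisionK B (transportK Ω B f)) (y, v) = h (y, v) := by
    intro y v hv
    by_cases hy : y ∈ Ω
    · rw [hh, zeroExtension_of_mem _ hy, zeroExtension_of_mem _ hy, collisionK, collisionK,
        hfirst y hy v hv]
      congr 1
      refine linearizedL_congr_ae hγ0 hγ1 hB ?_ (hfirst y hy v hv)
      have h0 : ∀ᵐ w : E3, w ≠ 0 := by simp [ae_iff]
      filter_upwards [h0] with w hw using hfirst y hy w hw
    · rw [hhs y hy, zeroExtension_of_notMem _ hy]
  set u : E3 × E3 → ℝ := fun p =>
    Ω.indicator (lineTransport d (ν p.2) p.2 fun y => h (y, p.2)) p.1 with hu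
  have hum : Measurable u := by
    have : u = zeroExtension Ω fun p =>
        lineTransport d (ν p.2) p.2 (fun y => h (y, p.2)) p.1 := by
      funext p
      obtain ⟨x, v⟩ := p
      by_cases hx : x ∈ Ω <;> simp [hu, zeroExtension, hx]
    rw [this]
    exact measurable_zeroExtension hΩm (measurable_lineTransport hν hhm)
  refine ⟨u, hum, fun x v hv => ?_, ?_, fun z => ?_⟩
  · by_cases hx : x ∈ Ω
    · rw [zeroExtension_of_mem _ hx]
      simp only [hu]
      rw [indicator_of_mem hx, transportK, transport_eq_lineTransport hop hconv hd _ _ hx hv]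
      congr 1
      funext y
      exact hsecond y v hv
    · rw [zeroExtension_of_notMem _ hx]
      simp only [hu]
      rw [indicator_of_notMem hx]
  · calc ∫⁻ v, ∫⁻ x, ‖u (x, v)‖ₑ ^ 2
        ≤ ∫⁻ v, ∫⁻ x, ‖lineTransport d (ν v) v (fun y => h (y, v)) x‖ₑ ^ 2 := by
          refine lintegral_mono fun v => lintegral_mono fun x => ?_
          by_cases hx : x ∈ Ω <;> simp [hu, hx]
      _ ≤ ENNReal.ofReal (d ^ 2) * weightedEnergy h := lintegral_transport_sq_le hν0 hd0.le hhm
      _ ≤ ENNReal.ofReal (d ^ 2) * (C₂ * (C₁ * N)) := by gcongr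
      _ = ENNReal.ofReal (d ^ 2) * (C₂ * C₁) * N := by ring
      _ ≤ _ := mul_le_mul_left le_self_add _
  · calc ∫⁻ v, ∫⁻ x, ‖u (x + z, v) - u (x, v)‖ₑ ^ 2
        ≤ _ := lintegral_transport_translate_le hop hc hsc hd hd0 hν hν0 hhm hhs hhfin z
      _ ≤ ENNReal.ofReal (d ^ 2) * (C₃ * ENNReal.ofReal ‖z‖ * (C₁ * N))
          + 2 * (ENNReal.ofReal (4 / c * ‖z‖) * (C₂ * (C₁ * N))) := by
          gcongr
          exact (h₃ A h hAm hAs hAfin hhP z).trans (mul_le_mul_right hAN _)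
      _ = ENNReal.ofReal ‖z‖ * ((ENNReal.ofReal (d ^ 2) * (C₃ * C₁)
          + 2 * (ENNReal.ofReal (4 / c) * (C₂ * C₁))) * N) := by
          rw [ENNReal.ofReal_mul (by positivity : 0 ≤ 4 / c)]
          ring
      _ ≤ _ := mul_le_mul_right (mul_le_mul_left le_add_self _) _

end Boltzmann

end

/-! ### The theorem -/

namespace Boltzmann

open KineticDomain Filter
open scoped ENNReal

theorem rpow_half_le_of_le_sq {S y : ℝ≥0∞} (h : S ≤ y ^ 2) : S ^ (1 / 2 : ℝ) ≤ y := by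
  calc S ^ (1 / 2 : ℝ) ≤ (y ^ 2) ^ (1 / 2 : ℝ) := ENNReal.rpow_le_rpow h (by norm_num)
    _ = y := by
        rw [← ENNReal.rpow_natCast, ← ENNReal.rpow_mul]
        norm_num

end Boltzmann

theorem mainTheorem2 (Ω : Set E3) (hΩ : KineticDomain.IsPositivelyCurved Ω)
    (γ : ℝ) (hγ0 : 0 ≤ γ) (hγ1 : γ ≤ 1)
    (B : ℝ → ℝ → ℝ) (hB : Boltzmann.AngularCutoff γ B) :
    ∃ C : ℝ, 0 < C ∧ ∀ ε : ℝ, 0 < ε → ε < 1 / 2 →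
      ∀ f : E3 × E3 → ℝ, MemLp f 2 (KineticDomain.phaseMeasure Ω) →
        KineticDomain.MemMixedSobolev (1 / 2 - ε) Set.univ
            (KineticDomain.zeroExtension Ω
              (Boltzmann.transportK Ω B (Boltzmann.transportK Ω B f))) ∧
          KineticDomain.mixedSobolevNorm (1 / 2 - ε) Set.univ
              (KineticDomain.zeroExtension Ω
                (Boltzmann.transportK Ω B (Boltzmann.transportK Ω B f)))
            ≤ ENNReal.ofReal (C / Real.sqrt (ε * (1 - 2 * ε)))
                * eLpNorm f 2 (KineticDomain.phaseMeasure Ω) := by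
  obtain ⟨C, hC, hbound⟩ := Boltzmann.exists_translate_bound hΩ hγ0 hγ1 hB
  have hop := hΩ.isOpen
  have hΩm := hop.measurableSet
  obtain ⟨d, hd⟩ : ∃ d : ℝ, ∀ x ∈ Ω, ∀ y ∈ Ω, ‖x - y‖ ≤ d := by
    obtain ⟨D, hD⟩ := Metric.isBounded_iff.1 hΩ.isBounded
    refine ⟨D, fun x hx y hy => ?_⟩
    rw [← dist_eq_norm]
    exact hD hx hy
  set σ := (volume : Measure E3).toSphere univ with hσ
  have hσfin : σ ≠ ⊤ := measure_ne_top _ _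
  -- `C` bounds the `L²` part and `σ * (4 * C)` the Slobodeckij part, with `σ` the area of the
  -- sphere.
  set D := C + σ * (4 * C) with hD
  have hDfin : D ≠ ⊤ := by finiteness
  refine ⟨Real.sqrt D.toReal + 1, by positivity, fun ε hε hε' f hf => ?_⟩
  set X := ε * (1 - 2 * ε) with hX
  have hX0 : 0 < X := mul_pos hε (by linarith)
  have hX1 : X ≤ 1 := by rw [hX]; nlinarith
  set n := eLpNorm f 2 (KineticDomain.phaseMeasure Ω) with hn
  -- The estimates are proved for measurable functions on the whole space; `f₀` is such a
  -- representative of `f` on `Ω`, and `S K` respects equality almost everywhere.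
  set f₀ := KineticDomain.zeroExtension Ω (hf.1.mk f) with hf₀
  have hmk : Measurable (hf.1.mk f) := hf.1.stronglyMeasurable_mk.measurable
  have hf₀m : Measurable f₀ := KineticDomain.measurable_zeroExtension hΩm hmk
  have hN : ∫⁻ w, ∫⁻ x, ‖f₀ (x, w)‖ₑ ^ 2 = n ^ 2 := by
    rw [hf₀, ← KineticDomain.eLpNorm_zeroExtension_sq hΩm hmk]
    exact congrArg (· ^ 2) (eLpNorm_congr_ae hf.1.ae_eq_mk).symm
  have hnfin : n ≠ ⊤ := hf.2.ne
  have hff₀ : f =ᵐ[KineticDomain.phaseMeasure Ω] f₀ := by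
    rw [Filter.EventuallyEq, KineticDomain.ae_phaseMeasure_iff hΩm]
    filter_upwards [(KineticDomain.ae_phaseMeasure_iff hΩm).1 hf.1.ae_eq_mk] with p hp hpΩ
    rw [hp hpΩ, hf₀]
    exact (KineticDomain.zeroExtension_of_mem _ hpΩ p.2).symm
  obtain ⟨u, hum, huU, hu2, hutr⟩ := hbound f₀ hf₀m (by rw [hN]; finiteness)
  rw [hN] at hu2 hutr
  set U := KineticDomain.zeroExtension Ω (Boltzmann.transportK Ω B (Boltzmann.transportK Ω B f))
    with hU
  have hUu : U =ᵐ[(volume : Measure E3).prod (volume : Measure E3)] u := by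
    have h2 := Boltzmann.transportK_congr_ae hop hΩ.convex hd hγ0 hγ1 hB
      (Boltzmann.transportK_congr_ae hop hΩ.convex hd hγ0 hγ1 hB hff₀)
    rw [Filter.EventuallyEq, KineticDomain.ae_phaseMeasure_iff hΩm] at h2
    filter_upwards [h2, KineticDomain.ae_snd_ne_zero] with p hp hp0
    obtain ⟨x, v⟩ := p
    rw [← huU x v hp0, hU]
    by_cases hx : x ∈ Ω
    · rw [KineticDomain.zeroExtension_of_mem _ hx, KineticDomain.zeroExtension_of_mem _ hx]
      exact hp hx
    · rw [KineticDomain.zeroExtension_of_notMem _ hx, KineticDomain.zeroExtension_of_notMem _ hx]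
  have hUslice : ∀ᵐ v, ∀ᵐ x, U (x, v) = u (x, v) :=
    Measure.ae_ae_of_ae_prod (Measure.measurePreserving_swap.quasiMeasurePreserving.ae hUu)
  have hphase : KineticDomain.phaseMeasure univ
      = (volume : Measure E3).prod (volume : Measure E3) := by
    rw [KineticDomain.phaseMeasure, Measure.restrict_univ]
  have hUnorm : eLpNorm U 2 (KineticDomain.phaseMeasure univ) ^ 2 ≤ C * n ^ 2 := by
    rw [hphase, eLpNorm_congr_ae hUu, KineticDomain.eLpNorm_two_sq,
      lintegral_prod_symm' _ (by fun_prop)]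
    exact hu2
  -- Since `X ≤ 1`, the `L²` part also carries the factor `1 / X` and merges with the energy.
  have hXinv : 1 ≤ ENNReal.ofReal (1 / X) := by
    rw [ENNReal.one_le_ofReal, le_div_iff₀ hX0]
    linarith
  have hUE : KineticDomain.slobodeckijEnergy (1 / 2 - ε) univ U
      ≤ σ * ENNReal.ofReal (1 / X) * (4 * (C * n ^ 2)) := by
    rw [KineticDomain.slobodeckijEnergy_congr_ae hUslice]
    -- The factor 4 comes from the trivial bound on a difference of translates; the same `M` then
    -- serves the linear bound as well.
    refine (KineticDomain.slobodeckijEnergy_le_of_translate hε hε' hum (M := 4 * (C * n ^ 2))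
      (fun z => (hutr z).trans ?_) fun z => ?_).trans ?_
    · refine mul_le_mul_right ?_ _
      exact le_mul_of_one_le_left' (by norm_num : (1 : ENNReal) ≤ 4)
    · exact (KineticDomain.lintegral_translate_sub_sq_le_four hum z).trans (by gcongr)
    · gcongr
      linarith
  have hsum : eLpNorm U 2 (KineticDomain.phaseMeasure univ) ^ 2
      + KineticDomain.slobodeckijEnergy (1 / 2 - ε) univ U
      ≤ D * ENNReal.ofReal (1 / X) * n ^ 2 := by
    calc _ ≤ C * n ^ 2 * ENNReal.ofReal (1 / X)
          + σ * ENNReal.ofReal (1 / X) * (4 * (C * n ^ 2)) :=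
          add_le_add (hUnorm.trans (le_mul_of_one_le_right' hXinv)) hUE
      _ = _ := by rw [hD]; ring
  refine ⟨⟨⟨?_, ?_⟩, ?_⟩, ?_⟩
  · rw [hphase]
    exact hum.aestronglyMeasurable.congr hUu.symm
  · have h2 : eLpNorm U 2 (KineticDomain.phaseMeasure univ) ^ 2 < ⊤ :=
      lt_of_le_of_lt hUnorm (by finiteness)
    simpa using (ENNReal.pow_lt_top_iff (n := 2)).1 h2
  · exact lt_of_le_of_lt hUE (by finiteness)
  · rw [KineticDomain.mixedSobolevNorm]
    refine Boltzmann.rpow_half_le_of_le_sq (hsum.trans ?_)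
    rw [mul_pow]
    refine mul_le_mul_left ?_ _
    rw [← ENNReal.ofReal_toReal hDfin, ← ENNReal.ofReal_mul ENNReal.toReal_nonneg,
      ← ENNReal.ofReal_pow (by positivity)]
    refine ENNReal.ofReal_le_ofReal ?_
    rw [ENNReal.toReal_ofReal ENNReal.toReal_nonneg, div_pow, Real.sq_sqrt hX0.le, mul_one_div]
    gcongr
    -- The constant `√D + 1` is strictly positive even if `D = 0`, and its square is at least `D`.
    have h1 := Real.sq_sqrt (ENNReal.toReal_nonneg (a := D))
    nlinarith [Real.sqrt_nonneg D.toReal]
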